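/- Let $k$ be an algebraically closed field of characteristic zero. All operads are non-symmetric and binary quadratic: $\mathcal P=\mathcal P(\Omega,\Lambda)$ is the quotient of the free operad on a finite-dimensional space $\Omega$ of binary operations by the operadic ideal generated by a subspace $\Lambda\subset\Omega^{\otimes 2}\oplus\Omega^{\otimes 2}$, where $(\sum_i a_i\otimes b_i,\ \sum_j c_j\otimes d_j)\in\Lambda$ stands for the relation $\sum_i (x\,a_i\,y)\,b_i\,z=\sum_j x\,c_j\,(y\,d_j\,z)$. The black square product is $\mathcal P(\Omega,\Lambda)\,\blacksquare\,\mathcal P(\Omega',\Lambda')=\mathcal P(\Omega\otimes\Omega',\Lambda'')$, where $\Lambda''$ is spanned by the componentwise products $(u\otimes u',\,v\otimes v')$ (tensor factors rearranged) of relations $(u,v)\in\Lambda$, $(u',v')\in\Lambda'$. The quadratic dual is $\mathcal P^!=\mathcal P(\Omega^*,\Lambda^\perp)$, where $\Lambda^\perp$ is the annihilator of $\Lambda$ for the pairing $\langle(\varphi,\psi),(u,v)\rangle=\varphi(u)-\psi(v)$. The bar complex of $\mathcal P$ has in arity $n$ and degree $-i$ the space $\bigoplus_T\bigotimes_{v\in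 T}\mathcal P(|v|)^*$, where $T$ runs over the planar trees with $n$ leaves and $n-1-i$ vertices $v$, each with $|v|\ge 2$ inputs; its differential is the transpose of the signed sum of the contractions of internal edges by means of the partial compositions of $\mathcal P$, and in degree $0$ (binary trees) it is augmented by the canonical map, up to the standard signs, to $\mathcal P^!$. The operad $\mathcal P$ is Koszul if its bar complex is a resolution of $\mathcal P^!$, that is, if in every arity $n$ the augmented complex ending in $\mathcal P^!(n)\to 0$ is exact. Let $\mathcal Dend$ be the operad of dendriform algebras: it is generated by two operations $\prec,\succ$ subject to $$(x\prec y)\prec z=x\prec(y\prec z+y\succ z),\quad (x\succ y)\prec z=x\succ(y\prec z),\quad (x\prec y+x\succ y)\succ z=x\succ(y\succ z).$$ Then for every $m\ge 1$ the $m$-fold black square power $\mathcal Dend^{\blacksquare m}=\mathcal Dend\,\blacksquare\cdots\blacksquare\,\mathcal Dend$ is Koszul. (The case $m=3$ is the operad of octo-algebras.) -/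

import Mathlib

/-! Non-symmetric binary quadratic operads, their black square product, quadratic dual and
(dual) bar complex. Symmetric group actions are suppressed: all operads considered are
generated by finitely many binary operations with relations that keep the order of the inputs. -/

universe u

/-- Binary quadratic data over `k`: a finite basis `Gen` of the space `Ω` of binary operations
and a space of relations `Λ ⊆ Ω ⊗ Ω ⊕ Ω ⊗ Ω`, where `Ω ⊗ Ω` is written as `Gen × Gen → k`.
A pair `(φ, ψ) ∈ rel` stands for the relation
`∑ φ(a,b) (x a y) b z = ∑ ψ(a,b) x a (y b z)`. -/
structure QuadraticData (k : Type u) [Field k] where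
  Gen : Type
  [fintypeGen : Fintype Gen]
  [decEqGen : DecidableEq Gen]
  rel : Submodule k ((Gen × Gen → k) × (Gen × Gen → k))

attribute [instance] QuadraticData.fintypeGen QuadraticData.decEqGen

/-- Planar binary trees with vertices labelled by `G`. -/
inductive BinTree (G : Type) : Type
  | leaf : BinTree G
  | node (g : G) (l r : BinTree G) : BinTree G

namespace BinTree

variable {G : Type}

def leaves : BinTree G → ℕ
  | leaf => 1
  | node _ l r => l.leaves + r.leaves

def verts : BinTree G → ℕ
  | leaf => 0
  | node _ l r => l.verts + r.verts + 1

/-- Graft `s` onto the leaf number `i` of `t` (leaves are numbered from the left, from `0`). -/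
def graft : BinTree G → ℕ → BinTree G → BinTree G
  | leaf, _, s => s
  | node g l r, i, s =>
      if i < l.leaves then node g (l.graft i s) r else node g l (r.graft (i - l.leaves) s)

theorem leaves_graft (t : BinTree G) (i : ℕ) (s : BinTree G) :
    (t.graft i s).leaves + 1 = t.leaves + s.leaves := by
  induction t generalizing i with
  | leaf => simp [graft, leaves, add_comm]
  | node g l r ihl ihr =>
    unfold graft
    split
    · have := ihl i
      simp only [leaves]; omega
    · have := ihr (i - l.leaves)
      simp only [leaves]; omega

theorem leaves_pos (t : BinTree G) : 0 < t.leaves := by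
  induction t with
  | leaf => simp [leaves]
  | node g l r ihl ihr => simp only [leaves]; omega

theorem finite_leaves_le [Finite G] (n : ℕ) : {t : BinTree G | t.leaves ≤ n}.Finite := by
  induction n with
  | zero =>
    refine Set.finite_empty.subset fun t ht => ?_
    have := t.leaves_pos
    simp only [Set.mem_ofPred_eq] at ht
    omega
  | succ n ih =>
    have h : ((Set.univ : Set G) ×ˢ ({t : BinTree G | t.leaves ≤ n} ×ˢ
        {t : BinTree G | t.leaves ≤ n})).Finite := Set.finite_univ.prod (ih.prod ih)
    refine ((h.image fun x => node x.1 x.2.1 x.2.2).union (Set.finite_singleton leaf)).subset ?_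
    rintro (_ | ⟨g, l, r⟩) ht
    · right; rfl
    · left
      have h1 := l.leaves_pos
      have h2 := r.leaves_pos
      simp only [Set.mem_ofPred_eq, leaves] at ht
      refine ⟨(g, l, r), ?_, rfl⟩
      simp only [Set.mem_prod, Set.mem_univ, Set.mem_ofPred_eq, true_and]
      omega

instance [Finite G] (n : ℕ) : Finite {t : BinTree G // t.leaves = n} :=
  ((finite_leaves_le n).subset fun _ ht => le_of_eq ht : {t : BinTree G | t.leaves = n}.Finite)

/-- The tree of `(x a y) b z`. -/
def leftComb (a b : G) : {t : BinTree G // t.leaves = 3} :=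
  ⟨node b (node a leaf leaf) leaf, rfl⟩

/-- The tree of `x a (y b z)`. -/
def rightComb (a b : G) : {t : BinTree G // t.leaves = 3} :=
  ⟨node a leaf (node b leaf leaf), rfl⟩

/-- The sign of a binary tree that identifies the orientation of the tree by the planar
(root first, left to right) order of its edges with the suspension of the free operad on
binary operations. It is determined up to a global sign in each arity by the condition that
the two resolutions `(a b) c` and `a (b c)` of a ternary vertex enter a boundary with opposite
signs. -/
def sign : BinTree G → ℤ
  | leaf => 1
  | node _ l r => (-1) ^ l.verts * l.sign * r.sign

end BinTree

noncomputable section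

/-- The arity `n` part of the free non-symmetric operad on binary operations with basis `G`. -/
abbrev FreeOp (k : Type u) [Field k] (G : Type) (n : ℕ) : Type u :=
  {t : BinTree G // t.leaves = n} →₀ k

/-- Partial composition `∘ᵢ` (with `i` numbered from `0`) in the free operad. -/
def FreeOp.comp {k : Type u} [Field k] {G : Type} {m n l : ℕ} (i : Fin m) (h : l + 1 = m + n) :
    FreeOp k G m →ₗ[k] FreeOp k G n →ₗ[k] FreeOp k G l :=
  Finsupp.linearCombination k fun t =>
    Finsupp.lmapDomain k k fun s =>
      ⟨t.1.graft i s.1, by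
        have := t.1.leaves_graft i s.1
        have := t.2
        have := s.2
        omega⟩

namespace QuadraticData

variable {k : Type u} [Field k]

/-- The element `∑ φ(a,b) (x a y) b z - ∑ ψ(a,b) x a (y b z)` of the free operad. -/
def relator {G : Type} [Fintype G] (φ ψ : G × G → k) : FreeOp k G 3 :=
  ∑ p : G × G, Finsupp.single (BinTree.leftComb p.1 p.2) (φ p) -
    ∑ p : G × G, Finsupp.single (BinTree.rightComb p.1 p.2) (ψ p)

/-- Membership in the operadic ideal generated by the relations. -/
inductive InIdeal (P : QuadraticData k) : {n : ℕ} → FreeOp k P.Gen n → Prop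
  | rel {φ ψ : P.Gen × P.Gen → k} : (φ, ψ) ∈ P.rel → InIdeal P (relator φ ψ)
  | zero {n : ℕ} : InIdeal P (0 : FreeOp k P.Gen n)
  | add {n : ℕ} {x y : FreeOp k P.Gen n} : InIdeal P x → InIdeal P y → InIdeal P (x + y)
  | smul {n : ℕ} (a : k) {x : FreeOp k P.Gen n} : InIdeal P x → InIdeal P (a • x)
  | comp_left {m n l : ℕ} (i : Fin m) (h : l + 1 = m + n) {x : FreeOp k P.Gen m}
      (y : FreeOp k P.Gen n) : InIdeal P x → InIdeal P (FreeOp.comp i h x y)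
  | comp_right {m n l : ℕ} (i : Fin m) (h : l + 1 = m + n) (x : FreeOp k P.Gen m)
      {y : FreeOp k P.Gen n} : InIdeal P y → InIdeal P (FreeOp.comp i h x y)

def ideal (P : QuadraticData k) (n : ℕ) : Submodule k (FreeOp k P.Gen n) where
  carrier := {x | InIdeal P x}
  add_mem' := InIdeal.add
  zero_mem' := InIdeal.zero
  smul_mem' a _ := InIdeal.smul a

/-- The arity `n` part of the operad presented by `P`. -/
abbrev Op (P : QuadraticData k) (n : ℕ) : Type u := FreeOp k P.Gen n ⧸ P.ideal n

/-- Partial composition `∘ᵢ` (with `i` numbered from `0`) in the operad presented by `P`. -/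
def comp (P : QuadraticData k) {m n l : ℕ} (i : Fin m) (h : l + 1 = m + n) :
    P.Op m →ₗ[k] P.Op n →ₗ[k] P.Op l :=
  (P.ideal m).liftQ
    ((Submodule.mapQLinear (P.ideal n) (P.ideal l)).comp
      ((FreeOp.comp i h).codRestrict (Submodule.compatibleMaps (P.ideal n) (P.ideal l))
        fun x _ hy => InIdeal.comp_right i h x hy))
    (by
      intro x hx
      rw [LinearMap.mem_ker]
      ext y
      simp only [LinearMap.comp_apply, Submodule.mapQLinear, LinearMap.coe_mk, AddHom.coe_mk,
        LinearMap.zero_apply, Submodule.mkQ_apply]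
      exact (Submodule.Quotient.mk_eq_zero _).2 (InIdeal.comp_left i h _ hx))

/-- A generating operation as an element of the operad. -/
def gen (P : QuadraticData k) (g : P.Gen) : P.Op 2 :=
  (P.ideal 2).mkQ (Finsupp.single ⟨.node g .leaf .leaf, rfl⟩ 1)

/-- The black square product: the operations are pairs of operations, the relations are spanned
by the pairs of relations. -/
def blackSquare (P Q : QuadraticData k) : QuadraticData k where
  Gen := P.Gen × Q.Gen
  rel := Submodule.span k
    {r | ∃ s ∈ P.rel, ∃ t ∈ Q.rel,
      r = (fun x => s.1 (x.1.1, x.2.1) * t.1 (x.1.2, x.2.2),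
           fun x => s.2 (x.1.1, x.2.1) * t.2 (x.1.2, x.2.2))}

/-- The operad `As`: one associative operation. -/
def assoc (k : Type u) [Field k] : QuadraticData k where
  Gen := Unit
  rel := Submodule.span k {(fun _ => 1, fun _ => 1)}

/-- Black square powers `P ■ ⋯ ■ P` (`m` factors); the empty product is `As`, the unit of `■`. -/
def blackPow (P : QuadraticData k) : ℕ → QuadraticData k
  | 0 => assoc k
  | 1 => P
  | m + 2 => (blackPow P (m + 1)).blackSquare P

/-- The quadratic dual: generated by the dual basis, with relations the annihilator of `rel` for
the pairing `φ φ' - ψ ψ'`. -/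
def dual (P : QuadraticData k) : QuadraticData k where
  Gen := P.Gen
  rel :=
    { carrier := {s | ∀ r ∈ P.rel, ∑ x, s.1 x * r.1 x - ∑ x, s.2 x * r.2 x = 0}
      add_mem' := by
        intro s t hs ht r hr
        have h1 := hs r hr
        have h2 := ht r hr
        simp only [Prod.fst_add, Prod.snd_add, Pi.add_apply, add_mul, Finset.sum_add_distrib]
        linear_combination h1 + h2
      zero_mem' := by
        intro r _
        simp
      smul_mem' := by
        intro a s hs r hr
        have h1 := hs r hr
        simp only [Prod.smul_fst, Prod.smul_snd, Pi.smul_apply, smul_eq_mul, mul_assoc,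
          ← Finset.mul_sum]
        linear_combination a * h1 }

end QuadraticData

/-- The two operations `≺` and `≻` of dendriform algebras. -/
inductive DendOp : Type
  | prec
  | succ
  deriving DecidableEq

instance : Fintype DendOp := ⟨{.prec, .succ}, fun x => by cases x <;> decide⟩

/-- The operad of dendriform algebras, with the three relations
`(x ≺ y) ≺ z = x ≺ (y ≺ z + y ≻ z)`, `(x ≻ y) ≺ z = x ≻ (y ≺ z)`,
`(x ≺ y + x ≻ y) ≻ z = x ≻ (y ≻ z)`. -/
def Dend (k : Type u) [Field k] : QuadraticData k where
  Gen := DendOp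
  rel := Submodule.span k
    {(Pi.single (.prec, .prec) 1, Pi.single (.prec, .prec) 1 + Pi.single (.prec, .succ) 1),
     (Pi.single (.succ, .prec) 1, Pi.single (.succ, .prec) 1),
     (Pi.single (.prec, .succ) 1 + Pi.single (.succ, .succ) 1, Pi.single (.succ, .succ) 1)}

/-- Planar trees whose vertices have at least two inputs, a vertex with `n` inputs being
decorated by an element of `E n`. -/
inductive DecTree (E : ℕ → Type u) : Type u
  | leaf : DecTree E
  | node {n : ℕ} (hn : 2 ≤ n) (p : E n) (c : Fin n → DecTree E) : DecTree E

namespace DecTree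

variable {E : ℕ → Type u}

def leaves : DecTree E → ℕ
  | leaf => 1
  | node _ _ c => ∑ i, (c i).leaves

def verts : DecTree E → ℕ
  | leaf => 0
  | node _ _ c => 1 + ∑ i, (c i).verts

/-- Trees with a hole at the place of a subtree. -/
inductive Context (E : ℕ → Type u) : Type u
  | hole : Context E
  | node {n : ℕ} (hn : 2 ≤ n) (p : E n) (c : Fin n → DecTree E) (i : Fin n) (C : Context E) :
      Context E

def Context.fill : Context E → DecTree E → DecTree E
  | .hole, t => t
  | .node hn p c i C, t => .node hn p (Function.update c i (C.fill t))

/-- The list of subtrees in which the `i`-th entry of `c` is replaced by the list `e`. -/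
def splice {n s : ℕ} (c : Fin n → DecTree E) (i : Fin n) (e : Fin s → DecTree E) :
    Fin (n + s - 1) → DecTree E := fun j =>
  if h₁ : j.1 < i.1 then c ⟨j.1, h₁.trans i.2⟩
  else if h₂ : j.1 < i.1 + s then e ⟨j.1 - i.1, by omega⟩
  else c ⟨j.1 + 1 - s, by have := j.2; omega⟩

/-- A function on decorated trees is multilinear if it is linear in the decoration of each
vertex. On trees of a fixed shape such functions are the elements of the tensor product of the
dual spaces of the `E n` (for finite-dimensional `E n`), one factor for each vertex. -/
def IsMultilinear (k : Type u) [Field k] [∀ n, AddCommGroup (E n)] [∀ n, Module k (E n)]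
    (f : DecTree E → k) : Prop :=
  ∀ (C : Context E) {n : ℕ} (hn : 2 ≤ n) (c : Fin n → DecTree E),
    IsLinearMap k fun p : E n => f (C.fill (node hn p c))

end DecTree

namespace QuadraticData

variable {k : Type u} [Field k]

/-- Contraction of the edge between the root (decorated by `p`, with subtrees `c`) and its
`i`-th subtree `t`; zero if this edge is a leaf. -/
def contract (P : QuadraticData k) {n : ℕ} (hn : 2 ≤ n) (p : P.Op n) (c : Fin n → DecTree P.Op)
    (i : Fin n) : DecTree P.Op → (DecTree P.Op →₀ k)
  | .leaf => 0
  | .node (n := s) hs q e =>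
      Finsupp.single
        (.node (n := n + s - 1) (by omega) (P.comp i (by omega) p q) (DecTree.splice c i e)) 1

/-- The alternating sum of the contractions of all internal edges of a decorated tree. Each
internal edge is identified with its upper vertex, and the edges are numbered, from `0`, in the
planar order (root first, left to right); the `j`-th edge is contracted with sign `(-1)^j`. -/
def boundary (P : QuadraticData k) : DecTree P.Op → (DecTree P.Op →₀ k)
  | .leaf => 0
  | .node hn p c =>
      ∑ i, (-1 : k) ^ (∑ j ∈ Finset.univ.filter (· < i), (c j).verts) •
        (P.contract hn p c i (c i) -
          Finsupp.mapDomain (fun t => .node hn p (Function.update c i t)) (P.boundary (c i)))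

/-- The differential of the bar complex: the transpose of the edge contractions. -/
def barD (P : QuadraticData k) : (DecTree P.Op → k) →ₗ[k] (DecTree P.Op → k) where
  toFun f T := Finsupp.linearCombination k f (P.boundary T)
  map_add' f g := by
    funext T
    simp [Finsupp.linearCombination_apply, Finsupp.sum, mul_add, Finset.sum_add_distrib]
  map_smul' a f := by
    funext T
    simp only [Finsupp.linearCombination_apply, Finsupp.sum, Pi.smul_apply, smul_eq_mul,
      RingHom.id_apply, Finset.mul_sum]
    exact Finset.sum_congr rfl fun _ _ => by ring

/-- The arity `n`, degree `-i` part of the bar complex (the free operad on the linear dual of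
the operad): multilinear functions on decorated trees with `n` leaves and `n - 1 - i` vertices.
The differential maps `bar n (i + 1)` to `bar n i`, and `bar n 0` is the part given by binary
trees. -/
def bar (P : QuadraticData k) (n i : ℕ) : Submodule k (DecTree P.Op → k) where
  carrier := {f | DecTree.IsMultilinear k f ∧
    ∀ T, ¬ (T.leaves = n ∧ T.verts + i + 1 = n) → f T = 0}
  add_mem' := by
    rintro f g ⟨hf, hf'⟩ ⟨hg, hg'⟩
    refine ⟨fun C n hn c => ?_, fun T hT => ?_⟩
    · exact ((hf C hn c).mk' _ + (hg C hn c).mk' _).isLinear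
    · simp [hf' T hT, hg' T hT]
  zero_mem' := ⟨fun C n hn c => (0 : P.Op n →ₗ[k] k).isLinear, fun T _ => rfl⟩
  smul_mem' := by
    rintro a f ⟨hf, hf'⟩
    refine ⟨fun C n hn c => ?_, fun T hT => ?_⟩
    · exact (a • (hf C hn c).mk' _).isLinear
    · simp [hf' T hT]

/-- A binary tree labelled by generators, as a tree decorated by elements of the operad. -/
def ofBinTree (P : QuadraticData k) : BinTree P.Gen → DecTree P.Op
  | .leaf => .leaf
  | .node g l r => .node (n := 2) le_rfl (P.gen g) ![P.ofBinTree l, P.ofBinTree r]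

/-- The augmentation of the bar complex: an element of degree zero is a linear combination of
binary trees labelled by the dual basis of the generators, which is mapped to its class in the
quadratic dual operad. -/
def barAug (P : QuadraticData k) (n : ℕ) : (DecTree P.Op → k) →ₗ[k] P.dual.Op n :=
  (P.dual.ideal n).mkQ ∘ₗ
    (Finsupp.linearEquivFunOnFinite k k {t : BinTree P.Gen // t.leaves = n}).symm.toLinearMap ∘ₗ
      LinearMap.pi fun t => (t.1.sign : k) • LinearMap.proj (P.ofBinTree t.1)

/-- The operad presented by `P` is Koszul if its bar complex is a resolution of the quadratic
dual operad: in each arity the complex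
`⋯ → bar n 2 → bar n 1 → bar n 0 → P.dual.Op n → 0` is exact. -/
def IsKoszul (P : QuadraticData k) : Prop :=
  ∀ n : ℕ,
    (P.bar n 0).map (P.barAug n) = ⊤ ∧
    (P.bar n 1).map P.barD = P.bar n 0 ⊓ LinearMap.ker (P.barAug n) ∧
    ∀ i : ℕ, (P.bar n (i + 2)).map P.barD = P.bar n (i + 1) ⊓ LinearMap.ker P.barD

end QuadraticData

end

/-! In the basis `≺`, `* = ≺ + ≻` of its operations the dendriform operad is presented by rewriting
rules `(x a y) b z → ∑ c x p (y q z)` whose left sides are single left combs: `(x ≺ y) ≺ z → x ≺ (y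
* z)`, `(x * y) ≺ z → x ≺ (y * z) + x * (y ≺ z) - x ≺ (y ≺ z)` and `(x * y) * z → x * (y * z)`. They
are confluent: both ways of reducing `((u a' x) a y) b z` lead to the same combination of right
combs. The black square product multiplies left parts with left parts and right parts with right
parts, so products of rules are rules of the same form, and the confluence conditions of a product
factor into those of the two systems. Hence every power has such a presentation (`LeftPBW.prod`,
`LeftPBW.dendPow`), and it remains to show that an operad with such a presentation is Koszul
(`LeftPBW.isKoszul`).

Elements of the bar complex are encoded by their values on normal trees: binary trees without
reducible pairs, some of whose subtrees are put into boxes. A box marks an internal edge of the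
decorated tree, and what lies between boxes is a monomial decorating a vertex. The values on normal
trees determine a multilinear function (`eq_expand`) and can be prescribed (`ofNormal`); the latter
rests on confluence, in the form that trees are an algebra over the operad (`mul_relation`,
`treeAlg`). The differential becomes the removal of boxes (`barD_toDec`). Removing a box may create
a reducible pair, but then the normal form only contains trees of strictly smaller weight
(`normalForm_mem`).

So, up to lower weight, non-normal trees count as zero, and this simplified complex has an explicit
contracting homotopy, which boxes the last possible subtree (`homotopy_spec`). It fails only on
critical trees: left combs in which every inner node is boxed and every adjacent pair would be
reducible without the box. These live in degree zero. Correcting a cocycle weight by weight, with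
the weight bounded by `n * n`, gives exactness in positive degrees (`exact_bar`).

Degree zero is a matter of quadratic duality rather than of confluence. A function on trees with one
ternary vertex restricts, at that vertex, to a relation of the quadratic dual, and its coboundary is
this relation inserted at the vertex; the signs make the two resolutions of the vertex opposite
(`sign_mul_edges`, `barAug_barD`, `exact_bar_zero`). -/

noncomputable section

/-! ### Substitution and relations in the operad, in terms of classes of trees. -/

namespace BinTree

variable {G : Type}

theorem leaves_leaf : (leaf : BinTree G).leaves = 1 := rfl

theorem leaves_node (g : G) (l r : BinTree G) : (node g l r).leaves = l.leaves + r.leaves := rfl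

theorem leaves_corolla (g : G) : (node g leaf leaf).leaves = 2 := rfl

end BinTree

namespace QuadraticData

variable {k : Type u} [Field k]

/-- The class of a tree in the operad presented by `P`. -/
def treeClass (P : QuadraticData k) {n : ℕ} (t : BinTree P.Gen) (h : t.leaves = n) : P.Op n :=
  (P.ideal n).mkQ (Finsupp.single ⟨t, h⟩ 1)

theorem comp_treeClass (P : QuadraticData k) {m n l : ℕ} (i : Fin m) (h : l + 1 = m + n)
    (t s : BinTree P.Gen) (ht : t.leaves = m) (hs : s.leaves = n) :
    P.comp i h (P.treeClass t ht) (P.treeClass s hs) =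
      P.treeClass (t.graft i s) (by have := t.leaves_graft i s; omega) := by
  have : P.comp i h (P.treeClass t ht) (P.treeClass s hs) =
    (P.ideal l).mkQ (FreeOp.comp i h (Finsupp.single ⟨t, ht⟩ 1) (Finsupp.single ⟨s, hs⟩ 1)) := rfl
  rw [this]
  simp [FreeOp.comp, treeClass, Finsupp.lmapDomain_apply, Finsupp.mapDomain_single]

theorem op_induction (P : QuadraticData k) {n : ℕ} {motive : P.Op n → Prop}
    (tree : ∀ t h, motive (P.treeClass t h)) (zero : motive 0)
    (add : ∀ x y, motive x → motive y → motive (x + y))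
    (smul : ∀ (a : k) x, motive x → motive (a • x)) (p : P.Op n) : motive p := by
  obtain ⟨x, rfl⟩ := (P.ideal n).mkQ_surjective p
  induction x using Finsupp.induction_linear with
  | zero => simpa using zero
  | add x y hx hy => rw [map_add]; exact add _ _ hx hy
  | single t a =>
    have : Finsupp.single t a = a • Finsupp.single t (1 : k) := by simp
    rw [this, map_smul]
    exact smul _ _ (tree t.1 t.2)

theorem op_linearMap_ext (P : QuadraticData k) {n : ℕ} {M : Type*} [AddCommGroup M] [Module k M]
    {f g : P.Op n →ₗ[k] M} (h : ∀ t ht, f (P.treeClass t ht) = g (P.treeClass t ht)) : f = g := by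
  refine LinearMap.ext fun p => ?_
  induction p using P.op_induction with
  | tree t ht => exact h t ht
  | zero => simp
  | add x y hx hy => simp [hx, hy]
  | smul a x hx => simp [hx]

/-- The operation `(p, q) ↦ g(p, q)` of the operad, for a generator `g`. -/
def opNode (P : QuadraticData k) (g : P.Gen) {a b l : ℕ} (h : l = a + b) :
    P.Op a →ₗ[k] P.Op b →ₗ[k] P.Op l :=
  LinearMap.flip ((P.comp (0 : Fin (b + 1)) (by omega : l + 1 = (b + 1) + a)).comp
    (P.comp (1 : Fin 2) (by omega : b + 1 + 1 = 2 + b) (P.gen g)))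

theorem opNode_treeClass (P : QuadraticData k) (g : P.Gen) {a b l : ℕ} (h : l = a + b)
    (t s : BinTree P.Gen) (ht : t.leaves = a) (hs : s.leaves = b) :
    P.opNode g h (P.treeClass t ht) (P.treeClass s hs) =
      P.treeClass (.node g t s) (by simp only [BinTree.leaves]; omega) := by
  have hg : P.gen g = P.treeClass (n := 2) (.node g .leaf .leaf) (BinTree.leaves_corolla g) := rfl
  simp only [opNode, LinearMap.flip_apply, LinearMap.comp_apply, hg, comp_treeClass]
  rfl

theorem treeClass_congr (P : QuadraticData k) {n : ℕ} {t s : BinTree P.Gen} (e : t = s)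
    (h : t.leaves = n) : P.treeClass t h = P.treeClass s (e ▸ h) := by subst e; rfl

/-- Both sides are trilinear, so it suffices to compare them on classes of trees, where the identity
is the first branch of `graft`. Arities are tied by equations rather than computed, so that no casts
between the spaces `Op` arise. -/
theorem comp_opNode_left (P : QuadraticData k) (g : P.Gen) {a b l s l' a' : ℕ} (h : l = a + b)
    (i : Fin l) (i' : Fin a) (hi : i.1 = i'.1) (h' : l' + 1 = l + s) (h₁ : a' + 1 = a + s)
    (h₂ : l' = a' + b) (p : P.Op a) (q : P.Op b) (r : P.Op s) :
    P.comp i h' (P.opNode g h p q) r = P.opNode g h₂ (P.comp i' h₁ p r) q := by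
  suffices H : ((P.comp i h').comp ((P.opNode g h).flip q)).flip r =
      ((P.opNode g h₂).flip q).comp ((P.comp i' h₁).flip r) from LinearMap.congr_fun H p
  refine P.op_linearMap_ext fun t ht => ?_
  simp only [LinearMap.comp_apply, LinearMap.flip_apply]
  suffices H : ((P.comp i h').comp ((P.opNode g h) (P.treeClass t ht))).flip r =
      ((P.opNode g h₂) (P.comp i' h₁ (P.treeClass t ht) r)) from LinearMap.congr_fun H q
  refine P.op_linearMap_ext fun t₂ ht₂ => ?_
  simp only [LinearMap.comp_apply, LinearMap.flip_apply]
  suffices H : P.comp i h' (P.opNode g h (P.treeClass t ht) (P.treeClass t₂ ht₂)) =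
      ((P.opNode g h₂).flip (P.treeClass t₂ ht₂)).comp (P.comp i' h₁ (P.treeClass t ht)) from
    LinearMap.congr_fun H r
  refine P.op_linearMap_ext fun t₃ ht₃ => ?_
  simp only [LinearMap.comp_apply, LinearMap.flip_apply, opNode_treeClass, comp_treeClass]
  refine P.treeClass_congr ?_ _
  have := i'.2
  rw [BinTree.graft, if_pos (by omega), hi]

theorem comp_opNode_right (P : QuadraticData k) (g : P.Gen) {a b l s l' b' : ℕ} (h : l = a + b)
    (i : Fin l) (i' : Fin b) (hi : i.1 = a + i'.1) (h' : l' + 1 = l + s) (h₁ : b' + 1 = b + s)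
    (h₂ : l' = a + b') (p : P.Op a) (q : P.Op b) (r : P.Op s) :
    P.comp i h' (P.opNode g h p q) r = P.opNode g h₂ p (P.comp i' h₁ q r) := by
  suffices H : ((P.comp i h').comp ((P.opNode g h).flip q)).flip r =
      (P.opNode g h₂).flip (P.comp i' h₁ q r) from LinearMap.congr_fun H p
  refine P.op_linearMap_ext fun t ht => ?_
  simp only [LinearMap.comp_apply, LinearMap.flip_apply]
  suffices H : ((P.comp i h').comp ((P.opNode g h) (P.treeClass t ht))).flip r =
      ((P.opNode g h₂) (P.treeClass t ht)).comp ((P.comp i' h₁).flip r) from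
    LinearMap.congr_fun H q
  refine P.op_linearMap_ext fun t₂ ht₂ => ?_
  simp only [LinearMap.comp_apply, LinearMap.flip_apply]
  suffices H : P.comp i h' (P.opNode g h (P.treeClass t ht) (P.treeClass t₂ ht₂)) =
      (P.opNode g h₂ (P.treeClass t ht)).comp (P.comp i' h₁ (P.treeClass t₂ ht₂)) from
    LinearMap.congr_fun H r
  refine P.op_linearMap_ext fun t₃ ht₃ => ?_
  simp only [LinearMap.comp_apply, opNode_treeClass, comp_treeClass]
  refine P.treeClass_congr ?_ _
  rw [BinTree.graft, if_neg (by omega)]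
  congr 2
  omega

/-- The identity operation. -/
def opId (P : QuadraticData k) : P.Op 1 := P.treeClass (n := 1) .leaf BinTree.leaves_leaf

theorem comp_opId (P : QuadraticData k) {s : ℕ} (i : Fin 1) (h : s + 1 = 1 + s) (q : P.Op s) :
    P.comp i h P.opId q = q := by
  suffices H : P.comp i h P.opId = LinearMap.id from LinearMap.congr_fun H q
  refine P.op_linearMap_ext fun t ht => ?_
  rw [opId, comp_treeClass]
  rfl

theorem mkQ_relator (P : QuadraticData k) {φ ψ : P.Gen × P.Gen → k} :
    (P.ideal 3).mkQ (relator φ ψ) =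
      ∑ x, φ x • P.treeClass (n := 3) (BinTree.leftComb x.1 x.2).1
          (BinTree.leftComb x.1 x.2).2 -
        ∑ x, ψ x • P.treeClass (n := 3) (BinTree.rightComb x.1 x.2).1
          (BinTree.rightComb x.1 x.2).2 := by
  have hs : ∀ (t : {t : BinTree P.Gen // t.leaves = 3}) (a : k),
      Finsupp.single t a = a • Finsupp.single t (1 : k) := by simp
  simp only [relator, map_sub, map_sum]
  congr 1 <;> refine Finset.sum_congr rfl fun x _ => ?_ <;> rw [hs, map_smul] <;> rfl

/-- The arguments are inserted from right to left, so that the places still to be filled keep their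
numbers. -/
theorem comp_leftComb (P : QuadraticData k) (g₁ g₂ : P.Gen)
    {a b c ab bc l : ℕ} (h₁ : ab = a + b) (h₂ : l = ab + c) (h₃ : bc = b + c)
    (x : P.Op a) (y : P.Op b) (z : P.Op c) :
    P.comp (0 : Fin (1 + bc)) (by omega : l + 1 = (1 + bc) + a)
      (P.comp (⟨1, by omega⟩ : Fin (2 + c)) (by omega : 1 + bc + 1 = (2 + c) + b)
        (P.comp (2 : Fin 3) (by omega : 2 + c + 1 = 3 + c) (P.treeClass (n := 3)
          (BinTree.leftComb g₁ g₂).1 (BinTree.leftComb g₁ g₂).2) z) y) x =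
      P.opNode g₂ h₂ (P.opNode g₁ h₁ x y) z := by
  induction x using P.op_induction with
  | zero => simp
  | add _ _ h h' => simp only [map_add, LinearMap.add_apply, h, h']
  | smul _ _ h => simp only [map_smul, LinearMap.smul_apply, h]
  | tree t ht =>
  induction y using P.op_induction with
  | zero => simp
  | add _ _ h h' => simp only [map_add, LinearMap.add_apply, h, h']
  | smul _ _ h => simp only [map_smul, LinearMap.smul_apply, h]
  | tree t₂ ht₂ =>
  induction z using P.op_induction with
  | zero => simp
  | add _ _ h h' => simp only [map_add, LinearMap.add_apply, h, h']
  | smul _ _ h => simp only [map_smul, LinearMap.smul_apply, h]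
  | tree t₃ ht₃ =>
  simp only [opNode_treeClass, comp_treeClass]
  exact P.treeClass_congr (by simp [BinTree.leftComb, BinTree.graft, BinTree.leaves]) _

theorem comp_rightComb (P : QuadraticData k) (g₁ g₂ : P.Gen)
    {a b c ab bc l : ℕ} (h₁ : ab = a + b) (h₂ : l = ab + c) (h₃ : bc = b + c) (h₄ : l = a + bc)
    (x : P.Op a) (y : P.Op b) (z : P.Op c) :
    P.comp (0 : Fin (1 + bc)) (by omega : l + 1 = (1 + bc) + a)
      (P.comp (⟨1, by omega⟩ : Fin (2 + c)) (by omega : 1 + bc + 1 = (2 + c) + b)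
        (P.comp (2 : Fin 3) (by omega : 2 + c + 1 = 3 + c) (P.treeClass (n := 3)
          (BinTree.rightComb g₁ g₂).1 (BinTree.rightComb g₁ g₂).2) z) y) x =
      P.opNode g₁ h₄ x (P.opNode g₂ h₃ y z) := by
  induction x using P.op_induction with
  | zero => simp
  | add _ _ h h' => simp only [map_add, LinearMap.add_apply, h, h']
  | smul _ _ h => simp only [map_smul, LinearMap.smul_apply, h]
  | tree t ht =>
  induction y using P.op_induction with
  | zero => simp
  | add _ _ h h' => simp only [map_add, LinearMap.add_apply, h, h']
  | smul _ _ h => simp only [map_smul, LinearMap.smul_apply, h]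
  | tree t₂ ht₂ =>
  induction z using P.op_induction with
  | zero => simp
  | add _ _ h h' => simp only [map_add, LinearMap.add_apply, h, h']
  | smul _ _ h => simp only [map_smul, LinearMap.smul_apply, h]
  | tree t₃ ht₃ =>
  simp only [opNode_treeClass, comp_treeClass]
  exact P.treeClass_congr (by simp [BinTree.rightComb, BinTree.graft, BinTree.leaves]) _

/-- The relations hold in the operad. -/
theorem opNode_relation (P : QuadraticData k) {r : (P.Gen × P.Gen → k) × (P.Gen × P.Gen → k)}
    (hr : r ∈ P.rel) {a b c ab bc l : ℕ} (h₁ : ab = a + b) (h₂ : l = ab + c)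
    (h₃ : bc = b + c) (h₄ : l = a + bc) (x : P.Op a) (y : P.Op b) (z : P.Op c) :
    ∑ g, r.1 g • P.opNode g.2 h₂ (P.opNode g.1 h₁ x y) z =
      ∑ g, r.2 g • P.opNode g.1 h₄ x (P.opNode g.2 h₃ y z) := by
  have h0 : (P.ideal 3).mkQ (relator r.1 r.2) = 0 :=
    (Submodule.Quotient.mk_eq_zero _).2 (InIdeal.rel hr)
  -- Substitution of `x`, `y`, `z` as one linear map on ternary operations; applied to the vanishing
  -- class of the relator it gives the claim.
  let F : P.Op 3 →ₗ[k] P.Op l :=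
    ((P.comp (0 : Fin (1 + bc)) (by omega : l + 1 = (1 + bc) + a)).flip x).comp
      (((P.comp (⟨1, by omega⟩ : Fin (2 + c)) (by omega : 1 + bc + 1 = (2 + c) + b)).flip y).comp
        ((P.comp (2 : Fin 3) (by omega : 2 + c + 1 = 3 + c)).flip z))
  have hF := congrArg F h0
  rw [mkQ_relator, map_zero, map_sub, sub_eq_zero, map_sum, map_sum] at hF
  simp only [map_smul] at hF
  simp only [F, LinearMap.comp_apply, LinearMap.flip_apply] at hF
  simpa only [P.comp_leftComb _ _ h₁ h₂ h₃, P.comp_rightComb _ _ h₁ h₂ h₃ h₄] using hF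

end QuadraticData
end

/-! ### Algebras over the operad and evaluation of operations in them. -/

noncomputable section

namespace QuadraticData

variable {k : Type u} [Field k]

/-- An algebra over the operad presented by `P`. -/
structure Alg (P : QuadraticData k) (V : Type*) [AddCommGroup V] [Module k V] where
  op : P.Gen → V →ₗ[k] V →ₗ[k] V
  relation : ∀ r ∈ P.rel, ∀ x y z : V,
    ∑ g : P.Gen × P.Gen, r.1 g • op g.2 (op g.1 x y) z =
      ∑ g : P.Gen × P.Gen, r.2 g • op g.1 x (op g.2 y z)

namespace Alg

variable {P : QuadraticData k} {V : Type*} [AddCommGroup V] [Module k V] (A : P.Alg V)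

/-- The value of a tree at a sequence of elements of an algebra. -/
def evalTree : BinTree P.Gen → (ℕ → V) → V
  | .leaf, v => v 0
  | .node g l r, v => A.op g (evalTree l v) (evalTree r fun j => v (j + l.leaves))

theorem evalTree_congr (t : BinTree P.Gen) {v w : ℕ → V} (h : ∀ j < t.leaves, v j = w j) :
    A.evalTree t v = A.evalTree t w := by
  induction t generalizing v w with
  | leaf => exact h 0 (by simp [BinTree.leaves])
  | node g l r ihl ihr =>
    simp only [BinTree.leaves] at h
    simp only [evalTree]
    rw [ihl fun j hj => h j (by omega), ihr fun j hj => h (j + l.leaves) (by omega)]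

/-- Each leaf is used exactly once, so the value is linear in each entry separately. -/
theorem evalTree_update (t : BinTree P.Gen) (v : ℕ → V) (i : ℕ) (hi : i < t.leaves) :
    ∃ L : V →ₗ[k] V, ∀ x, A.evalTree t (Function.update v i x) = L x := by
  induction t generalizing v i with
  | leaf =>
    obtain rfl : i = 0 := by simp only [BinTree.leaves] at hi; omega
    exact ⟨LinearMap.id, fun x => by simp [evalTree]⟩
  | node g l r ihl ihr =>
    simp only [BinTree.leaves] at hi
    by_cases h : i < l.leaves
    · obtain ⟨L, hL⟩ := ihl v i h
      refine ⟨((A.op g).flip (A.evalTree r fun j => v (j + l.leaves))).comp L, fun x => ?_⟩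
      simp only [evalTree, hL, LinearMap.comp_apply, LinearMap.flip_apply]
      congr 2
      funext j
      rw [Function.update_of_ne (by omega)]
    · obtain ⟨L, hL⟩ := ihr (fun j => v (j + l.leaves)) (i - l.leaves) (by omega)
      refine ⟨(A.op g (A.evalTree l v)).comp L, fun x => ?_⟩
      simp only [evalTree, LinearMap.comp_apply, ← hL]
      rw [A.evalTree_congr l (w := v) fun j hj => Function.update_of_ne (by omega) _ _]
      congr 2
      funext j
      by_cases hj : j = i - l.leaves
      · subst hj
        rw [Function.update_self, show i - l.leaves + l.leaves = i by omega, Function.update_self]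
      · rw [Function.update_of_ne hj, Function.update_of_ne (by omega)]

/-- The sequence obtained from `v` by replacing the `s` entries from place `i` on by `x`. -/
def insertAt (v : ℕ → V) (i s : ℕ) (x : V) : ℕ → V :=
  Function.update (fun j => if j < i then v j else v (j + s - 1)) i x

theorem evalTree_graft (t : BinTree P.Gen) (i : ℕ) (hi : i < t.leaves) (s : BinTree P.Gen)
    (v : ℕ → V) : A.evalTree (t.graft i s) v =
      A.evalTree t (insertAt v i s.leaves (A.evalTree s fun j => v (j + i))) := by
  induction t generalizing i v with
  | leaf =>
    obtain rfl : i = 0 := by simp only [BinTree.leaves] at hi; omega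
    simp [BinTree.graft, evalTree, insertAt]
  | node g l r ihl ihr =>
    simp only [BinTree.leaves] at hi
    have hs := s.leaves_pos
    by_cases h : i < l.leaves
    · rw [BinTree.graft, if_pos h]
      simp only [evalTree]
      rw [ihl i h]
      congr 1
      refine A.evalTree_congr _ fun j _ => ?_
      have := l.leaves_graft i s
      rw [insertAt, Function.update_of_ne (by omega), if_neg (by omega)]
      congr 1
      omega
    · rw [BinTree.graft, if_neg h]
      simp only [evalTree]
      rw [ihr _ (by omega)]
      congr 1
      · congr 1
        refine A.evalTree_congr _ fun j hj => ?_
        rw [insertAt, Function.update_of_ne (by omega), if_pos (by omega)]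
      · refine A.evalTree_congr _ fun j hj => ?_
        simp only [insertAt]
        by_cases hj : j = i - l.leaves
        · subst hj
          rw [Function.update_self, show i - l.leaves + l.leaves = i by omega,
            Function.update_self]
          refine A.evalTree_congr _ fun j hj => ?_
          congr 1
          omega
        · rw [Function.update_of_ne hj, Function.update_of_ne (by omega)]
          split_ifs <;> first | rfl | (congr 1; omega)

/-- Evaluation of elements of the free operad. -/
def evalFree (n : ℕ) : FreeOp k P.Gen n →ₗ[k] (ℕ → V) → V :=
  Finsupp.linearCombination k fun t => A.evalTree t.1

theorem evalFree_single {n : ℕ} (t : {t : BinTree P.Gen // t.leaves = n}) (a : k) :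
    A.evalFree n (Finsupp.single t a) = a • A.evalTree t.1 := by
  simp [evalFree]

theorem evalFree_relator {φ ψ : P.Gen × P.Gen → k} (h : (φ, ψ) ∈ P.rel) :
    A.evalFree 3 (relator φ ψ) = 0 := by
  funext v
  have := A.relation _ h (v 0) (v 1) (v 2)
  simp only [relator, map_sub, map_sum, evalFree_single, BinTree.leftComb, BinTree.rightComb,
    Pi.sub_apply, Finset.sum_apply, Pi.smul_apply, evalTree, BinTree.leaves, Pi.zero_apply,
    sub_eq_zero]
  exact this

theorem evalFree_comp {m n l : ℕ} (i : Fin m) (h : l + 1 = m + n) (x : FreeOp k P.Gen m)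
    (y : FreeOp k P.Gen n) (v : ℕ → V) :
    A.evalFree l (FreeOp.comp i h x y) v =
      x.sum fun t a => y.sum fun s b => (a * b) •
        A.evalTree t.1 (insertAt v i n (A.evalTree s.1 fun j => v (j + i))) := by
  have key : ∀ (t : {t : BinTree P.Gen // t.leaves = m}) (s : {t : BinTree P.Gen // t.leaves = n}),
      A.evalTree (t.1.graft i s.1) v =
        A.evalTree t.1 (insertAt v i n (A.evalTree s.1 fun j => v (j + i))) := by
    intro t s
    rw [A.evalTree_graft t.1 i (by rw [t.2]; exact i.2), s.2]
  induction x using Finsupp.induction_linear with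
  | zero => simp
  | add x x' hx hx' =>
    rw [map_add, LinearMap.add_apply, map_add, Pi.add_apply, hx, hx',
      Finsupp.sum_add_index' (by simp) (by simp [add_mul, add_smul, Finsupp.sum_add])]
  | single t a =>
    rw [Finsupp.sum_single_index (by simp)]
    induction y using Finsupp.induction_linear with
    | zero => simp
    | add y y' hy hy' =>
      rw [map_add, map_add, Pi.add_apply, hy, hy',
        Finsupp.sum_add_index' (by simp) (by simp [mul_add, add_smul])]
    | single s b =>
      rw [Finsupp.sum_single_index (by simp), ← key]
      simp only [FreeOp.comp, Finsupp.linearCombination_single, LinearMap.smul_apply,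
        Finsupp.lmapDomain_apply, Finsupp.mapDomain_single, map_smul, evalFree_single,
        Pi.smul_apply, mul_smul]

/-- Evaluation turns composition into substitution, so the elements that evaluate to zero are closed
under composition on either side. Consequently every algebra yields linear functions on the operad
itself, which is how nonzero elements are detected later. -/
theorem evalFree_eq_zero {n : ℕ} {x : FreeOp k P.Gen n} (hx : P.InIdeal x) :
    A.evalFree n x = 0 := by
  induction hx with
  | rel h => exact A.evalFree_relator h
  | zero => simp
  | add _ _ h h' => simp [h, h']
  | smul a _ h => simp [h]
  | @comp_left m n l i h x y _ ih =>
    funext v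
    rw [evalFree_comp, Finsupp.sum_comm]
    refine Finset.sum_eq_zero fun s _ => ?_
    -- For each inner tree `s` the outer element is evaluated at the sequence with the value of `s`
    -- inserted.
    have := congrFun ih (insertAt v i n (A.evalTree s.1 fun j => v (j + i)))
    simp only [evalFree, Finsupp.linearCombination_apply, Finsupp.sum, Finset.sum_apply,
      Pi.smul_apply, Pi.zero_apply] at this
    simp only [Finsupp.sum, mul_comm _ (y s), mul_smul, ← Finset.smul_sum, this, smul_zero]
  | @comp_right m n l i h x y _ ih =>
    funext v
    rw [evalFree_comp]
    refine Finset.sum_eq_zero fun t _ => ?_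
    -- The outer tree depends linearly on the inserted value, so the sum over the inner trees can be
    -- moved inside, where it vanishes.
    obtain ⟨L, hL⟩ := A.evalTree_update t.1 (fun j => if j < i then v j else v (j + n - 1)) i
      (by rw [t.2]; exact i.2)
    have := congrFun ih fun j => v (j + i)
    simp only [evalFree, Finsupp.linearCombination_apply, Finsupp.sum, Finset.sum_apply,
      Pi.smul_apply, Pi.zero_apply] at this
    simp only [insertAt, hL, Finsupp.sum, mul_smul, ← Finset.smul_sum]
    simp only [← map_smul L, ← map_sum L, this, map_zero, smul_zero]

/-- Evaluation of elements of the operad. -/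
def eval (n : ℕ) : P.Op n →ₗ[k] (ℕ → V) → V :=
  (P.ideal n).liftQ (A.evalFree n) fun _ hx => A.evalFree_eq_zero hx

theorem eval_treeClass {n : ℕ} (t : BinTree P.Gen) (h : t.leaves = n) :
    A.eval n (P.treeClass t h) = A.evalTree t := by
  have : A.eval n (P.treeClass t h) = A.evalFree n (Finsupp.single ⟨t, h⟩ 1) := rfl
  rw [this, evalFree_single, one_smul]

theorem eval_congr {n : ℕ} (p : P.Op n) {v w : ℕ → V} (h : ∀ j < n, v j = w j) :
    A.eval n p v = A.eval n p w := by
  induction p using P.op_induction with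
  | zero => simp
  | add _ _ h h' => simp [h, h']
  | smul _ _ h => simp [h]
  | tree t ht => rw [eval_treeClass]; exact A.evalTree_congr t (ht ▸ h)

theorem eval_update {n : ℕ} (p : P.Op n) (v : ℕ → V) (i : ℕ) (hi : i < n) :
    ∃ L : V →ₗ[k] V, ∀ x, A.eval n p (Function.update v i x) = L x := by
  induction p using P.op_induction with
  | zero => exact ⟨0, by simp⟩
  | add _ _ h h' =>
    obtain ⟨L, hL⟩ := h
    obtain ⟨L', hL'⟩ := h'
    exact ⟨L + L', by simp [hL, hL']⟩
  | smul a _ h =>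
    obtain ⟨L, hL⟩ := h
    exact ⟨a • L, by simp [hL]⟩
  | tree t ht => rw [eval_treeClass]; exact A.evalTree_update t v i (ht ▸ hi)

theorem eval_opId (v : ℕ → V) : A.eval 1 P.opId v = v 0 := by
  rw [opId, eval_treeClass]; rfl

theorem eval_opNode (g : P.Gen) {a b l : ℕ} (h : l = a + b) (p : P.Op a) (q : P.Op b)
    (v : ℕ → V) : A.eval l (P.opNode g h p q) v =
      A.op g (A.eval a p v) (A.eval b q fun j => v (j + a)) := by
  induction p using P.op_induction with
  | zero => simp
  | add _ _ h h' => simp [h, h']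
  | smul _ _ h => simp [h]
  | tree t ht =>
  induction q using P.op_induction with
  | zero => simp
  | add _ _ h h' => simp [h, h']
  | smul _ _ h => simp [h]
  | tree s hs =>
  rw [opNode_treeClass, eval_treeClass, eval_treeClass, eval_treeClass, evalTree, ht]

end Alg

end QuadraticData
end

/-! ### Multilinear functions on decorated trees. -/

noncomputable section

namespace DecTree

variable {k : Type u} [Field k] {E : ℕ → Type u} [∀ n, AddCommGroup (E n)] [∀ n, Module k (E n)]

theorem IsMultilinear.root {f : DecTree E → k} (hf : IsMultilinear k f) {n : ℕ} (hn : 2 ≤ n)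
    (c : Fin n → DecTree E) : IsLinearMap k fun p : E n => f (node hn p c) :=
  hf .hole hn c

theorem IsMultilinear.update {f : DecTree E → k} (hf : IsMultilinear k f) {n : ℕ} (hn : 2 ≤ n)
    (p : E n) (c : Fin n → DecTree E) (i : Fin n) :
    IsMultilinear k fun X => f (node hn p (Function.update c i X)) :=
  fun C _ hm d => hf (.node hn p c i C) hm d

/-- A context is the hole or enters one subtree of the root, so multilinearity can be checked one
level at a time. -/
theorem IsMultilinear.of_root {f : DecTree E → k}
    (h : ∀ {n : ℕ} (hn : 2 ≤ n) (c : Fin n → DecTree E),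
      IsLinearMap k fun p : E n => f (node hn p c))
    (h' : ∀ {n : ℕ} (hn : 2 ≤ n) (p : E n) (c : Fin n → DecTree E) (i : Fin n),
      IsMultilinear k fun X => f (node hn p (Function.update c i X))) : IsMultilinear k f := by
  intro C m hm d
  cases C with
  | hole => exact h hm d
  | node hn p c i C => exact h' hn p c i C hm d

theorem IsMultilinear.zero : IsMultilinear k (fun _ : DecTree E => (0 : k)) :=
  fun _ n _ _ => (0 : E n →ₗ[k] k).isLinear

theorem IsMultilinear.add {f g : DecTree E → k} (hf : IsMultilinear k f)
    (hg : IsMultilinear k g) : IsMultilinear k fun X => f X + g X :=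
  fun C _ hn c => ((hf C hn c).mk' _ + (hg C hn c).mk' _).isLinear

theorem IsMultilinear.const_mul {f : DecTree E → k} (hf : IsMultilinear k f) (a : k) :
    IsMultilinear k fun X => a * f X :=
  fun C _ hn c => (a • (hf C hn c).mk' _).isLinear

theorem IsMultilinear.sub {f g : DecTree E → k} (hf : IsMultilinear k f)
    (hg : IsMultilinear k g) : IsMultilinear k fun X => f X - g X :=
  fun C _ hn c => ((hf C hn c).mk' _ - (hg C hn c).mk' _).isLinear

theorem IsMultilinear.sum {ι : Type*} (s : Finset ι) {f : ι → DecTree E → k}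
    (hf : ∀ i ∈ s, IsMultilinear k (f i)) : IsMultilinear k fun X => ∑ i ∈ s, f i X := by
  classical
  induction s using Finset.induction_on with
  | empty => simpa using IsMultilinear.zero
  | insert i s hi ih =>
    simp only [Finset.sum_insert hi]
    exact (hf i (by simp)).add (ih fun j hj => hf j (by simp [hj]))

end DecTree

namespace QuadraticData.Alg

variable {k : Type u} [Field k] {P : QuadraticData k} {V : Type*} [AddCommGroup V] [Module k V]
  (A : P.Alg V)

/-- The value of a decorated tree in an algebra with an element `e` and an operator `box` that
is applied after the evaluation of each vertex. -/
def evalDec (e : V) (box : V →ₗ[k] V) : DecTree P.Op → V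
  | .leaf => e
  | .node (n := n) _ p c =>
      box (A.eval n p fun j => if h : j < n then evalDec e box (c ⟨j, h⟩) else 0)

theorem evalDec_update (e : V) (box : V →ₗ[k] V) {n : ℕ} (hn : 2 ≤ n) (p : P.Op n)
    (c : Fin n → DecTree P.Op) (i : Fin n) :
    ∃ L : V →ₗ[k] V, ∀ X, A.evalDec e box (.node hn p (Function.update c i X)) =
      L (A.evalDec e box X) := by
  obtain ⟨L, hL⟩ := A.eval_update p
    (fun j => if h : j < n then A.evalDec e box (c ⟨j, h⟩) else 0) i i.2
  refine ⟨box.comp L, fun X => ?_⟩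
  rw [evalDec, LinearMap.comp_apply, ← hL]
  refine congrArg box (congrArg (A.eval n p) (funext fun j => ?_))
  by_cases hj : j = i
  · subst hj
    simp
  · rw [Function.update_of_ne hj]
    split_ifs with h
    · rw [Function.update_of_ne]
      exact fun h' => hj (by rw [← h'])
    · rfl

theorem evalDec_fill (e : V) (box : V →ₗ[k] V) (C : DecTree.Context P.Op) :
    ∃ L : V →ₗ[k] V, ∀ X, A.evalDec e box (C.fill X) = L (A.evalDec e box X) := by
  induction C with
  | hole => exact ⟨LinearMap.id, fun X => rfl⟩
  | node hn p c i C ih =>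
    obtain ⟨L, hL⟩ := ih
    obtain ⟨L', hL'⟩ := A.evalDec_update e box hn p c i
    exact ⟨L'.comp L, fun X => by rw [DecTree.Context.fill, hL', hL]; rfl⟩

/-- The value of a filled context is a linear function of the value of the subtree in the hole, and
that is linear in its root decoration. This is the source of multilinear functions with prescribed
values. -/
theorem isMultilinear_evalDec (e : V) (box : V →ₗ[k] V) (φ : V →ₗ[k] k) :
    DecTree.IsMultilinear k fun T => φ (A.evalDec e box T) := by
  intro C n hn c
  obtain ⟨L, hL⟩ := A.evalDec_fill e box C
  constructor
  · intro p q
    simp only [hL, evalDec, map_add, Pi.add_apply]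
  · intro a p
    simp only [hL, evalDec, map_smul, Pi.smul_apply]

end QuadraticData.Alg
end

/-! ### Confluent rewriting of left combs, and the algebra of boxed trees. -/

noncomputable section

/-- A rewriting system `(x a y) b z → ∑ coeff a b p q x p (y q z)` for the pairs `a`, `b` with
`red a b`, together with the conditions for its confluence. -/
structure LeftRewriting (G : Type) [Fintype G] where
  red : G → G → Prop
  coeff : G → G → G → G → ℤ
  -- In `((u a' x) a y) b z`, rewriting the inner pair first keeps the outer pair reducible;
  -- `red_right` is the same for the opposite order.
  red_left : ∀ {a' a b p q}, coeff a' a p q ≠ 0 → red a b → red p b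
  red_right : ∀ {a' a b p q}, coeff a b p q ≠ 0 → red a' a → red a' p
  -- Two reductions starting inside give terms `u r ((x q y) s z)`. Starting outside gives only
  -- right combs `u r (x w (y v z))`, so the terms with irreducible `q`, `s` must cancel; `overlap`
  -- compares what is left.
  overlap_zero : ∀ {a' a b q s} (r : G), red a' a → red a b → ¬ red q s →
    ∑ p, coeff a' a p q * coeff p b r s = 0
  overlap : ∀ {a' a b} (r w v : G), red a' a → red a b →
    ∑ q, ∑ s, (∑ p, coeff a' a p q * coeff p b r s) * coeff q s w v =
      ∑ p, coeff a b p v * coeff a' p r w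

/-- Binary trees labelled by `G` some of whose subtrees are put into a box. -/
inductive BoxTree (G : Type) : Type
  | leaf : BoxTree G
  | box (t : BoxTree G) : BoxTree G
  | node (g : G) (l r : BoxTree G) : BoxTree G

namespace BoxTree

variable {G : Type}

def leaves : BoxTree G → ℕ
  | leaf => 1
  | box t => t.leaves
  | node _ l r => l.leaves + r.leaves

def boxes : BoxTree G → ℕ
  | leaf => 0
  | box t => t.boxes + 1
  | node _ l r => l.boxes + r.boxes

/-- The sum over all nodes of the number of leaves to the left. -/
def weight : BoxTree G → ℕ
  | leaf => 0
  | box t => t.weight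
  | node _ l r => l.weight + r.weight + l.leaves

def IsNode : BoxTree G → Prop
  | node _ _ _ => True
  | _ => False

/-- All boxes are put around nodes. -/
def Proper : BoxTree G → Prop
  | leaf => True
  | box t => t.Proper ∧ t.IsNode
  | node _ l r => l.Proper ∧ r.Proper

theorem leaves_pos (t : BoxTree G) : 0 < t.leaves := by
  induction t with
  | leaf => simp [leaves]
  | box t ih => exact ih
  | node g l r ihl ihr => simp only [leaves]; omega

/-- The filtration by weight is finite in each arity; this is what makes the corrections of a
cocycle stop. -/
theorem weight_le (t : BoxTree G) : t.weight ≤ t.leaves * t.leaves := by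
  induction t with
  | leaf => simp [weight]
  | box t ih => exact ih
  | node g l r ihl ihr =>
    have := l.leaves_pos
    have := r.leaves_pos
    simp only [weight, leaves]
    nlinarith

end BoxTree

namespace LeftRewriting

variable {k : Type u} [Field k] {G : Type} [Fintype G] (R : LeftRewriting G)

/-- `RootRed t b`: the root of `t` is not in a box and forms a reducible pair with `b`. -/
def RootRed (t : BoxTree G) (b : G) : Prop :=
  match t with
  | .node a _ _ => R.red a b
  | _ => False

/-- The proper trees without reducible pairs. -/
def Normal : BoxTree G → Prop
  | .leaf => True
  | .box t => Normal t ∧ t.IsNode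
  | .node g l r => Normal l ∧ Normal r ∧ ¬ R.RootRed l g

theorem Normal.proper {t : BoxTree G} (h : R.Normal t) : t.Proper := by
  induction t with
  | leaf => trivial
  | box t ih => exact ⟨ih h.1, h.2⟩
  | node g l r ihl ihr => exact ⟨ihl h.1, ihr h.2.1⟩

variable (k) in
/-- The node of two trees, linear in the second one. -/
def nodeRight (g : G) (t : BoxTree G) : (BoxTree G →₀ k) →ₗ[k] (BoxTree G →₀ k) :=
  Finsupp.lmapDomain k k (BoxTree.node g t)

open Classical in
variable (k) in
/-- The reduced form of `x b y`. -/
def mulTree : BoxTree G → G → (BoxTree G →₀ k) →ₗ[k] (BoxTree G →₀ k)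
  | .leaf, b => nodeRight k b .leaf
  | .box t, b => nodeRight k b (.box t)
  | .node a x y, b =>
      if R.red a b then
        ∑ p, ∑ q, (R.coeff a b p q : k) • (mulTree x p).comp (mulTree y q)
      else nodeRight k b (.node a x y)

theorem mulTree_of_not_rootRed {t : BoxTree G} {b : G} (h : ¬ R.RootRed t b) :
    R.mulTree k t b = nodeRight k b t := by
  cases t with
  | leaf => rfl
  | box t => rfl
  | node a x y =>
    have h' : ¬ R.red a b := h
    rw [mulTree, if_neg h']

theorem mulTree_of_red {a b : G} (h : R.red a b) (x y : BoxTree G) :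
    R.mulTree k (.node a x y) b =
      ∑ p, ∑ q, (R.coeff a b p q : k) • (R.mulTree k x p).comp (R.mulTree k y q) := by
  rw [mulTree, if_pos h]

variable (k) in
/-- The bilinear operation on trees defined by a label. -/
def mul (b : G) : (BoxTree G →₀ k) →ₗ[k] (BoxTree G →₀ k) →ₗ[k] (BoxTree G →₀ k) :=
  Finsupp.linearCombination k fun t => R.mulTree k t b

theorem mul_single (b : G) (t : BoxTree G) (a : k) :
    R.mul k b (Finsupp.single t a) = a • R.mulTree k t b := by
  simp [mul]

/-- If no rule applies to the first product it is a genuine node, and the second product unfolds by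
definition. -/
theorem mul_nodeRight {a b : G} (h : R.red a b) {x : BoxTree G} (hx : ¬ R.RootRed x a)
    (y z : BoxTree G →₀ k) : R.mul k b (R.mulTree k x a y) z =
      ∑ p, ∑ q, (R.coeff a b p q : k) • R.mulTree k x p (R.mul k q y z) := by
  rw [R.mulTree_of_not_rootRed hx]
  induction y using Finsupp.induction_linear with
  | zero => simp
  | add x x' h h' => simp only [map_add, LinearMap.add_apply, h, h', smul_add,
      Finset.sum_add_distrib]
  | single t c =>
    simp only [nodeRight, Finsupp.lmapDomain_apply, Finsupp.mapDomain_single, mul_single,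
      LinearMap.smul_apply, map_smul, R.mulTree_of_red h, LinearMap.sum_apply,
      LinearMap.comp_apply, Finset.smul_sum]
    refine Finset.sum_congr rfl fun p _ => Finset.sum_congr rfl fun q _ => smul_comm _ _ _

theorem sum_smul_first {M : Type*} [AddCommGroup M] [Module k M] (A : G → G → G → G → k)
    (Y : G → G → G → M) : ∑ p, ∑ q, ∑ r, ∑ s, A p q r s • Y q r s =
      ∑ r, ∑ q, ∑ s, (∑ p, A p q r s) • Y q r s := by
  simp only [Finset.sum_smul]
  calc _ = ∑ q, ∑ p, ∑ r, ∑ s, A p q r s • Y q r s := Finset.sum_comm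
    _ = ∑ q, ∑ r, ∑ s, ∑ p, A p q r s • Y q r s := Finset.sum_congr rfl fun q _ => by
        rw [Finset.sum_comm]
        exact Finset.sum_congr rfl fun r _ => Finset.sum_comm
    _ = _ := Finset.sum_comm

theorem sum_smul_two {M : Type*} [AddCommGroup M] [Module k M] (A : G → G → G → G → k)
    (Y : G → G → M) : ∑ p, ∑ q, ∑ r, ∑ s, A p q r s • Y r s =
      ∑ r, ∑ s, (∑ p, ∑ q, A p q r s) • Y r s := by
  simp only [Finset.sum_smul]
  calc _ = ∑ p, ∑ r, ∑ q, ∑ s, A p q r s • Y r s :=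
        Finset.sum_congr rfl fun p _ => Finset.sum_comm
    _ = ∑ r, ∑ p, ∑ q, ∑ s, A p q r s • Y r s := Finset.sum_comm
    _ = _ := Finset.sum_congr rfl fun r _ => by
        rw [Finset.sum_comm (s := (Finset.univ : Finset G)) (t := (Finset.univ : Finset G))
          (f := fun s p => ∑ q, A p q r s • Y r s)]
        exact Finset.sum_congr rfl fun p _ => Finset.sum_comm

/-- Two rules overlap only when `x` is itself a node forming a reducible pair with `a`. Then the
left side reduces the inner pair first, the right side the outer pair first, and the overlap
conditions make the results equal. The induction closes because `mulTree` recurses only into the two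
subtrees of `x`. -/
theorem mul_mulTree {a b : G} (h : R.red a b) (x : BoxTree G) (y z : BoxTree G →₀ k) :
    R.mul k b (R.mulTree k x a y) z =
      ∑ p, ∑ q, (R.coeff a b p q : k) • R.mulTree k x p (R.mul k q y z) := by
  induction x generalizing a b y z with
  | leaf => exact R.mul_nodeRight h (x := .leaf) (fun h => h) y z
  | box t => exact R.mul_nodeRight h (x := .box t) (fun h => h) y z
  | node a' x₁ x₂ ih₁ ih₂ =>
    by_cases h' : R.red a' a
    swap
    · exact R.mul_nodeRight h (x := .node a' x₁ x₂) h' y z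
    obtain ⟨B, hB⟩ : ∃ B : G → G → G → G → k, ∀ a b p q, (R.coeff a b p q : k) = B a b p q :=
      ⟨_, fun _ _ _ _ => rfl⟩
    have hB0 : ∀ {a b p q}, B a b p q ≠ 0 → R.coeff a b p q ≠ 0 := by
      intro a b p q h h0
      rw [← hB, h0] at h
      simp at h
    simp only [hB] at ih₁ ih₂ ⊢
    have e₁ : ∀ p q, B a' a p q • R.mul k b (R.mulTree k x₁ p (R.mulTree k x₂ q y)) z =
        ∑ r, ∑ s, (B a' a p q * B p b r s) •
          R.mulTree k x₁ r (R.mul k s (R.mulTree k x₂ q y) z) := by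
      intro p q
      by_cases h0 : B a' a p q = 0
      · simp [h0]
      · rw [ih₁ (R.red_left (hB0 h0) h)]
        simp only [Finset.smul_sum, smul_smul]
    -- The pair `q`, `s` is rewritten once more if it is reducible; otherwise its total coefficient
    -- is zero by `overlap_zero`.
    have e₂ : ∀ r q s, (∑ p, B a' a p q * B p b r s) •
          R.mulTree k x₁ r (R.mul k s (R.mulTree k x₂ q y) z) =
        ∑ w, ∑ v, ((∑ p, B a' a p q * B p b r s) * B q s w v) •
          R.mulTree k x₁ r (R.mulTree k x₂ w (R.mul k v y z)) := by
      intro r q s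
      by_cases h0 : R.red q s
      · rw [ih₂ h0]
        simp only [map_sum, map_smul, Finset.smul_sum, smul_smul]
      · have := congrArg (Int.cast : ℤ → k) (R.overlap_zero r h' h h0)
        push_cast [hB] at this
        simp [this]
    -- Outer pair first: here `red_right` provides the second reduction.
    have e₃ : ∀ p v, B a b p v • R.mulTree k (.node a' x₁ x₂) p (R.mul k v y z) =
        ∑ r, ∑ w, (B a b p v * B a' p r w) •
          R.mulTree k x₁ r (R.mulTree k x₂ w (R.mul k v y z)) := by
      intro p v
      by_cases h0 : B a b p v = 0
      · simp [h0]
      · rw [R.mulTree_of_red (R.red_right (hB0 h0) h')]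
        simp only [LinearMap.sum_apply, LinearMap.smul_apply, LinearMap.comp_apply,
          Finset.smul_sum, smul_smul, hB]
    have e₄ : ∀ r w v, ∑ q, ∑ s, (∑ p, B a' a p q * B p b r s) * B q s w v =
        ∑ p, B a b p v * B a' p r w := by
      intro r w v
      have := congrArg (Int.cast : ℤ → k) (R.overlap r w v h' h)
      push_cast [hB] at this
      exact this
    rw [R.mulTree_of_red h']
    simp only [LinearMap.sum_apply, LinearMap.smul_apply, LinearMap.comp_apply, map_sum,
      map_smul, hB, e₁, e₃]
    rw [sum_smul_first (fun p q r s => B a' a p q * B p b r s)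
      (fun q r s => R.mulTree k x₁ r (R.mul k s (R.mulTree k x₂ q y) z)),
      sum_smul_first (fun p v r w => B a b p v * B a' p r w)
      (fun v r w => R.mulTree k x₁ r (R.mulTree k x₂ w (R.mul k v y z)))]
    refine Finset.sum_congr rfl fun r _ => ?_
    simp only [e₂]
    rw [sum_smul_two]
    simp only [e₄]
    exact Finset.sum_comm

/-- The rules hold as identities between bilinear operations on trees. This is the form in which
confluence yields the independence of normal trees. -/
theorem mul_relation {a b : G} (h : R.red a b) (x y z : BoxTree G →₀ k) :
    R.mul k b (R.mul k a x y) z =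
      ∑ p, ∑ q, (R.coeff a b p q : k) • R.mul k p x (R.mul k q y z) := by
  induction x using Finsupp.induction_linear with
  | zero => simp
  | add x x' h h' => simp only [map_add, LinearMap.add_apply, h, h', smul_add,
      Finset.sum_add_distrib]
  | single t c =>
    simp only [mul_single, LinearMap.smul_apply, map_smul, R.mul_mulTree h, Finset.smul_sum]
    refine Finset.sum_congr rfl fun p _ => Finset.sum_congr rfl fun q _ => smul_comm _ _ _

end LeftRewriting
end

/-! ### Normal forms and their weight. -/

noncomputable section

namespace LeftRewriting

variable {k : Type u} [Field k] {G : Type} [Fintype G] (R : LeftRewriting G)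

/-- Normal trees with prescribed numbers of leaves and boxes and with bounded weight. -/
def bounded (n m w : ℕ) : Set (BoxTree G) :=
  {t | R.Normal t ∧ t.leaves = n ∧ t.boxes = m ∧ t.weight ≤ w}

theorem bounded_mono {n m w w' : ℕ} (h : w ≤ w') : R.bounded n m w ⊆ R.bounded n m w' :=
  fun _ ht => ⟨ht.1, ht.2.1, ht.2.2.1, ht.2.2.2.trans h⟩

theorem nodeRight_mem {b : G} {x : BoxTree G} (hx : R.Normal x) (hb : ¬ R.RootRed x b)
    {n m w : ℕ} {y : BoxTree G →₀ k} (hy : y ∈ Finsupp.supported k k (R.bounded n m w)) :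
    nodeRight k b x y ∈ Finsupp.supported k k
      ({t | t.IsNode} ∩ R.bounded (x.leaves + n) (x.boxes + m) (x.weight + w + x.leaves)) := by
  classical
  rw [Finsupp.mem_supported] at hy ⊢
  refine (Finset.coe_subset.2 Finsupp.mapDomain_support).trans ?_
  rw [Finset.coe_image]
  rintro _ ⟨t, ht, rfl⟩
  obtain ⟨h₁, h₂, h₃, h₄⟩ := hy ht
  refine ⟨trivial, ⟨hx, h₁, hb⟩, ?_, ?_, ?_⟩ <;>
    simp only [BoxTree.leaves, BoxTree.boxes, BoxTree.weight] <;> omega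

/-- Replacing `(x₁ a x₂) b y` by `x₁ p (x₂ q y)` lowers the weight by the number of leaves of `x₁`,
which is positive. So reduction never exceeds the weight of the unreduced node, and is strictly
below it once a rule has been applied at the root. Results are unboxed nodes, so a box may be put
around them. -/
theorem mulTree_mem {b : G} {x : BoxTree G} (hx : R.Normal x) {n m w : ℕ} {y : BoxTree G →₀ k}
    (hy : y ∈ Finsupp.supported k k (R.bounded n m w)) :
    R.mulTree k x b y ∈ Finsupp.supported k k
      ({t | t.IsNode} ∩ R.bounded (x.leaves + n) (x.boxes + m) (x.weight + w + x.leaves)) ∧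
    (R.RootRed x b → R.mulTree k x b y ∈ Finsupp.supported k k
      (R.bounded (x.leaves + n) (x.boxes + m) (x.weight + w + x.leaves - 1))) := by
  induction x generalizing b n m w y with
  | leaf => exact ⟨R.nodeRight_mem hx (fun h => h) hy, fun h => h.elim⟩
  | box t => exact ⟨R.nodeRight_mem hx (fun h => h) hy, fun h => h.elim⟩
  | node a x₁ x₂ ih₁ ih₂ =>
    by_cases h : R.red a b
    swap
    · rw [R.mulTree_of_not_rootRed (t := .node a x₁ x₂) h]
      exact ⟨R.nodeRight_mem hx h hy, fun h' => (h h').elim⟩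
    have key : R.mulTree k (.node a x₁ x₂) b y ∈ Finsupp.supported k k ({t | t.IsNode} ∩
        R.bounded (x₁.leaves + (x₂.leaves + n)) (x₁.boxes + (x₂.boxes + m))
          (x₁.weight + (x₂.weight + w + x₂.leaves) + x₁.leaves)) := by
      rw [R.mulTree_of_red h]
      simp only [LinearMap.sum_apply, LinearMap.smul_apply, LinearMap.comp_apply]
      refine Submodule.sum_mem _ fun p _ => Submodule.sum_mem _ fun q _ =>
        Submodule.smul_mem _ _ (ih₁ hx.1 ?_).1
      exact Finsupp.supported_mono Set.inter_subset_right (ih₂ hx.2.1 hy).1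
    have h₁ := x₁.leaves_pos
    constructor
    · refine Finsupp.supported_mono (Set.inter_subset_inter_right _ ?_) key
      simp only [BoxTree.leaves, BoxTree.boxes, BoxTree.weight, ← add_assoc]
      exact R.bounded_mono (by omega)
    · intro _
      refine Finsupp.supported_mono (Set.inter_subset_right.trans ?_) key
      simp only [BoxTree.leaves, BoxTree.boxes, BoxTree.weight, ← add_assoc]
      exact R.bounded_mono (by omega)

theorem mul_mem {b : G} {n m w n' m' w' : ℕ} {x y : BoxTree G →₀ k}
    (hx : x ∈ Finsupp.supported k k (R.bounded n m w))
    (hy : y ∈ Finsupp.supported k k (R.bounded n' m' w')) :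
    R.mul k b x y ∈ Finsupp.supported k k
      ({t | t.IsNode} ∩ R.bounded (n + n') (m + m') (w + w' + n)) := by
  have : R.mul k b x y = x.sum fun t a => a • R.mulTree k t b y := by
    simp [mul, Finsupp.linearCombination_apply, Finsupp.sum]
  rw [this]
  refine Submodule.sum_mem _ fun t ht => Submodule.smul_mem _ _ ?_
  obtain ⟨h₁, h₂, h₃, h₄⟩ := (Finsupp.mem_supported _ _).1 hx ht
  refine Finsupp.supported_mono (Set.inter_subset_inter_right _ ?_) (R.mulTree_mem h₁ hy).1
  rw [h₂, h₃]
  exact R.bounded_mono (by omega)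

variable (k) in
/-- The linear extension of `BoxTree.box`. -/
def boxMap : (BoxTree G →₀ k) →ₗ[k] (BoxTree G →₀ k) := Finsupp.lmapDomain k k BoxTree.box

theorem boxMap_mem {n m w : ℕ} {x : BoxTree G →₀ k}
    (hx : x ∈ Finsupp.supported k k ({t | t.IsNode} ∩ R.bounded n m w)) :
    boxMap k x ∈ Finsupp.supported k k (R.bounded n (m + 1) w) := by
  classical
  rw [Finsupp.mem_supported] at hx ⊢
  refine (Finset.coe_subset.2 Finsupp.mapDomain_support).trans ?_
  rw [Finset.coe_image]
  rintro _ ⟨t, ht, rfl⟩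
  obtain ⟨h₀, h₁, h₂, h₃, h₄⟩ := hx ht
  exact ⟨⟨h₁, h₀⟩, h₂, by rw [BoxTree.boxes, h₃], h₄⟩

variable (k) in
/-- The normal form of a tree. -/
def normalForm : BoxTree G → (BoxTree G →₀ k)
  | .leaf => Finsupp.single .leaf 1
  | .box t => boxMap k (normalForm t)
  | .node g l r => R.mul k g (normalForm l) (normalForm r)

theorem normalForm_of_normal {t : BoxTree G} (h : R.Normal t) :
    R.normalForm k t = Finsupp.single t 1 := by
  induction t with
  | leaf => rfl
  | box t ih => rw [normalForm, ih h.1, boxMap, Finsupp.lmapDomain_apply, Finsupp.mapDomain_single]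
  | node g l r ihl ihr =>
    rw [normalForm, ihl h.1, ihr h.2.1, mul_single, one_smul, R.mulTree_of_not_rootRed h.2.2,
      nodeRight, Finsupp.lmapDomain_apply, Finsupp.mapDomain_single]

/-- Such a tree contains a node; this makes the truncated subtraction in `weight - 1` a true
decrease. -/
theorem weight_pos_of_not_normal {t : BoxTree G} (h : t.Proper) (hn : ¬ R.Normal t) :
    0 < t.weight := by
  induction t with
  | leaf => exact (hn trivial).elim
  | box t ih => exact ih h.1 fun h' => hn ⟨h', h.2⟩
  | node g l r _ _ =>
    have := l.leaves_pos
    simp only [BoxTree.weight]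
    omega

/-- A proper tree that is not normal fails to be so in its left part, in its right part or at its
root, and in each case a rule is applied that lowers the weight. The last clause is the reason why
non-normal trees are negligible for the leading part of a function. -/
theorem normalForm_mem {t : BoxTree G} (h : t.Proper) :
    R.normalForm k t ∈ Finsupp.supported k k (R.bounded t.leaves t.boxes t.weight) ∧
    (t.IsNode → R.normalForm k t ∈ Finsupp.supported k k
      ({t | t.IsNode} ∩ R.bounded t.leaves t.boxes t.weight)) ∧
    (¬ R.Normal t → R.normalForm k t ∈ Finsupp.supported k k
      (R.bounded t.leaves t.boxes (t.weight - 1))) := by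
  induction t with
  | leaf =>
    refine ⟨?_, fun h => h.elim, fun h => (h trivial).elim⟩
    exact Finsupp.single_mem_supported k _ ⟨trivial, rfl, rfl, le_rfl⟩
  | box t ih =>
    obtain ⟨h₁, h₂, h₃⟩ := ih h.1
    refine ⟨R.boxMap_mem (h₂ h.2), fun h => h.elim, fun hn => ?_⟩
    have hn' : ¬ R.Normal t := fun h' => hn ⟨h', h.2⟩
    refine R.boxMap_mem (n := t.leaves) (m := t.boxes) (w := t.weight - 1) ?_
    rw [Finsupp.mem_supported] at *
    exact Set.subset_inter ((h₂ h.2).trans Set.inter_subset_left) (h₃ hn')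
  | node g l r ihl ihr =>
    obtain ⟨l₁, l₂, l₃⟩ := ihl h.1
    obtain ⟨r₁, r₂, r₃⟩ := ihr h.2
    have key := R.mul_mem (b := g) l₁ r₁
    refine ⟨Finsupp.supported_mono Set.inter_subset_right key, fun _ => key, fun hn => ?_⟩
    have hpos := l.leaves_pos
    by_cases hl : R.Normal l
    swap
    · have := R.weight_pos_of_not_normal h.1 hl
      refine Finsupp.supported_mono (Set.inter_subset_right.trans (R.bounded_mono ?_))
        (R.mul_mem (b := g) (l₃ hl) r₁)
      simp only [BoxTree.weight]
      omega
    by_cases hr : R.Normal r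
    swap
    · have := R.weight_pos_of_not_normal h.2 hr
      refine Finsupp.supported_mono (Set.inter_subset_right.trans (R.bounded_mono ?_))
        (R.mul_mem (b := g) l₁ (r₃ hr))
      simp only [BoxTree.weight]
      omega
    -- Both subtrees are normal, so the obstruction sits at the root.
    have hb : R.RootRed l g := by
      by_contra hb
      exact hn ⟨hl, hr, hb⟩
    rw [normalForm, R.normalForm_of_normal hl, mul_single, one_smul]
    exact (R.mulTree_mem hl r₁).2 hb

end LeftRewriting
end

/-! ### Presentations by confluent rules, in a changed basis of operations. -/

noncomputable section

namespace QuadraticData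

variable {k : Type u} [Field k]

/-- A presentation of the relations of `P`, in terms of the new basis `β` of the space of
operations, by a confluent rewriting system. -/
structure LeftPBW (P : QuadraticData k) where
  R : LeftRewriting P.Gen
  β : P.Gen → P.Gen → k
  α : P.Gen → P.Gen → k
  β_α : ∀ a b, ∑ h, β a h * α h b = if a = b then 1 else 0
  α_β : ∀ a b, ∑ h, α a h * β h b = if a = b then 1 else 0
  rel_eq : P.rel = Submodule.span k {r | ∃ a b, R.red a b ∧
    r = (fun x => β a x.1 * β b x.2,
      fun x => ∑ p, ∑ q, (R.coeff a b p q : k) * (β p x.1 * β q x.2))}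

namespace LeftPBW

variable {P : QuadraticData k} (B : P.LeftPBW)

theorem sum_β_α_smul {M : Type*} [AddCommGroup M] [Module k M] (f : P.Gen → M) (a : P.Gen) :
    ∑ h, B.β a h • ∑ b, B.α h b • f b = f a := by
  simp only [Finset.smul_sum, smul_smul]
  rw [Finset.sum_comm]
  simp [← Finset.sum_smul, B.β_α]

theorem sum_α_β_smul {M : Type*} [AddCommGroup M] [Module k M] (f : P.Gen → M) (a : P.Gen) :
    ∑ h, B.α a h • ∑ b, B.β h b • f b = f a := by
  simp only [Finset.smul_sum, smul_smul]
  rw [Finset.sum_comm]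
  simp [← Finset.sum_smul, B.α_β]

theorem sum_relation_left {M : Type*} [AddCommGroup M] [Module k M] (f : P.Gen → P.Gen → M)
    (a b : P.Gen) : ∑ x : P.Gen × P.Gen, (B.β a x.1 * B.β b x.2) • f x.1 x.2 =
      ∑ y, B.β b y • ∑ x, B.β a x • f x y := by
  rw [Fintype.sum_prod_type, Finset.sum_comm]
  simp only [Finset.smul_sum, smul_smul, mul_comm]

theorem sum_relation_right {M : Type*} [AddCommGroup M] [Module k M] (f : P.Gen → P.Gen → M)
    (a b : P.Gen) :
    ∑ x : P.Gen × P.Gen, (∑ p, ∑ q, (B.R.coeff a b p q : k) * (B.β p x.1 * B.β q x.2)) •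
        f x.1 x.2 =
      ∑ p, ∑ q, (B.R.coeff a b p q : k) • ∑ y, B.β q y • ∑ x, B.β p x • f x y := by
  simp only [← B.sum_relation_left f]
  simp only [Finset.sum_smul, Finset.smul_sum, smul_smul]
  rw [Finset.sum_comm]
  exact Finset.sum_congr rfl fun p _ => Finset.sum_comm

/-- The algebra of trees. -/
def treeAlg : P.Alg (BoxTree P.Gen →₀ k) where
  op g := ∑ a, B.α g a • B.R.mul k a
  relation := by
    intro r hr x y z
    rw [B.rel_eq] at hr
    induction hr using Submodule.span_induction with
    | zero => simp
    | add r s _ _ hr hs =>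
      simp only [Prod.fst_add, Prod.snd_add, Pi.add_apply, add_smul, Finset.sum_add_distrib, hr, hs]
    | smul c r _ hr =>
      simp only [Prod.smul_fst, Prod.smul_snd, Pi.smul_apply, smul_assoc, ← Finset.smul_sum, hr]
    | mem r hr =>
      obtain ⟨a, b, hab, rfl⟩ := hr
      dsimp only
      rw [B.sum_relation_left fun g g' => (∑ a, B.α g' a • B.R.mul k a)
          ((∑ a, B.α g a • B.R.mul k a) x y) z,
        B.sum_relation_right fun g g' => (∑ a, B.α g a • B.R.mul k a) x
          ((∑ a, B.α g' a • B.R.mul k a) y z)]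
      have e₁ : ∀ c (x y : BoxTree P.Gen →₀ k),
          ∑ g, B.β c g • (∑ a, B.α g a • B.R.mul k a) x y = B.R.mul k c x y := by
        intro c x y
        rw [← B.sum_β_α_smul (fun a => B.R.mul k a x y) c]
        simp only [LinearMap.sum_apply, LinearMap.smul_apply]
      have e₂ : ∀ c (L : (BoxTree P.Gen →₀ k) →ₗ[k] (BoxTree P.Gen →₀ k))
          (x y : BoxTree P.Gen →₀ k),
          ∑ g, B.β c g • L ((∑ a, B.α g a • B.R.mul k a) x y) = L (B.R.mul k c x y) := by
        intro c L x y
        rw [← e₁]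
        simp only [map_sum, map_smul]
      have e₃ : ∀ (g' : P.Gen), ∑ g, B.β a g • (∑ a, B.α g' a • B.R.mul k a)
          ((∑ a, B.α g a • B.R.mul k a) x y) z =
          (∑ a, B.α g' a • B.R.mul k a) (B.R.mul k a x y) z := fun g' =>
        e₂ a ((∑ a, B.α g' a • B.R.mul k a).flip z) x y
      simp only [e₃, e₁, e₂]
      exact B.R.mul_relation hab x y z

theorem sum_β_treeAlg_op (a : P.Gen) (x y : BoxTree P.Gen →₀ k) :
    ∑ g, B.β a g • B.treeAlg.op g x y = B.R.mul k a x y := by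
  rw [← B.sum_β_α_smul (fun a => B.R.mul k a x y) a]
  simp only [treeAlg, LinearMap.sum_apply, LinearMap.smul_apply]

/-- The operation of the operad defined by an element of the new basis. -/
def newNode (a : P.Gen) {m n l : ℕ} (h : l = m + n) : P.Op m →ₗ[k] P.Op n →ₗ[k] P.Op l :=
  ∑ g, B.β a g • P.opNode g h

theorem sum_α_newNode (g : P.Gen) {m n l : ℕ} (h : l = m + n) :
    ∑ a, B.α g a • B.newNode a h = P.opNode g h :=
  B.sum_α_β_smul (fun g => P.opNode g h) g

theorem eval_newNode (g : P.Gen) {a b l : ℕ} (h : l = a + b) (p : P.Op a) (q : P.Op b)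
    (v : ℕ → BoxTree P.Gen →₀ k) : B.treeAlg.eval l (B.newNode g h p q) v =
      B.R.mul k g (B.treeAlg.eval a p v) (B.treeAlg.eval b q fun j => v (j + a)) := by
  simp only [newNode, LinearMap.sum_apply, LinearMap.smul_apply, map_sum, map_smul,
    Finset.sum_apply, Pi.smul_apply, Alg.eval_opNode, sum_β_treeAlg_op]

theorem newNode_relation {a b : P.Gen} (hab : B.R.red a b) {n₁ n₂ n₃ n₁₂ n₂₃ l : ℕ}
    (h₁ : n₁₂ = n₁ + n₂) (h₂ : l = n₁₂ + n₃) (h₃ : n₂₃ = n₂ + n₃) (h₄ : l = n₁ + n₂₃)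
    (x : P.Op n₁) (y : P.Op n₂) (z : P.Op n₃) :
    B.newNode b h₂ (B.newNode a h₁ x y) z =
      ∑ p, ∑ q, (B.R.coeff a b p q : k) • B.newNode p h₄ x (B.newNode q h₃ y z) := by
  have hr := P.opNode_relation (r := (fun x => B.β a x.1 * B.β b x.2,
      fun x => ∑ p, ∑ q, (B.R.coeff a b p q : k) * (B.β p x.1 * B.β q x.2)))
      (by rw [B.rel_eq]; exact Submodule.subset_span ⟨a, b, hab, rfl⟩) h₁ h₂ h₃ h₄ x y z
  dsimp only at hr
  rw [B.sum_relation_left fun g g' => P.opNode g' h₂ (P.opNode g h₁ x y) z,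
    B.sum_relation_right fun g g' => P.opNode g h₄ x (P.opNode g' h₃ y z)] at hr
  have e₁ : ∀ a {m n l : ℕ} (h : l = m + n) (x : P.Op m) (y : P.Op n),
      B.newNode a h x y = ∑ g, B.β a g • P.opNode g h x y := by
    intros
    simp only [newNode, LinearMap.sum_apply, LinearMap.smul_apply]
  have e₂ : ∀ g, ∑ g', B.β a g' • P.opNode g h₂ (P.opNode g' h₁ x y) z =
      P.opNode g h₂ (B.newNode a h₁ x y) z := by
    intro g
    simp only [e₁, map_sum, map_smul, LinearMap.sum_apply, LinearMap.smul_apply]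
  simp only [e₂, ← e₁] at hr
  rw [hr]
  refine Finset.sum_congr rfl fun p _ => Finset.sum_congr rfl fun q _ => ?_
  rw [e₁ q, map_sum]
  simp only [map_smul]

theorem comp_newNode_left (g : P.Gen) {a b l s l' a' : ℕ} (h : l = a + b)
    (i : Fin l) (i' : Fin a) (hi : i.1 = i'.1) (h' : l' + 1 = l + s) (h₁ : a' + 1 = a + s)
    (h₂ : l' = a' + b) (p : P.Op a) (q : P.Op b) (r : P.Op s) :
    P.comp i h' (B.newNode g h p q) r = B.newNode g h₂ (P.comp i' h₁ p r) q := by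
  simp only [newNode, LinearMap.sum_apply, LinearMap.smul_apply, map_sum, map_smul,
    P.comp_opNode_left _ h i i' hi h' h₁ h₂]

theorem comp_newNode_right (g : P.Gen) {a b l s l' b' : ℕ} (h : l = a + b)
    (i : Fin l) (i' : Fin b) (hi : i.1 = a + i'.1) (h' : l' + 1 = l + s) (h₁ : b' + 1 = b + s)
    (h₂ : l' = a + b') (p : P.Op a) (q : P.Op b) (r : P.Op s) :
    P.comp i h' (B.newNode g h p q) r = B.newNode g h₂ p (P.comp i' h₁ q r) := by
  simp only [newNode, LinearMap.sum_apply, LinearMap.smul_apply, map_sum, map_smul,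
    P.comp_opNode_right _ h i i' hi h' h₁ h₂]

end LeftPBW
end QuadraticData
end

/-! ### Expansion of decorated trees in normal trees. -/

noncomputable section

namespace QuadraticData

variable {k : Type u} [Field k]

/-- An operation of arity `n` together with decorated trees to be grafted onto its inputs; only
the first `n` of them matter. -/
structure Block (P : QuadraticData k) where
  n : ℕ
  p : P.Op n
  c : ℕ → DecTree P.Op

namespace Block

variable {P : QuadraticData k}

/-- The operations are given as families over all arities equal to `n` or `n'`, which allows blocks
with only propositionally equal arities to be compared without casts. -/
theorem mk_congr {n n' : ℕ} (h : n = n') (p : ∀ l, l = n → P.Op l) (p' : ∀ l, l = n' → P.Op l)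
    (hp : ∀ l h h', p l h = p' l h') {c c' : ℕ → DecTree P.Op} (hc : c = c') :
    (⟨n, p n rfl, c⟩ : P.Block) = ⟨n', p' n' rfl, c'⟩ := by
  subst h hc
  rw [hp n rfl rfl]

/-- The decorated tree with the given root vertex. -/
def close (X : P.Block) : DecTree P.Op :=
  if h : 2 ≤ X.n then .node h X.p fun i => X.c i else X.c 0

theorem close_of_le {n : ℕ} (h : 2 ≤ n) (p : P.Op n) (c : ℕ → DecTree P.Op) :
    close ⟨n, p, c⟩ = .node h p fun i => c i := dif_pos h

/-- The block of the identity operation. -/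
def one (T : DecTree P.Op) : P.Block := ⟨1, P.opId, Function.update (fun _ => .leaf) 0 T⟩

theorem close_one (T : DecTree P.Op) : (one T).close = T := by
  simp [close, one]

/-- Functions on blocks that come from multilinear functions on decorated trees. -/
structure Admissible (Ψ : P.Block → k) : Prop where
  linear : ∀ {n : ℕ}, 2 ≤ n → ∀ c, IsLinearMap k fun p : P.Op n => Ψ ⟨n, p, c⟩
  multilinear : ∀ {n : ℕ} (p : P.Op n) (c : ℕ → DecTree P.Op) (i : ℕ), i < n →
    DecTree.IsMultilinear k fun T => Ψ ⟨n, p, Function.update c i T⟩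
  congr : ∀ {n : ℕ} (p : P.Op n) {c c' : ℕ → DecTree P.Op}, 0 < n → (∀ j < n, c j = c' j) →
    Ψ ⟨n, p, c⟩ = Ψ ⟨n, p, c'⟩

theorem restrict_update {n : ℕ} (c : ℕ → DecTree P.Op) (i : ℕ) (hi : i < n) (T : DecTree P.Op) :
    (fun j : Fin n => Function.update c i T j) =
      Function.update (fun j : Fin n => c j) ⟨i, hi⟩ T := by
  funext j
  by_cases h : j.1 = i
  · have : j = ⟨i, hi⟩ := Fin.ext h
    subst this
    simp
  · rw [Function.update_of_ne h, Function.update_of_ne]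
    exact fun h' => h (congrArg Fin.val h')

/-- Below arity two `close` discards the operation, which is why linearity in the operation is
demanded only from arity two on. -/
theorem admissible_close {f : DecTree P.Op → k} (hf : DecTree.IsMultilinear k f) :
    Admissible fun X : P.Block => f X.close where
  linear hn c := by
    simp only [close_of_le hn]
    exact hf.root hn _
  multilinear {n} p c i hi := by
    by_cases hn : 2 ≤ n
    · simp only [close_of_le hn, restrict_update c i hi]
      exact hf.update hn p _ _
    · obtain rfl : i = 0 := by omega
      simpa [close, hn] using hf
  congr {n} p c c' h0 h := by
    by_cases hn : 2 ≤ n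
    · simp only [close_of_le hn]
      congr 2
      funext j
      exact h j j.2
    · simp only [close, hn, dite_false]
      rw [h 0 h0]

theorem Admissible.one {Ψ : P.Block → k} (h : Admissible Ψ) :
    Admissible fun X : P.Block => Ψ (one X.close) :=
  admissible_close (h.multilinear P.opId _ 0 one_pos)

end Block

namespace LeftPBW

open Block

variable {P : QuadraticData k} (B : P.LeftPBW)

/-- The block of the operation `g` applied to two blocks. -/
def join (g : P.Gen) (X Y : P.Block) : P.Block :=
  ⟨X.n + Y.n, B.newNode g rfl X.p Y.p, fun j => if j < X.n then X.c j else Y.c (j - X.n)⟩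

/-- Joining with a fixed block is linear on operations and merely relocates subtrees. Inductions
over nodes can therefore absorb one half of the node into the function `Ψ`. -/
theorem admissible_join_left {Ψ : P.Block → k} (h : Admissible Ψ) (g : P.Gen) (Y : P.Block) :
    Admissible fun X : P.Block => Ψ (B.join g X Y) where
  linear {n} hn c := by
    have := h.linear (n := n + Y.n) (by omega) fun j => if j < n then c j else Y.c (j - n)
    exact ((this.mk' _).comp ((B.newNode g rfl).flip Y.p)).isLinear
  multilinear {n} p c i hi := by
    have := h.multilinear (B.newNode g rfl p Y.p)
      (fun j => if j < n then c j else Y.c (j - n)) i (by omega)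
    have e : ∀ T, B.join g ⟨n, p, Function.update c i T⟩ Y = ⟨n + Y.n, B.newNode g rfl p Y.p,
        Function.update (fun j => if j < n then c j else Y.c (j - n)) i T⟩ := by
      intro T
      refine congrArg (Block.mk _ _) (funext fun j => ?_)
      by_cases hj : j = i
      · subst hj; simp [hi]
      · simp [Function.update_of_ne hj]
    simpa only [e] using this
  congr {n} p c c' h0 hc := by
    refine h.congr _ (Nat.add_pos_left h0 _) fun j _ => ?_
    dsimp only
    split_ifs with h
    · exact hc j h
    · rfl

theorem admissible_join_right {Ψ : P.Block → k} (h : Admissible Ψ) (g : P.Gen) (X : P.Block) :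
    Admissible fun Y : P.Block => Ψ (B.join g X Y) where
  linear {n} hn c := by
    have := h.linear (n := X.n + n) (by omega) fun j => if j < X.n then X.c j else c (j - X.n)
    exact ((this.mk' _).comp (B.newNode g rfl X.p)).isLinear
  multilinear {n} p c i hi := by
    have := h.multilinear (B.newNode g rfl X.p p)
      (fun j => if j < X.n then X.c j else c (j - X.n)) (i + X.n) (by omega)
    have e : ∀ T, B.join g X ⟨n, p, Function.update c i T⟩ = ⟨X.n + n, B.newNode g rfl X.p p,
        Function.update (fun j => if j < X.n then X.c j else c (j - X.n)) (i + X.n) T⟩ := by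
      intro T
      refine congrArg (Block.mk _ _) (funext fun j => ?_)
      by_cases hj : j = i + X.n
      · subst hj; simp
      · rw [Function.update_of_ne hj]
        dsimp only
        split_ifs with h'
        · rfl
        · rw [Function.update_of_ne (by omega)]
    simpa only [e] using this
  congr {n} p c c' h0 hc := by
    refine h.congr _ (Nat.add_pos_right _ h0) fun j hj => ?_
    dsimp only at hj ⊢
    split_ifs with h
    · rfl
    · exact hc _ (by omega)

/-- The block of a tree: the part that can be reached from the root without entering a box. -/
def block : BoxTree P.Gen → P.Block
  | .leaf => one .leaf
  | .box t => one (block t).close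
  | .node g l r => B.join g (block l) (block r)

/-- The decorated tree of a tree: each box becomes a vertex. -/
def toDec (t : BoxTree P.Gen) : DecTree P.Op := (B.block t).close

theorem toDec_leaf : B.toDec .leaf = .leaf := close_one _

theorem toDec_box (t : BoxTree P.Gen) : B.toDec (.box t) = B.toDec t := close_one _

/-- Both bracketings carry the same sequence of subtrees, so this is the rule in the operad under
`Ψ`. The bound on arities puts the whole block in the range where `Ψ` is linear. -/
theorem join_relation {Ψ : P.Block → k} (h : Admissible Ψ) {a b : P.Gen} (hab : B.R.red a b)
    (X Y Z : P.Block) (hn : 2 ≤ X.n + Y.n) : Ψ (B.join b (B.join a X Y) Z) =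
      ∑ p, ∑ q, (B.R.coeff a b p q : k) * Ψ (B.join p X (B.join q Y Z)) := by
  have e : ∀ p q, B.join p X (B.join q Y Z) = ⟨X.n + Y.n + Z.n,
      B.newNode p (add_assoc _ _ _) X.p (B.newNode q rfl Y.p Z.p),
      fun j => if j < X.n then X.c j else if j < X.n + Y.n then Y.c (j - X.n)
        else Z.c (j - (X.n + Y.n))⟩ := by
    intro p q
    refine mk_congr (add_assoc _ _ _).symm
      (fun l hl => B.newNode p hl X.p (B.newNode q rfl Y.p Z.p))
      (fun l hl => B.newNode p (hl.trans (add_assoc _ _ _)) X.p (B.newNode q rfl Y.p Z.p))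
      (fun _ _ _ => rfl) ?_
    funext j
    dsimp only [join]
    split_ifs <;> first | rfl | omega | (congr 1; omega)
  have e' : B.join b (B.join a X Y) Z = ⟨X.n + Y.n + Z.n,
      ∑ p, ∑ q, (B.R.coeff a b p q : k) •
        B.newNode p (add_assoc _ _ _) X.p (B.newNode q rfl Y.p Z.p),
      fun j => if j < X.n then X.c j else if j < X.n + Y.n then Y.c (j - X.n)
        else Z.c (j - (X.n + Y.n))⟩ := by
    rw [← B.newNode_relation hab rfl rfl rfl (add_assoc _ _ _)]
    refine congrArg (Block.mk _ _) (funext fun j => ?_)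
    change (if j < X.n + Y.n then (if j < X.n then X.c j else Y.c (j - X.n))
      else Z.c (j - (X.n + Y.n))) = _
    split_ifs <;> first | rfl | omega
  have hl := h.linear (n := X.n + Y.n + Z.n) (by omega)
    fun j => if j < X.n then X.c j else if j < X.n + Y.n then Y.c (j - X.n)
        else Z.c (j - (X.n + Y.n))
  rw [e']
  simp only [e]
  change (hl.mk' _) _ = _
  simp only [map_sum, map_smul, smul_eq_mul]
  rfl

theorem block_n_pos (t : BoxTree P.Gen) : 0 < (B.block t).n := by
  induction t with
  | leaf => exact one_pos
  | box t => exact one_pos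
  | node g l r ihl ihr => exact Nat.add_pos_left ihl _

theorem linearCombination_single_one {M : Type*} [AddCommGroup M] [Module k M] {X : Type*}
    (L : (X →₀ k) →ₗ[k] M) (z : X →₀ k) :
    Finsupp.linearCombination k (fun t => L (Finsupp.single t 1)) z = L z := by
  induction z using Finsupp.induction_linear with
  | zero => simp
  | add x y hx hy => rw [map_add, map_add, hx, hy]
  | single t a => rw [Finsupp.linearCombination_single, ← map_smul, Finsupp.smul_single_one]

theorem block_node_of_not_rootRed (Ψ : P.Block → k) {b : P.Gen} {x y : BoxTree P.Gen}
    (hx : ¬ B.R.RootRed x b) : Ψ (B.block (.node b x y)) =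
      Finsupp.linearCombination k (fun t => Ψ (B.block t))
        (B.R.mulTree k x b (Finsupp.single y 1)) := by
  rw [B.R.mulTree_of_not_rootRed hx, LeftRewriting.nodeRight, Finsupp.lmapDomain_apply,
    Finsupp.mapDomain_single, Finsupp.linearCombination_single, one_smul]

/-- The rules hold in the operad, so reduction is invisible to admissible functions. `Ψ` has to vary
in the induction because the recursion reduces a product inside the right argument of a `join`. -/
theorem admissible_mulTree {Ψ : P.Block → k} (h : Admissible Ψ) (b : P.Gen)
    (x y : BoxTree P.Gen) : Ψ (B.block (.node b x y)) =
      Finsupp.linearCombination k (fun t => Ψ (B.block t))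
        (B.R.mulTree k x b (Finsupp.single y 1)) := by
  induction x generalizing Ψ b y with
  | leaf => exact B.block_node_of_not_rootRed Ψ (x := .leaf) fun h => h
  | box t => exact B.block_node_of_not_rootRed Ψ (x := .box t) fun h => h
  | node a x₁ x₂ ih₁ ih₂ =>
    by_cases hab : B.R.red a b
    swap
    · exact B.block_node_of_not_rootRed Ψ (x := .node a x₁ x₂) hab
    have h₁ := B.block_n_pos x₁
    have h₂ := B.block_n_pos x₂
    rw [block, block, B.join_relation h hab _ _ _ (by omega), B.R.mulTree_of_red hab]
    simp only [LinearMap.sum_apply, LinearMap.smul_apply, LinearMap.comp_apply, map_sum,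
      map_smul, smul_eq_mul]
    refine Finset.sum_congr rfl fun p _ => Finset.sum_congr rfl fun q _ => ?_
    congr 1
    have e₂ := ih₂ (B.admissible_join_right h p (B.block x₁)) q y
    have e₁ := fun y => ih₁ h p y
    rw [block] at e₂
    rw [e₂]
    simp only [block] at e₁
    simp only [e₁]
    exact linearCombination_single_one ((Finsupp.linearCombination k fun t => Ψ (B.block t)).comp
      (B.R.mulTree k x₁ p)) _

theorem admissible_mul {Ψ : P.Block → k} (h : Admissible Ψ) (b : P.Gen)
    (x y : BoxTree P.Gen →₀ k) :
    Finsupp.linearCombination k (fun s => Finsupp.linearCombination k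
      (fun t => Ψ (B.block (.node b s t))) y) x =
      Finsupp.linearCombination k (fun t => Ψ (B.block t)) (B.R.mul k b x y) := by
  have e : ∀ s, Finsupp.linearCombination k (fun t => Ψ (B.block (.node b s t))) y =
      Finsupp.linearCombination k (fun t => Ψ (B.block t)) (B.R.mulTree k s b y) := by
    intro s
    simp only [B.admissible_mulTree h]
    exact linearCombination_single_one ((Finsupp.linearCombination k fun t => Ψ (B.block t)).comp
      (B.R.mulTree k s b)) _
  simp only [e]
  have := linearCombination_single_one ((Finsupp.linearCombination k fun t => Ψ (B.block t)).comp
    ((B.R.mul k b).flip y)) x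
  simpa only [LinearMap.comp_apply, LinearMap.flip_apply, LeftRewriting.mul_single, one_smul]
    using this

theorem treeAlg_op (g : P.Gen) (x y : BoxTree P.Gen →₀ k) :
    B.treeAlg.op g x y = ∑ a, B.α g a • B.R.mul k a x y := by
  simp only [treeAlg, LinearMap.sum_apply, LinearMap.smul_apply]

/-- The expansion of a decorated tree in terms of normal trees. -/
def expand : DecTree P.Op → (BoxTree P.Gen →₀ k) :=
  B.treeAlg.evalDec (Finsupp.single .leaf 1) (LeftRewriting.boxMap k)

theorem expand_leaf : B.expand .leaf = Finsupp.single .leaf 1 := rfl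

theorem expand_node {n : ℕ} (hn : 2 ≤ n) (p : P.Op n) (c : Fin n → DecTree P.Op) :
    B.expand (.node hn p c) = LeftRewriting.boxMap k
      (B.treeAlg.eval n p fun j => if h : j < n then B.expand (c ⟨j, h⟩) else 0) := rfl

theorem linearCombination_toDec_boxMap (f : DecTree P.Op → k) (x : BoxTree P.Gen →₀ k) :
    Finsupp.linearCombination k (fun t => f (B.toDec t)) (LeftRewriting.boxMap k x) =
      Finsupp.linearCombination k (fun t => f (B.toDec t)) x := by
  rw [LeftRewriting.boxMap, Finsupp.lmapDomain_apply, Finsupp.linearCombination_mapDomain]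
  simp only [Function.comp_def, toDec_box]

/-- An expansion contains only the leaf or boxed trees, and the block of such a tree is already that
of the identity operation. -/
theorem linearCombination_block_expand (Ψ : P.Block → k) (T : DecTree P.Op) :
    Finsupp.linearCombination k (fun t => Ψ (one (B.toDec t))) (B.expand T) =
      Finsupp.linearCombination k (fun t => Ψ (B.block t)) (B.expand T) := by
  cases T with
  | leaf =>
    rw [expand_leaf, Finsupp.linearCombination_single, Finsupp.linearCombination_single,
      toDec_leaf]
    rfl
  | node hn p c =>
    rw [expand_node, LeftRewriting.boxMap, Finsupp.lmapDomain_apply,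
      Finsupp.linearCombination_mapDomain, Finsupp.linearCombination_mapDomain]
    simp only [Function.comp_def, toDec_box]
    rfl

/-- Written in the new basis, each node of `s` becomes a combination of joins, and joins match
products in `treeAlg` by `admissible_mul`. The hypothesis on `c` supplies the expansions at the
leaves of `s`. -/
theorem admissible_expand {Ψ : P.Block → k} (h : Admissible Ψ) (s : BinTree P.Gen) {n : ℕ}
    (hs : s.leaves = n) (c : ℕ → DecTree P.Op)
    (hc : ∀ j < n, ∀ f : DecTree P.Op → k, DecTree.IsMultilinear k f →
      f (c j) = Finsupp.linearCombination k (fun t => f (B.toDec t)) (B.expand (c j))) :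
    Ψ ⟨n, P.treeClass s hs, c⟩ = Finsupp.linearCombination k (fun t => Ψ (B.block t))
      (B.treeAlg.evalTree s fun j => B.expand (c j)) := by
  subst hs
  induction s generalizing Ψ c with
  | leaf =>
    have e : Ψ ⟨1, P.opId, c⟩ = Ψ (one (c 0)) := h.congr _ one_pos fun j hj => by
      obtain rfl : j = 0 := by omega
      simp
    refine e.trans ?_
    refine (hc 0 one_pos _ (h.multilinear P.opId (fun _ => .leaf) 0 one_pos)).trans ?_
    exact B.linearCombination_block_expand Ψ (c 0)
  | node g l r ihl ihr =>
    have hl := l.leaves_pos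
    have hr := r.leaves_pos
    change Ψ ⟨l.leaves + r.leaves, P.treeClass (.node g l r) (BinTree.leaves_node g l r), c⟩ = _
    have e₁ : P.treeClass (.node g l r) (BinTree.leaves_node g l r) = ∑ a, B.α g a •
        B.newNode a rfl (P.treeClass l rfl) (P.treeClass r rfl) := by
      rw [← P.opNode_treeClass g rfl l r rfl rfl, ← B.sum_α_newNode]
      simp only [LinearMap.sum_apply, LinearMap.smul_apply]
    have hlin := h.linear (n := l.leaves + r.leaves) (by omega) c
    have e₂ : ∀ a, Ψ ⟨l.leaves + r.leaves, B.newNode a rfl (P.treeClass l rfl)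
        (P.treeClass r rfl), c⟩ = Finsupp.linearCombination k (fun t => Ψ (B.block t))
        (B.R.mul k a (B.treeAlg.evalTree l fun j => B.expand (c j))
          (B.treeAlg.evalTree r fun j => B.expand (c (j + l.leaves)))) := by
      intro a
      have e₃ : (⟨l.leaves + r.leaves, B.newNode a rfl (P.treeClass l rfl)
        (P.treeClass r rfl), c⟩ : P.Block) = B.join a ⟨l.leaves, P.treeClass l rfl, c⟩
          ⟨r.leaves, P.treeClass r rfl, fun j => c (j + l.leaves)⟩ := by
        refine congrArg (Block.mk _ _) (funext fun j => ?_)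
        dsimp only
        split_ifs with hj
        · rfl
        · rw [Nat.sub_add_cancel (by omega)]
      rw [e₃, ihl (B.admissible_join_left h a _) c fun j hj => hc j (Nat.lt_add_right _ hj)]
      rw [← B.admissible_mul h]
      congr 2
      funext s
      refine ihr (B.admissible_join_right h a (B.block s)) (fun j => c (j + l.leaves)) fun j hj =>
        hc _ ?_
      simp only [BinTree.leaves]
      omega
    rw [e₁]
    change hlin.mk' _ _ = _
    simp only [map_sum, map_smul, IsLinearMap.mk'_apply, e₂, Alg.evalTree, treeAlg_op]

/-- A multilinear function is determined by its values on normal trees. -/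
theorem eq_expand {f : DecTree P.Op → k} (hf : DecTree.IsMultilinear k f) (T : DecTree P.Op) :
    f T = Finsupp.linearCombination k (fun t => f (B.toDec t)) (B.expand T) := by
  induction T generalizing f with
  | leaf => rw [expand_leaf, Finsupp.linearCombination_single, one_smul, toDec_leaf]
  | @node n hn p c ih =>
    rw [expand_node, linearCombination_toDec_boxMap]
    induction p using P.op_induction with
    | zero =>
      rw [(hf.root hn c).map_zero]
      simp
    | add p q hp hq =>
      rw [(hf.root hn c).map_add, hp, hq]
      simp
    | smul a p hp =>
      rw [(hf.root hn c).map_smul, hp]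
      simp
    | tree s hs =>
      -- The finite family of subtrees is continued by leaves; entries from place `n` on are never
      -- read.
      have := B.admissible_expand (admissible_close hf) s hs
        (fun j => if h : j < n then c ⟨j, h⟩ else .leaf) fun j hj f hf => by
          rw [dif_pos hj]
          exact ih _ hf
      rw [close_of_le hn] at this
      simp only [Fin.is_lt, dite_true, Fin.eta] at this
      rw [this, Alg.eval_treeClass]
      refine congrArg _ (B.treeAlg.evalTree_congr s fun j hj => ?_)
      rw [dif_pos (hs ▸ hj), dif_pos (hs ▸ hj)]

end LeftPBW
end QuadraticData
end

/-! ### Expansion of the decorated tree of a boxed tree; counting leaves and vertices. -/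

noncomputable section

namespace LeftRewriting

variable {G : Type} [Fintype G] (R : LeftRewriting G)

theorem bounded_subset (n m w : ℕ) : R.bounded n m w ⊆ R.bounded n m (n * n) := by
  rintro t ⟨h₁, h₂, h₃, -⟩
  exact ⟨h₁, h₂, h₃, h₂ ▸ t.weight_le⟩

end LeftRewriting

namespace QuadraticData

variable {k : Type u} [Field k]

namespace LeftPBW

open Block

variable {P : QuadraticData k} (B : P.LeftPBW)

theorem two_le_block_n {t : BoxTree P.Gen} (h : t.IsNode) : 2 ≤ (B.block t).n := by
  cases t with
  | leaf => exact h.elim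
  | box t => exact h.elim
  | node g l r =>
    have h₁ := B.block_n_pos l
    have h₂ := B.block_n_pos r
    change 2 ≤ (B.block l).n + (B.block r).n
    omega

theorem toDec_of_isNode {t : BoxTree P.Gen} (h : t.IsNode) :
    B.toDec t = .node (B.two_le_block_n h) (B.block t).p fun i => (B.block t).c i :=
  close_of_le _ _ _

theorem expand_toDec_of_eval {t : BoxTree P.Gen} (h : t.IsNode) {x : BoxTree P.Gen →₀ k}
    (hx : B.treeAlg.eval _ (B.block t).p (fun j => B.expand ((B.block t).c j)) = x) :
    B.expand (B.toDec t) = LeftRewriting.boxMap k x := by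
  rw [B.toDec_of_isNode h, expand_node, ← hx]
  refine congrArg _ (B.treeAlg.eval_congr _ fun j hj => ?_)
  rw [dif_pos hj]

/-- Blocks are built from `newNode`, which evaluates to the reduced product, in the same way as
`normalForm` is built from `mul`. A boxed subtree enters through the expansion of its decorated
tree, which puts the box back. -/
theorem eval_block {t : BoxTree P.Gen} (h : t.Proper) :
    B.treeAlg.eval _ (B.block t).p (fun j => B.expand ((B.block t).c j)) =
      B.R.normalForm k t := by
  induction t with
  | leaf => exact B.treeAlg.eval_opId _
  | box t ih => exact (B.treeAlg.eval_opId _).trans (B.expand_toDec_of_eval h.2 (ih h.1))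
  | node g l r ihl ihr =>
    refine (B.eval_newNode g _ _ _ _).trans ?_
    rw [LeftRewriting.normalForm, ← ihl h.1, ← ihr h.2]
    have e₁ := B.treeAlg.eval_congr (B.block l).p
      (v := fun j => B.expand ((B.block (.node g l r)).c j))
      (w := fun j => B.expand ((B.block l).c j)) fun j hj => by
        simp only [block, join, if_pos hj]
    have e₂ := B.treeAlg.eval_congr (B.block r).p
      (v := fun j => B.expand ((B.block (.node g l r)).c (j + (B.block l).n)))
      (w := fun j => B.expand ((B.block r).c j)) fun j hj => by
        simp [block, join]
    rw [e₁, e₂]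

/-- For normal `t` the right side is the single tree `.box t`, so values on different normal trees
are independent. -/
theorem expand_toDec {t : BoxTree P.Gen} (h : t.Proper) (h' : t.IsNode) :
    B.expand (B.toDec t) = LeftRewriting.boxMap k (B.R.normalForm k t) :=
  B.expand_toDec_of_eval h' (B.eval_block h)

theorem treeAlg_op_mem {g : P.Gen} {n m n' m' : ℕ} {x y : BoxTree P.Gen →₀ k}
    (hx : x ∈ Finsupp.supported k k (B.R.bounded n m (n * n)))
    (hy : y ∈ Finsupp.supported k k (B.R.bounded n' m' (n' * n'))) :
    B.treeAlg.op g x y ∈ Finsupp.supported k k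
      ({t | t.IsNode} ∩ B.R.bounded (n + n') (m + m') ((n + n') * (n + n'))) := by
  rw [treeAlg_op]
  refine Submodule.sum_mem _ fun a _ => Submodule.smul_mem _ _ ?_
  exact Finsupp.supported_mono (Set.inter_subset_inter_right _ (B.R.bounded_subset _ _ _))
    (B.R.mul_mem hx hy)

theorem evalTree_mem (s : BinTree P.Gen) {v : ℕ → BoxTree P.Gen →₀ k} {ν μ : ℕ → ℕ}
    (hv : ∀ j < s.leaves, v j ∈ Finsupp.supported k k (B.R.bounded (ν j) (μ j) (ν j * ν j))) :
    B.treeAlg.evalTree s v ∈ Finsupp.supported k k (B.R.bounded (∑ j ∈ Finset.range s.leaves, ν j)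
      (∑ j ∈ Finset.range s.leaves, μ j) ((∑ j ∈ Finset.range s.leaves, ν j) *
        (∑ j ∈ Finset.range s.leaves, ν j))) ∧
    (2 ≤ s.leaves → B.treeAlg.evalTree s v ∈ Finsupp.supported k k {t | t.IsNode}) := by
  induction s generalizing v ν μ with
  | leaf =>
    refine ⟨?_, fun h => ?_⟩
    · simpa [BinTree.leaves, Alg.evalTree] using hv 0 one_pos
    · simp [BinTree.leaves] at h
  | node g l r ihl ihr =>
    simp only [BinTree.leaves] at hv
    have h₁ := (ihl fun j hj => hv j (by omega)).1
    have h₂ := (ihr (v := fun j => v (j + l.leaves)) (ν := fun j => ν (j + l.leaves))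
      (μ := fun j => μ (j + l.leaves)) fun j hj => hv _ (by omega)).1
    have key := B.treeAlg_op_mem (g := g) h₁ h₂
    simp only [add_comm _ l.leaves, ← Finset.sum_range_add] at key
    rw [BinTree.leaves_node, Alg.evalTree]
    simp only [add_comm _ l.leaves]
    exact ⟨Finsupp.supported_mono Set.inter_subset_right key,
      fun _ => Finsupp.supported_mono Set.inter_subset_left key⟩

theorem expand_mem (T : DecTree P.Op) : B.expand T ∈ Finsupp.supported k k
    (B.R.bounded T.leaves T.verts (T.leaves * T.leaves)) := by
  induction T with
  | leaf => exact Finsupp.single_mem_supported k _ ⟨trivial, rfl, rfl, Nat.zero_le _⟩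
  | @node n hn p c ih =>
    rw [expand_node, DecTree.verts, DecTree.leaves, add_comm]
    refine B.R.boxMap_mem ?_
    induction p using P.op_induction with
    | zero => simp
    | add x y hx hy =>
      rw [map_add]
      exact Submodule.add_mem _ hx hy
    | smul a x hx =>
      rw [map_smul]
      exact Submodule.smul_mem _ _ hx
    | tree s hs =>
      rw [Alg.eval_treeClass]
      subst hs
      have h := B.evalTree_mem s
        (v := fun j => if h : j < s.leaves then B.expand (c ⟨j, h⟩) else 0)
        (ν := fun j => if h : j < s.leaves then (c ⟨j, h⟩).leaves else 0)
        (μ := fun j => if h : j < s.leaves then (c ⟨j, h⟩).verts else 0) fun j hj => by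
          simp only [dif_pos hj]
          exact ih _
      simp only [Finset.sum_range, Fin.is_lt, dite_true, Fin.eta] at h
      rw [Finsupp.mem_supported]
      exact Set.subset_inter ((Finsupp.mem_supported _ _).1 (h.2 hn))
        ((Finsupp.mem_supported _ _).1 h.1)

/-- Every box is a vertex of one of the subtrees attached to the block. The vertex of the block
itself is not counted, hence the `+ 1` in `verts_toDec`. -/
theorem sum_leaves_block {t : BoxTree P.Gen} (h : t.Proper) :
    ∑ j ∈ Finset.range (B.block t).n, ((B.block t).c j).leaves = t.leaves ∧
      ∑ j ∈ Finset.range (B.block t).n, ((B.block t).c j).verts = t.boxes := by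
  induction t with
  | leaf => simp [block, one, DecTree.leaves, DecTree.verts, BoxTree.leaves, BoxTree.boxes]
  | box t ih =>
    obtain ⟨h₁, h₂⟩ := ih h.1
    have e : (B.block t).close = B.toDec t := rfl
    rw [Finset.sum_range] at h₁ h₂
    simp [block, one, e, B.toDec_of_isNode h.2, DecTree.leaves, DecTree.verts, BoxTree.leaves,
      BoxTree.boxes, h₁, h₂, add_comm]
  | node g l r ihl ihr =>
    obtain ⟨l₁, l₂⟩ := ihl h.1
    obtain ⟨r₁, r₂⟩ := ihr h.2
    have e₁ : ∀ φ : DecTree P.Op → ℕ, ∑ j ∈ Finset.range (B.block (.node g l r)).n,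
        φ ((B.block (.node g l r)).c j) = ∑ j ∈ Finset.range (B.block l).n, φ ((B.block l).c j) +
          ∑ j ∈ Finset.range (B.block r).n, φ ((B.block r).c j) := by
      intro φ
      simp only [block, join, Finset.sum_range_add]
      congr 1
      · exact Finset.sum_congr rfl fun j hj => by rw [if_pos (Finset.mem_range.1 hj)]
      · exact Finset.sum_congr rfl fun j _ => by simp
    rw [e₁ DecTree.leaves, e₁ DecTree.verts, l₁, r₁, l₂, r₂]
    exact ⟨rfl, rfl⟩

theorem leaves_toDec {t : BoxTree P.Gen} (h : t.Proper) (h' : t.IsNode) :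
    (B.toDec t).leaves = t.leaves := by
  rw [B.toDec_of_isNode h', DecTree.leaves, ← (B.sum_leaves_block h).1, Finset.sum_range]

theorem verts_toDec {t : BoxTree P.Gen} (h : t.Proper) (h' : t.IsNode) :
    (B.toDec t).verts = t.boxes + 1 := by
  rw [B.toDec_of_isNode h', DecTree.verts, ← (B.sum_leaves_block h).2, Finset.sum_range, add_comm]

end LeftPBW
end QuadraticData
end

/-! ### The bar differential as removal of boxes. -/

noncomputable section

namespace BoxTree

variable (k : Type u) [Field k] {G : Type}

/-- The alternating sum of the trees obtained by removing one box. -/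
def boundary : BoxTree G → (BoxTree G →₀ k)
  | leaf => 0
  | box t => Finsupp.single t 1 - LeftRewriting.boxMap k (boundary t)
  | node g l r => Finsupp.lmapDomain k k (fun t => node g t r) (boundary l) +
      (-1 : k) ^ l.boxes • LeftRewriting.nodeRight k g l (boundary r)

end BoxTree

namespace QuadraticData

variable {k : Type u} [Field k]

namespace Block

variable {P : QuadraticData k}

/-- The list of subtrees after the contraction of the edge number `i`. -/
def spliceSeq (c : ℕ → DecTree P.Op) (i s : ℕ) (e : ℕ → DecTree P.Op) : ℕ → DecTree P.Op :=
  fun j => if j < i then c j else if j < i + s then e (j - i) else c (j + 1 - s)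

/-- A finite sequence of trees, continued by leaves. -/
def extend {s : ℕ} (e : Fin s → DecTree P.Op) : ℕ → DecTree P.Op :=
  fun j => if h : j < s then e ⟨j, h⟩ else .leaf

/-- The value of a function on the contraction of the edge from the root to its `i`-th
subtree `T`. -/
def contractValue (Ψ : P.Block → k) (X : P.Block) (i : ℕ) : DecTree P.Op → k
  | .leaf => 0
  | .node (n := s) _ q e =>
      if h : i < X.n then
        Ψ ⟨X.n + s - 1, P.comp ⟨i, h⟩ (by omega) X.p q, spliceSeq X.c i s (extend e)⟩
      else 0

theorem contractValue_node (Ψ : P.Block → k) {n i : ℕ} (hi : i < n) (p : P.Op n)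
    (c : ℕ → DecTree P.Op) {s : ℕ} (hs : 2 ≤ s) (q : P.Op s) (e : Fin s → DecTree P.Op) :
    contractValue Ψ ⟨n, p, c⟩ i (.node hs q e) =
      Ψ ⟨n + s - 1, P.comp ⟨i, hi⟩ (by omega) p q, spliceSeq c i s (extend e)⟩ := dif_pos hi

/-- The value of a function on the boundary of a block. -/
def boundaryValue (Ψ : P.Block → k) (X : P.Block) : k :=
  ∑ i ∈ Finset.range X.n, (-1 : k) ^ (∑ j ∈ Finset.range i, (X.c j).verts) *
    (contractValue Ψ X i (X.c i) - Finsupp.linearCombination k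
      (fun T => Ψ ⟨X.n, X.p, Function.update X.c i T⟩) (P.boundary (X.c i)))

theorem sum_filter_lt {n : ℕ} (i : Fin n) (φ : ℕ → ℕ) :
    ∑ j ∈ Finset.univ.filter (· < i), φ j = ∑ j ∈ Finset.range i, φ j := by
  refine Finset.sum_nbij (fun j => j.1) ?_ ?_ ?_ fun _ _ => rfl
  · intro j hj
    simpa using hj
  · intro j _ j' _ h
    exact Fin.ext h
  · intro j hj
    have hj' : j < i.1 := by simpa using hj
    exact ⟨⟨j, hj'.trans i.2⟩, Finset.mem_coe.2 (Finset.mem_filter.2 ⟨Finset.mem_univ _, hj'⟩), rfl⟩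

theorem linearCombination_boundary_close (f : DecTree P.Op → k) {n : ℕ} (hn : 2 ≤ n) (p : P.Op n)
    (c : ℕ → DecTree P.Op) :
    Finsupp.linearCombination k f (P.boundary (.node hn p fun i => c i)) =
      boundaryValue (fun X => f X.close) ⟨n, p, c⟩ := by
  rw [boundary, map_sum, boundaryValue, Finset.sum_range]
  refine Finset.sum_congr rfl fun i _ => ?_
  dsimp only
  rw [map_smul, smul_eq_mul, map_sub, sum_filter_lt i fun j => (c j).verts]
  congr 2
  · cases h : c i with
    | leaf => simp [contract, contractValue]
    | @node s hs q e =>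
      simp only [contract, contractValue, Finsupp.linearCombination_single, one_smul, i.2,
        dite_true]
      rw [close_of_le (by omega)]
      congr 2
      funext j
      simp only [DecTree.splice, spliceSeq, extend]
      split_ifs <;> first | rfl | omega
  · rw [Finsupp.linearCombination_mapDomain]
    simp only [close_of_le hn, Function.comp_def]
    congr 2
    funext T
    rw [restrict_update c i i.2]

end Block

namespace LeftPBW

open Block

variable {P : QuadraticData k} (B : P.LeftPBW)

theorem contractValue_join_left (Ψ : P.Block → k) (g : P.Gen) (X Y : P.Block) {i : ℕ}
    (hi : i < X.n) (T : DecTree P.Op) : contractValue Ψ (B.join g X Y) i T =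
      contractValue (fun X => Ψ (B.join g X Y)) X i T := by
  cases T with
  | leaf => rfl
  | @node s hs q e =>
    obtain ⟨n, p, c⟩ := X
    obtain ⟨m, p', c'⟩ := Y
    change i < n at hi
    rw [join, contractValue_node _ (by dsimp only; omega), contractValue_node _ hi]
    refine congrArg Ψ (mk_congr (n := n + m + s - 1) (n' := n + s - 1 + m) (by omega)
      (fun l hl => P.comp (⟨i, by omega⟩ : Fin (n + m)) (by omega) (B.newNode g rfl p p') q)
      (fun l hl => B.newNode g hl (P.comp ⟨i, hi⟩ (by omega) p q) p')
      (fun l hl hl' => B.comp_newNode_left g rfl _ _ rfl _ _ _ _ _ _) ?_)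
    funext j
    dsimp only [spliceSeq]
    split_ifs <;> first | rfl | omega | (congr 1; omega)

theorem contractValue_join_right (Ψ : P.Block → k) (g : P.Gen) (X Y : P.Block) {i : ℕ}
    (hi : i < Y.n) (T : DecTree P.Op) : contractValue Ψ (B.join g X Y) (X.n + i) T =
      contractValue (fun Y => Ψ (B.join g X Y)) Y i T := by
  cases T with
  | leaf => rfl
  | @node s hs q e =>
    obtain ⟨n, p, c⟩ := X
    obtain ⟨m, p', c'⟩ := Y
    change i < m at hi
    rw [join, contractValue_node _ (by dsimp only; omega), contractValue_node _ hi]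
    refine congrArg Ψ (mk_congr (n := n + m + s - 1) (n' := n + (m + s - 1)) (by omega)
      (fun l hl => P.comp (⟨n + i, by omega⟩ : Fin (n + m)) (by omega) (B.newNode g rfl p p') q)
      (fun l hl => B.newNode g hl p (P.comp ⟨i, hi⟩ (by omega) p' q))
      (fun l hl hl' => B.comp_newNode_right g rfl _ _ rfl _ _ _ _ _ _) ?_)
    funext j
    dsimp only [spliceSeq]
    split_ifs <;> first | rfl | omega | (congr 1; omega)

/-- A Leibniz rule: an internal edge lies over one of the two blocks, and in the planar order all
edges over `X` precede those over `Y`, whence the sign. -/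
theorem boundaryValue_join (Ψ : P.Block → k) (g : P.Gen) (X Y : P.Block) :
    boundaryValue Ψ (B.join g X Y) = boundaryValue (fun X => Ψ (B.join g X Y)) X +
      (-1 : k) ^ (∑ j ∈ Finset.range X.n, (X.c j).verts) *
        boundaryValue (fun Y => Ψ (B.join g X Y)) Y := by
  have hc₁ : ∀ j < X.n, (B.join g X Y).c j = X.c j := fun j hj => if_pos hj
  have hc₂ : ∀ j, (B.join g X Y).c (X.n + j) = Y.c j := fun j => by simp [join]
  change ∑ i ∈ Finset.range (X.n + Y.n), _ = _
  rw [Finset.sum_range_add]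
  congr 1
  · refine Finset.sum_congr rfl fun i hi => ?_
    rw [Finset.mem_range] at hi
    rw [hc₁ i hi, B.contractValue_join_left Ψ g X Y hi]
    refine congrArg₂ (· * ·) (congrArg _ (Finset.sum_congr rfl fun j hj => ?_))
      (congrArg₂ (· - ·) rfl (congrArg (fun φ => Finsupp.linearCombination k φ _)
        (funext fun T => congrArg Ψ (congrArg (Block.mk _ _) (funext fun j => ?_)))))
    · rw [hc₁ j ((Finset.mem_range.1 hj).trans hi)]
    · by_cases hj : j = i
      · subst hj
        simp [hi]
      · simp [Function.update_of_ne hj, join]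
  · rw [boundaryValue, Finset.mul_sum]
    refine Finset.sum_congr rfl fun i hi => ?_
    rw [Finset.mem_range] at hi
    rw [hc₂ i, B.contractValue_join_right Ψ g X Y hi, Finset.sum_range_add, pow_add, mul_assoc]
    refine congrArg₂ (· * ·) (congrArg _ (Finset.sum_congr rfl fun j hj => ?_))
      (congrArg₂ (· * ·) (congrArg _ (Finset.sum_congr rfl fun j hj => ?_))
      (congrArg₂ (· - ·) rfl (congrArg (fun φ => Finsupp.linearCombination k φ _)
        (funext fun T => congrArg Ψ (congrArg (Block.mk _ _) (funext fun j => ?_))))))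
    · rw [hc₁ j (Finset.mem_range.1 hj)]
    · rw [hc₂ j]
    · by_cases hj : j = X.n + i
      · subst hj
        simp
      · rw [Function.update_of_ne hj]
        dsimp only [join]
        split_ifs with h
        · rfl
        · rw [Function.update_of_ne (by omega)]

/-- At a node this is the Leibniz rule. At a box there is one edge leading to the boxed vertex,
whose contraction removes the box, and the remaining edges lie above it, shifted by one in the
numbering and therefore with opposite sign. -/
theorem boundaryValue_block {Ψ : P.Block → k} (h : Admissible Ψ) {t : BoxTree P.Gen}
    (ht : t.Proper) : boundaryValue Ψ (B.block t) =
      Finsupp.linearCombination k (fun t => Ψ (B.block t)) (t.boundary k) := by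
  induction t generalizing Ψ with
  | leaf =>
    simp [block, one, boundaryValue, contractValue, BoxTree.boundary, QuadraticData.boundary]
  | box t ih =>
    have e₁ : boundaryValue Ψ (B.block (.box t)) = contractValue Ψ (one (B.toDec t)) 0 (B.toDec t) -
        Finsupp.linearCombination k (fun T => Ψ (one T)) (P.boundary (B.toDec t)) := by
      simp [boundaryValue, block, one, toDec]
    -- Contraction into the identity operation gives back the block of the unboxed tree.
    have e₂ : contractValue Ψ (one (B.toDec t)) 0 (B.toDec t) = Ψ (B.block t) := by
      rw [B.toDec_of_isNode ht.2]
      simp only [contractValue, one, Nat.one_pos]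
      have := B.two_le_block_n ht.2
      trans Ψ ⟨(B.block t).n, (B.block t).p, spliceSeq (Function.update (fun _ => .leaf) 0
          (B.toDec t)) 0 (B.block t).n (extend fun i : Fin (B.block t).n => (B.block t).c i)⟩
      · refine congrArg Ψ (mk_congr (by omega) (fun l hl => P.comp ⟨0, one_pos⟩ (by omega) P.opId
          (B.block t).p) (fun l hl => hl ▸ (B.block t).p) ?_ ?_)
        · intro l h₁ h₂
          subst h₂
          exact P.comp_opId _ _ _
        · rw [B.toDec_of_isNode ht.2]
      · refine h.congr _ (by omega) fun j hj => ?_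
        simp [spliceSeq, extend, hj]
    have e₃ := linearCombination_boundary_close (fun T => Ψ (one T)) (B.two_le_block_n ht.2)
      (B.block t).p (B.block t).c
    rw [← B.toDec_of_isNode ht.2] at e₃
    have e₄ := ih h.one ht.1
    rw [e₁, e₂, e₃, BoxTree.boundary, map_sub, Finsupp.linearCombination_single, one_smul]
    refine congrArg _ (e₄.trans ?_)
    rw [LeftRewriting.boxMap, Finsupp.lmapDomain_apply, Finsupp.linearCombination_mapDomain]
    rfl
  | node g l r ihl ihr =>
    rw [block, boundaryValue_join, ihl (B.admissible_join_left h g _) ht.1,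
      ihr (B.admissible_join_right h g _) ht.2, BoxTree.boundary, map_add, map_smul,
      (B.sum_leaves_block ht.1).2, Finsupp.lmapDomain_apply, LeftRewriting.nodeRight,
      Finsupp.lmapDomain_apply, Finsupp.linearCombination_mapDomain,
      Finsupp.linearCombination_mapDomain]
    rfl

/-- The boxes of a proper tree are exactly the internal edges of its decorated tree. Contracting an
edge composes two monomials, that is, erases the box between them. -/
theorem barD_toDec {f : DecTree P.Op → k} (hf : DecTree.IsMultilinear k f) {t : BoxTree P.Gen}
    (ht : t.Proper) (ht' : t.IsNode) : P.barD f (B.toDec t) =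
      Finsupp.linearCombination k (fun t => f (B.toDec t)) (t.boundary k) := by
  refine Eq.trans ?_ (B.boundaryValue_block (admissible_close hf) ht)
  rw [B.toDec_of_isNode ht']
  exact linearCombination_boundary_close f _ _ _

end LeftPBW
end QuadraticData
end

/-! ### The bar differential preserves multilinearity. -/

noncomputable section

namespace DecTree

variable {k : Type u} [Field k] {E : ℕ → Type u}

theorem verts_fill [∀ n, AddCommGroup (E n)] (C : Context E) {n : ℕ} (hn : 2 ≤ n)
    (c : Fin n → DecTree E) (p q : E n) :
    (C.fill (node hn p c)).verts = (C.fill (node hn q c)).verts := by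
  induction C with
  | hole => rfl
  | @node m hm p₀ c₀ i C ih =>
    simp only [Context.fill, verts]
    refine congrArg _ (Finset.sum_congr rfl fun j _ => ?_)
    by_cases hj : j = i
    · subst hj
      simpa using ih
    · simp [Function.update_of_ne hj]

theorem splice_update_inner {n s : ℕ} (c : Fin n → DecTree E) (i : Fin n) (e : Fin s → DecTree E)
    (j : Fin s) (X : DecTree E) : splice c i (Function.update e j X) =
      Function.update (splice c i e) ⟨i + j, by omega⟩ X := by
  funext l
  by_cases hl : l.1 = i + j
  · have h : ¬ (i.1 + j.1 < i.1) := by omega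
    have h' : i.1 + j.1 < i.1 + s := by omega
    rw [show l = ⟨i + j, by omega⟩ from Fin.ext hl, Function.update_self]
    simp only [splice, h, h', dite_true, dite_false]
    rw [show (⟨i.1 + j.1 - i.1, by omega⟩ : Fin s) = j from Fin.ext (by simp),
      Function.update_self]
  · rw [Function.update_of_ne (fun h => hl (congrArg Fin.val h))]
    simp only [splice]
    split_ifs with h₁ h₂
    · rfl
    · rw [Function.update_of_ne (fun h => hl (by have := congrArg Fin.val h; simp at this; omega))]
    · rfl

/-- The new place depends only on the positions: it moves by `s - 1` if `i₀` lies to the right of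
the contracted edge. -/
theorem exists_splice_update_outer {n s : ℕ} (hs : 2 ≤ s) {i i₀ : Fin n} (hi : i ≠ i₀) :
    ∃ i' : Fin (n + s - 1), ∀ (c : Fin n → DecTree E) (e : Fin s → DecTree E) (X : DecTree E),
      splice (Function.update c i₀ X) i e = Function.update (splice c i e) i' X := by
  have hi' : i.1 ≠ i₀.1 := fun h => hi (Fin.ext h)
  refine ⟨⟨if i₀.1 < i.1 then i₀.1 else i₀.1 + s - 1, by split_ifs <;> omega⟩, fun c e X => ?_⟩
  funext l
  by_cases hl : l.1 = if i₀.1 < i.1 then i₀.1 else i₀.1 + s - 1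
  · rw [show l = ⟨if i₀.1 < i.1 then i₀.1 else i₀.1 + s - 1, by split_ifs <;> omega⟩ from
      Fin.ext hl, Function.update_self]
    simp only [splice]
    split_ifs at hl ⊢ with h₁ h₂ h₃
    all_goals first | omega | skip
    · exact Function.update_self (f := c) i₀ X
    · rw [show (⟨i₀.1 + s - 1 + 1 - s, by omega⟩ : Fin n) = i₀ from Fin.ext (by simp; omega),
        Function.update_self]
  · rw [Function.update_of_ne (fun h => hl (congrArg Fin.val h))]
    simp only [splice]
    split_ifs at hl ⊢ with h₁ h₂ h₃ h₃ h₃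
    all_goals first | rfl | (rw [Function.update_of_ne
      (fun h => by have := congrArg Fin.val h; simp at this; omega)])

variable [∀ n, AddCommGroup (E n)] [∀ n, Module k (E n)]

/-- The number of vertices does not depend on the decorations, so the signs in the differential are
constants as far as linearity is concerned. -/
theorem IsMultilinear.verts_mul {f : DecTree E → k} (hf : IsMultilinear k f) (φ : ℕ → k) :
    IsMultilinear k fun X => φ X.verts * f X := by
  intro C n hn c
  have : ∀ p, φ (C.fill (node hn p c)).verts * f (C.fill (node hn p c)) =
      φ (C.fill (node hn 0 c)).verts * f (C.fill (node hn p c)) := fun p => by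
    rw [verts_fill C hn c p 0]
  simp only [this]
  exact hf.const_mul _ C hn c

theorem IsMultilinear.linearCombination {ι : Type*} {f : ι → DecTree E → k}
    (hf : ∀ i, IsMultilinear k (f i)) (v : ι →₀ k) :
    IsMultilinear k fun X => Finsupp.linearCombination k (fun i => f i X) v := by
  simp only [Finsupp.linearCombination_apply, Finsupp.sum, smul_eq_mul]
  exact IsMultilinear.sum _ fun i _ => (hf i).const_mul _

end DecTree

namespace QuadraticData

open DecTree

variable {k : Type u} [Field k] {P : QuadraticData k}

theorem barD_node (f : DecTree P.Op → k) {n : ℕ} (hn : 2 ≤ n) (p : P.Op n)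
    (c : Fin n → DecTree P.Op) : P.barD f (.node hn p c) =
      ∑ i, (-1 : k) ^ (∑ j ∈ Finset.univ.filter (· < i), (c j).verts) *
        (Finsupp.linearCombination k f (P.contract hn p c i (c i)) -
          P.barD (fun T => f (.node hn p (Function.update c i T))) (c i)) := by
  change Finsupp.linearCombination k f (P.boundary _) = _
  rw [boundary, map_sum]
  refine Finset.sum_congr rfl fun i _ => ?_
  rw [map_smul, smul_eq_mul, map_sub, Finsupp.linearCombination_mapDomain]
  rfl

theorem isLinearMap_linearCombination {ι V : Type*} [AddCommGroup V] [Module k V] {F : ι → V → k}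
    (hF : ∀ i, IsLinearMap k (F i)) (v : ι →₀ k) :
    IsLinearMap k fun p => Finsupp.linearCombination k (fun i => F i p) v := by
  have e := (∑ i ∈ v.support, v i • (hF i).mk' _).isLinear
  rw [LinearMap.coe_sum] at e
  simpa only [Finset.sum_fn, LinearMap.smul_apply, IsLinearMap.mk'_apply,
    Finsupp.linearCombination_apply, Finsupp.sum] using e

theorem isLinearMap_contract {f : DecTree P.Op → k} (hf : IsMultilinear k f) {n : ℕ}
    (hn : 2 ≤ n) (c : Fin n → DecTree P.Op) (i : Fin n) (T : DecTree P.Op) :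
    IsLinearMap k fun p => Finsupp.linearCombination k f (P.contract hn p c i T) := by
  cases T with
  | leaf => exact (0 : P.Op n →ₗ[k] k).isLinear
  | @node s hs q e =>
    simp only [contract, Finsupp.linearCombination_single, one_smul]
    exact (((hf.root (by omega) _).mk' _).comp ((P.comp i (by omega)).flip q)).isLinear

theorem isMultilinear_contract {f : DecTree P.Op → k} (hf : IsMultilinear k f) {n : ℕ}
    (hn : 2 ≤ n) (p : P.Op n) (c : Fin n → DecTree P.Op) (i : Fin n) :
    IsMultilinear k fun X => Finsupp.linearCombination k f (P.contract hn p c i X) := by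
  refine IsMultilinear.of_root (fun {s} hs e => ?_) fun {s} hs q e j => ?_
  · simp only [contract, Finsupp.linearCombination_single, one_smul]
    exact (((hf.root (by omega) _).mk' _).comp (P.comp i (by omega) p)).isLinear
  · simp only [contract, Finsupp.linearCombination_single, one_smul, splice_update_inner]
    exact hf.update _ _ _ _

theorem isMultilinear_contract_update {f : DecTree P.Op → k} (hf : IsMultilinear k f)
    {n : ℕ} (hn : 2 ≤ n) (p : P.Op n) (c : Fin n → DecTree P.Op) {i i₀ : Fin n} (hi : i ≠ i₀) (T : DecTree P.Op) : IsMultilinear k fun X =>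
      Finsupp.linearCombination k f (P.contract hn p (Function.update c i₀ X) i T) := by
  cases T with
  | leaf => simpa [contract] using IsMultilinear.zero
  | @node s hs q e =>
    obtain ⟨i', h⟩ := exists_splice_update_outer (E := P.Op) hs hi
    simp only [contract, Finsupp.linearCombination_single, one_smul, h]
    exact hf.update _ _ _ _

theorem isMultilinear_barD {f : DecTree P.Op → k} (hf : IsMultilinear k f) :
    IsMultilinear k (P.barD f) := by
  intro C n hn c
  induction C generalizing f with
  | hole =>
    simp only [Context.fill, barD_node]
    have h : ∀ i : Fin n, IsLinearMap k fun p =>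
        P.barD (fun T => f (.node hn p (Function.update c i T))) (c i) := fun i =>
      isLinearMap_linearCombination (fun T => hf.root hn (Function.update c i T)) _
    have e := (∑ i, (-1 : k) ^ (∑ j ∈ Finset.univ.filter (· < i), (c j).verts) •
      ((isLinearMap_contract hf hn c i (c i)).mk' _ - (h i).mk' _)).isLinear
    rw [LinearMap.coe_sum] at e
    simpa only [Finset.sum_fn, LinearMap.smul_apply, LinearMap.sub_apply, smul_eq_mul,
      IsLinearMap.mk'_apply] using e
  | @node m hm p₀ c₀ i₀ C ih =>
    -- The edges at or above the varying subtree are separated from the others. In the terms of the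
    -- others that subtree is merely carried along and affects the sign only through its number of
    -- vertices.
    have key : ∀ X, P.barD f (.node hm p₀ (Function.update c₀ i₀ X)) =
        (-1 : k) ^ (∑ j ∈ Finset.univ.filter (· < i₀), (c₀ j).verts) *
          (Finsupp.linearCombination k f (P.contract hm p₀ c₀ i₀ X) -
            P.barD (fun T => f (.node hm p₀ (Function.update c₀ i₀ T))) X) +
        ∑ i ∈ Finset.univ.erase i₀,
          (-1 : k) ^ (∑ j ∈ Finset.univ.filter (· < i), (if j = i₀ then X else c₀ j).verts) *
          (Finsupp.linearCombination k f (P.contract hm p₀ (Function.update c₀ i₀ X) i (c₀ i)) -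
            P.barD (fun T => f (.node hm p₀ (Function.update (Function.update c₀ i T) i₀ X)))
              (c₀ i)) := by
      intro X
      have hcon : P.contract hm p₀ (Function.update c₀ i₀ X) i₀ X = P.contract hm p₀ c₀ i₀ X := by
        cases X with
        | leaf => rfl
        | node hs q e =>
          simp only [contract]
          refine congrArg (fun d => Finsupp.single (DecTree.node _ _ d) (1 : k))
            (funext fun j => ?_)
          simp only [splice]
          split_ifs with h₁ h₂
          · rw [Function.update_of_ne (fun h => by have := congrArg Fin.val h; simp at this; omega)]
          · rfl
          · rw [Function.update_of_ne (fun h => by have := congrArg Fin.val h; simp at this; omega)]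
      rw [barD_node, ← Finset.add_sum_erase _ _ (Finset.mem_univ i₀)]
      refine congrArg₂ (· + ·) ?_ (Finset.sum_congr rfl fun i hi => ?_)
      · rw [Function.update_self, hcon]
        simp only [Function.update_idem]
        refine congrArg (fun s => (-1 : k) ^ s * _) (Finset.sum_congr rfl fun j hj => ?_)
        rw [Function.update_of_ne (Finset.mem_filter.1 hj).2.ne]
      · have hi' := Finset.ne_of_mem_erase hi
        rw [Function.update_of_ne hi']
        have hcomm : ∀ T, Function.update (Function.update c₀ i₀ X) i T =
            Function.update (Function.update c₀ i T) i₀ X := fun T =>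
          Function.update_comm hi'.symm _ _ _
        simp only [hcomm, Function.update_apply c₀ i₀ X]
    simp only [Context.fill, key]
    have h₁ : IsMultilinear k fun X => ∑ i ∈ Finset.univ.erase i₀,
          (-1 : k) ^ (∑ j ∈ Finset.univ.filter (· < i), (if j = i₀ then X else c₀ j).verts) *
          (Finsupp.linearCombination k f (P.contract hm p₀ (Function.update c₀ i₀ X) i (c₀ i)) -
            P.barD (fun T => f (.node hm p₀ (Function.update (Function.update c₀ i T) i₀ X)))
              (c₀ i)) := by
      refine IsMultilinear.sum _ fun i hi => ?_
      have := ((isMultilinear_contract_update hf hm p₀ c₀ (Finset.ne_of_mem_erase hi) (c₀ i)).sub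
        (IsMultilinear.linearCombination (fun T => hf.update hm p₀ (Function.update c₀ i T) i₀)
          (P.boundary (c₀ i)))).verts_mul fun N => (-1 : k) ^ (∑ j ∈ Finset.univ.filter (· < i),
            if j = i₀ then N else (c₀ j).verts)
      simp only [apply_ite DecTree.verts]
      exact this
    have h₂ := (isMultilinear_contract hf hm p₀ c₀ i₀) C hn c
    have h₃ := ih (hf.update hm p₀ c₀ i₀)
    exact ((_ : k) • ((h₂.mk' _) - (h₃.mk' _)) + (h₁ C hn c).mk' _).isLinear

end QuadraticData
end

/-! ### The square of the differential. -/

noncomputable section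

namespace BoxTree

variable {k : Type u} [Field k] {G : Type}

/-- The trees with the same numerical invariants and the same label of the root as `t`. -/
def similar (t : BoxTree G) : Set (BoxTree G) :=
  {s | s.leaves = t.leaves ∧ s.weight = t.weight ∧ (t.Proper → s.Proper) ∧
    ∀ g l r, t = node g l r → ∃ l' r', s = node g l' r'}

theorem isNode_of_similar {s t : BoxTree G} (h : s ∈ t.similar) (ht : t.IsNode) : s.IsNode := by
  cases t with
  | leaf => exact ht.elim
  | box t => exact ht.elim
  | node g l r =>
    obtain ⟨l', r', rfl⟩ := h.2.2.2 g l r rfl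
    trivial

theorem mapDomain_mem_supported {S S' : Set (BoxTree G)} {φ : BoxTree G → BoxTree G}
    (hφ : ∀ s ∈ S, φ s ∈ S') {x : BoxTree G →₀ k} (hx : x ∈ Finsupp.supported k k S) :
    Finsupp.lmapDomain k k φ x ∈ Finsupp.supported k k S' := by
  classical
  rw [Finsupp.mem_supported] at hx ⊢
  refine (Finset.coe_subset.2 Finsupp.mapDomain_support).trans ?_
  rw [Finset.coe_image]
  rintro _ ⟨t, ht, rfl⟩
  exact hφ t (hx ht)

/-- Leaves, weight and the labels of nodes do not see boxes, so removing one preserves everything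
but the number of boxes. -/
theorem boundary_mem (t : BoxTree G) : t.boundary k ∈
    Finsupp.supported k k (t.similar ∩ {s | s.boxes + 1 = t.boxes}) := by
  induction t with
  | leaf => exact Submodule.zero_mem _
  | box t ih =>
    refine Submodule.sub_mem _ ?_ (mapDomain_mem_supported ?_ ih)
    · refine Finsupp.single_mem_supported k _ ⟨⟨rfl, rfl, fun h => h.1, ?_⟩, rfl⟩
      rintro g l r ⟨⟩
    · rintro s ⟨hs, hs'⟩
      refine ⟨⟨hs.1, hs.2.1, fun h => ⟨hs.2.2.1 h.1, isNode_of_similar hs h.2⟩, ?_⟩, ?_⟩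
      · rintro g l r ⟨⟩
      · simpa [boxes] using hs'
  | node g l r ihl ihr =>
    refine Submodule.add_mem _ (mapDomain_mem_supported ?_ ihl)
      (Submodule.smul_mem _ _ (mapDomain_mem_supported ?_ ihr))
    · rintro s ⟨⟨h₁, h₂, h₃, -⟩, h₅⟩
      refine ⟨⟨?_, ?_, fun h => ⟨h₃ h.1, h.2⟩, ?_⟩, ?_⟩
      · simp only [leaves, h₁]
      · simp only [weight, h₁, h₂]
      · rintro _ _ _ ⟨⟩
        exact ⟨_, _, rfl⟩
      · simp only [boxes, Set.mem_ofPred_eq] at h₅ ⊢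
        omega
    · rintro s ⟨⟨h₁, h₂, h₃, -⟩, h₅⟩
      refine ⟨⟨?_, ?_, fun h => ⟨h.1, h₃ h.2⟩, ?_⟩, ?_⟩
      · simp only [leaves, h₁]
      · simp only [weight, h₂]
      · rintro _ _ _ ⟨⟩
        exact ⟨_, _, rfl⟩
      · simp only [boxes, Set.mem_ofPred_eq] at h₅ ⊢
        omega

theorem lift_lmapDomain (L : BoxTree G → (BoxTree G →₀ k)) (φ : BoxTree G → BoxTree G)
    (x : BoxTree G →₀ k) : Finsupp.linearCombination k L (Finsupp.lmapDomain k k φ x) =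
      Finsupp.linearCombination k (fun t => L (φ t)) x := by
  rw [Finsupp.lmapDomain_apply, Finsupp.linearCombination_mapDomain]
  rfl

theorem linearCombination_congr {M : Type*} [AddCommGroup M] [Module k M] {S : Set (BoxTree G)}
    {x : BoxTree G →₀ k} (hx : x ∈ Finsupp.supported k k S) {φ ψ : BoxTree G → M}
    (h : ∀ s ∈ S, φ s = ψ s) :
    Finsupp.linearCombination k φ x = Finsupp.linearCombination k ψ x := by
  rw [Finsupp.linearCombination_apply, Finsupp.linearCombination_apply]
  refine Finset.sum_congr rfl fun s hs => ?_
  dsimp only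
  rw [h s ((Finsupp.mem_supported _ _).1 hx hs)]

theorem linearCombination_map {M : Type*} [AddCommGroup M] [Module k M]
    (L : (BoxTree G →₀ k) →ₗ[k] M) (φ : BoxTree G → (BoxTree G →₀ k)) (x : BoxTree G →₀ k) :
    Finsupp.linearCombination k (fun t => L (φ t)) x =
      L (Finsupp.linearCombination k φ x) := by
  rw [Finsupp.linearCombination_apply, Finsupp.linearCombination_apply, Finsupp.sum, Finsupp.sum,
    map_sum]
  simp only [map_smul]

theorem linearCombination_add {M : Type*} [AddCommGroup M] [Module k M] (φ ψ : BoxTree G → M) :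
    Finsupp.linearCombination k (fun t => φ t + ψ t) =
      Finsupp.linearCombination k φ + Finsupp.linearCombination k ψ := by
  ext
  simp

theorem linearCombination_sub {M : Type*} [AddCommGroup M] [Module k M] (φ ψ : BoxTree G → M) :
    Finsupp.linearCombination k (fun t => φ t - ψ t) =
      Finsupp.linearCombination k φ - Finsupp.linearCombination k ψ := by
  ext
  simp

theorem linearCombination_const_smul {M : Type*} [AddCommGroup M] [Module k M] (a : k)
    (φ : BoxTree G → M) : Finsupp.linearCombination k (fun t => a • φ t) =
      a • Finsupp.linearCombination k φ := by
  ext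
  simp

theorem linearCombination_single_map (φ : BoxTree G → BoxTree G) (x : BoxTree G →₀ k) :
    Finsupp.linearCombination k (fun t => Finsupp.single (φ t) (1 : k)) x =
      Finsupp.lmapDomain k k φ x := by
  rw [Finsupp.linearCombination_apply, Finsupp.lmapDomain_apply, Finsupp.mapDomain]
  simp only [Finsupp.smul_single_one]

theorem linearCombination_nodeRight_swap (g : G) (x y : BoxTree G →₀ k) :
    Finsupp.linearCombination k (fun t => LeftRewriting.nodeRight k g t y) x =
      Finsupp.linearCombination k (fun s => Finsupp.lmapDomain k k (fun t => node g t s) x) y := by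
  simp only [LeftRewriting.nodeRight, Finsupp.lmapDomain_apply, Finsupp.mapDomain,
    Finsupp.linearCombination_apply, Finsupp.sum, Finset.smul_sum, Finsupp.smul_single,
    smul_eq_mul]
  rw [Finset.sum_comm]
  simp only [mul_comm]

/-- At a box, the outer box can be removed before or after an inner one, with opposite signs. At a
node, the mixed terms occur twice, and cancel because `(-1) ^ l.boxes` changes sign when a box of
`l` has been removed. -/
theorem boundary_boundary (t : BoxTree G) :
    Finsupp.linearCombination k (boundary k) (t.boundary k) = 0 := by
  induction t with
  | leaf => simp [boundary]
  | box t ih =>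
    rw [boundary, map_sub, Finsupp.linearCombination_single, one_smul, LeftRewriting.boxMap,
      lift_lmapDomain]
    simp only [boundary]
    rw [linearCombination_sub, LinearMap.sub_apply, linearCombination_map, ih, map_zero, sub_zero,
      linearCombination_single_map (fun t => t), Finsupp.lmapDomain_apply]
    exact sub_eq_zero.2 Finsupp.mapDomain_id.symm
  | node g l r ihl ihr =>
    have e₁ : Finsupp.linearCombination k (boundary k)
        (Finsupp.lmapDomain k k (fun t => node g t r) (boundary k l)) =
        -((-1 : k) ^ l.boxes • Finsupp.linearCombination k
          (fun t => LeftRewriting.nodeRight k g t (boundary k r)) (boundary k l)) := by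
      rw [lift_lmapDomain]
      simp only [boundary]
      rw [linearCombination_add, LinearMap.add_apply, linearCombination_map, ihl, map_zero, zero_add,
        ← map_smul, ← map_neg, ← neg_smul]
      rw [map_smul, ← LinearMap.smul_apply]
      rw [linearCombination_congr (ψ := fun t => (-(-1 : k) ^ l.boxes) •
        LeftRewriting.nodeRight k g t (boundary k r)) (boundary_mem l) fun s hs => ?_]
      · rw [linearCombination_const_smul]
      · rw [← hs.2, pow_succ]
        simp
    rw [boundary, map_add, e₁, map_smul, LeftRewriting.nodeRight, lift_lmapDomain]
    simp only [boundary]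
    rw [linearCombination_add, LinearMap.add_apply, linearCombination_const_smul,
      LinearMap.smul_apply, linearCombination_map, ihr, map_zero, smul_zero, add_zero, linearCombination_nodeRight_swap]
    exact neg_add_cancel _

end BoxTree

namespace QuadraticData

variable {k : Type u} [Field k]

namespace LeftPBW

variable {P : QuadraticData k} (B : P.LeftPBW)

theorem exists_expand_node {n : ℕ} (hn : 2 ≤ n) (p : P.Op n) (c : Fin n → DecTree P.Op) :
    ∃ x ∈ Finsupp.supported k k {t | B.R.Normal t ∧ t.IsNode ∧
        t.leaves = (DecTree.node hn p c).leaves ∧ t.boxes + 1 = (DecTree.node hn p c).verts},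
      B.expand (.node hn p c) = LeftRewriting.boxMap k x := by
  have h := B.expand_mem (.node hn p c)
  refine ⟨_, ?_, B.expand_node hn p c⟩
  rw [expand_node, Finsupp.mem_supported] at h
  rw [Finsupp.mem_supported]
  intro t ht
  have inj : Function.Injective (BoxTree.box (G := P.Gen)) := fun _ _ h => by injection h
  have ht' : BoxTree.box t ∈ (LeftRewriting.boxMap k (B.treeAlg.eval n p fun j =>
      if h : j < n then B.expand (c ⟨j, h⟩) else 0)).support := by
    rw [Finsupp.mem_support_iff, LeftRewriting.boxMap, Finsupp.lmapDomain_apply,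
      Finsupp.mapDomain_apply inj]
    exact Finsupp.mem_support_iff.1 ht
  obtain ⟨h₁, h₂, h₃, -⟩ := h ht'
  exact ⟨h₁.1, h₁.2, h₂, h₃⟩

/-- The expansion of `T` involves only normal trees with the numbers of leaves and vertices of `T`,
so agreement on those suffices. The trivial tree has no root vertex and is a separate hypothesis. -/
theorem multilinear_ext {f g : DecTree P.Op → k} (hf : DecTree.IsMultilinear k f)
    (hg : DecTree.IsMultilinear k g) (h₀ : f .leaf = g .leaf) (T : DecTree P.Op)
    (h : ∀ t, B.R.Normal t → t.IsNode → t.leaves = T.leaves → t.boxes + 1 = T.verts →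
      f (B.toDec t) = g (B.toDec t)) : f T = g T := by
  cases T with
  | leaf => exact h₀
  | node hn p c =>
    obtain ⟨x, hx, e⟩ := B.exists_expand_node hn p c
    rw [B.eq_expand hf, B.eq_expand hg, e, linearCombination_toDec_boxMap,
      linearCombination_toDec_boxMap]
    exact BoxTree.linearCombination_congr hx fun t ht => h t ht.1 ht.2.1 ht.2.2.1 ht.2.2.2

theorem barD_leaf (f : DecTree P.Op → k) : P.barD f .leaf = 0 := by
  change Finsupp.linearCombination k f (P.boundary .leaf) = 0
  rw [boundary, map_zero]

/-- Tested on normal trees this is `boundary_boundary`. The intermediate trees need not be normal,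
but they are proper, which is all that `barD_toDec` requires. -/
theorem barD_barD (B : P.LeftPBW) {f : DecTree P.Op → k} (hf : DecTree.IsMultilinear k f) :
    P.barD (P.barD f) = 0 := by
  have h₁ := isMultilinear_barD hf
  refine funext fun T => B.multilinear_ext (isMultilinear_barD h₁) DecTree.IsMultilinear.zero
    (barD_leaf _) T fun t ht ht' _ _ => ?_
  have htp := ht.proper
  rw [B.barD_toDec h₁ htp ht']
  have := BoxTree.boundary_mem (k := k) t
  rw [BoxTree.linearCombination_congr this (ψ := fun s => Finsupp.linearCombination k
    (fun t => f (B.toDec t)) (s.boundary k)) fun s hs => B.barD_toDec hf (hs.1.2.2.1 htp)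
      (BoxTree.isNode_of_similar hs.1 ht'), BoxTree.linearCombination_map,
    BoxTree.boundary_boundary, map_zero]

theorem barD_mem (B : P.LeftPBW) {n i : ℕ} {f : DecTree P.Op → k} (hf : f ∈ P.bar n (i + 1)) :
    P.barD f ∈ P.bar n i := by
  refine ⟨isMultilinear_barD hf.1, fun T hT => B.multilinear_ext (isMultilinear_barD hf.1)
    DecTree.IsMultilinear.zero (barD_leaf _) T fun t ht ht' h₁ h₂ => ?_⟩
  have htp := ht.proper
  rw [B.barD_toDec hf.1 htp ht', BoxTree.linearCombination_congr (BoxTree.boundary_mem t)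
    (ψ := fun _ => (0 : k)) fun s hs => ?_]
  · simp [Finsupp.linearCombination_apply]
  · have h₃ := hs.1.2.2.1 htp
    have h₄ := BoxTree.isNode_of_similar hs.1 ht'
    refine hf.2 _ fun h => hT ?_
    rw [B.leaves_toDec h₃ h₄, B.verts_toDec h₃ h₄, hs.1.1, h₁] at h
    have := hs.2
    simp only [Set.mem_ofPred_eq] at this
    omega

end LeftPBW
end QuadraticData
end

/-! ### The contracting homotopy on normal trees. -/

noncomputable section

namespace BoxTree

variable {k : Type u} [Field k] {G : Type}

theorem linearCombination_node_left (H : BoxTree G → k) (g : G) (l r : BoxTree G) :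
    Finsupp.linearCombination k H ((node g l r).boundary k) =
      Finsupp.linearCombination k (fun s => H (.node g s r)) (l.boundary k) +
      (-1 : k) ^ l.boxes *
        Finsupp.linearCombination k (fun s => H (.node g l s)) (r.boundary k) := by
  rw [boundary, map_add, map_smul, Finsupp.lmapDomain_apply, LeftRewriting.nodeRight,
    Finsupp.lmapDomain_apply, Finsupp.linearCombination_mapDomain,
    Finsupp.linearCombination_mapDomain]
  rfl

theorem linearCombination_box (H : BoxTree G → k) (t : BoxTree G) :
    Finsupp.linearCombination k H ((box t).boundary k) = H t -
      Finsupp.linearCombination k (fun s => H (.box s)) (t.boundary k) := by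
  rw [boundary, map_sub, LeftRewriting.boxMap, Finsupp.lmapDomain_apply,
    Finsupp.linearCombination_mapDomain, Finsupp.linearCombination_single, one_smul]
  rfl

theorem linearCombination_const_mul (a : k) (H : BoxTree G → k) (x : BoxTree G →₀ k) :
    Finsupp.linearCombination k (fun s => a * H s) x = a * Finsupp.linearCombination k H x :=
  congrArg (fun L => L x) (linearCombination_const_smul a H)

theorem linearCombination_zero (x : BoxTree G →₀ k) :
    Finsupp.linearCombination k (fun _ => (0 : k)) x = 0 := by
  simp [Finsupp.linearCombination_apply]

end BoxTree

namespace LeftRewriting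

variable {k : Type u} [Field k] {G : Type} [Fintype G] (R : LeftRewriting G)

open BoxTree

open Classical in
variable (k) in
/-- The contracting homotopy: it puts a box around the last possible subtree. -/
def homotopy : BoxTree G → (BoxTree G →₀ k)
  | .node g l (.node g' a b) =>
      (-1 : k) ^ l.boxes • Finsupp.single (.node g l (.box (.node g' a b))) 1
  | .node g (.node g' a b) .leaf => Finsupp.single (.node g (.box (.node g' a b)) .leaf) 1
  | .node g (.box l) .leaf =>
      if R.RootRed l g then
        -Finsupp.lmapDomain k k (fun s => .node g (.box s) .leaf) (homotopy l)
      else 0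
  | _ => 0

/-- The trees that are not reached by the homotopy. -/
def Critical : BoxTree G → Prop
  | .node _ .leaf .leaf => True
  | .node g (.box l) .leaf => R.RootRed l g ∧ Critical l
  | _ => False

/-- Every node but the root has its own box, so the decorated tree of a critical tree is binary and
belongs to degree zero. -/
theorem Critical.boxes {t : BoxTree G} (h : R.Critical t) : t.boxes + 2 = t.leaves := by
  fun_induction Critical R t with
  | case1 => rfl
  | case2 g l ih =>
    have := ih h.2
    simp only [BoxTree.boxes, BoxTree.leaves]
    omega
  | case3 => exact h.elim

theorem homotopy_mem (t : BoxTree G) : R.homotopy k t ∈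
    Finsupp.supported k k (t.similar ∩ {s | s.boxes = t.boxes + 1}) := by
  fun_induction homotopy k R t with
  | case1 g l g' a b =>
    refine Submodule.smul_mem _ _ (Finsupp.single_mem_supported k _ ⟨⟨rfl, rfl, ?_, ?_⟩, ?_⟩)
    · exact fun h => ⟨h.1, h.2, trivial⟩
    · rintro _ _ _ ⟨⟩
      exact ⟨_, _, rfl⟩
    · simp only [BoxTree.boxes, Set.mem_ofPred_eq]
      omega
  | case2 g g' a b =>
    refine Finsupp.single_mem_supported k _ ⟨⟨rfl, rfl, ?_, ?_⟩, ?_⟩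
    · exact fun h => ⟨⟨h.1, trivial⟩, h.2⟩
    · rintro _ _ _ ⟨⟩
      exact ⟨_, _, rfl⟩
    · simp only [BoxTree.boxes, Set.mem_ofPred_eq]
  | case3 g l h ih =>
    refine Submodule.neg_mem _ (mapDomain_mem_supported ?_ ih)
    rintro s ⟨hs, hs'⟩
    refine ⟨⟨?_, ?_, fun h => ⟨⟨hs.2.2.1 h.1.1, isNode_of_similar hs h.1.2⟩, h.2⟩, ?_⟩, ?_⟩
    · simp only [BoxTree.leaves, hs.1]
    · simp only [BoxTree.weight, BoxTree.leaves, hs.1, hs.2.1]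
    · rintro _ _ _ ⟨⟩
      exact ⟨_, _, rfl⟩
    · simp only [BoxTree.boxes, Set.mem_ofPred_eq] at hs' ⊢
      omega
  | case4 => exact Submodule.zero_mem _
  | case5 => exact Submodule.zero_mem _

theorem rootRed_of_similar {s t : BoxTree G} (h : s ∈ t.similar) (ht : t.IsNode) (g : G) :
    R.RootRed s g ↔ R.RootRed t g := by
  cases t with
  | leaf => exact ht.elim
  | box t => exact ht.elim
  | node g' l r =>
    obtain ⟨l', r', rfl⟩ := h.2.2.2 g' l r rfl
    exact Iff.rfl

open Classical in
variable (k) in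
/-- The transpose of the homotopy on normal trees. -/
def homotopyDual (F : BoxTree G → k) (t : BoxTree G) : k :=
  if R.Normal t then Finsupp.linearCombination k F (R.homotopy k t) else 0

theorem homotopy_node_of_isNode (g : G) (l : BoxTree G) {r : BoxTree G} (hr : r.IsNode) :
    R.homotopy k (.node g l r) = (-1 : k) ^ l.boxes • Finsupp.single (.node g l (.box r)) 1 := by
  cases r with
  | leaf => exact hr.elim
  | box r => exact hr.elim
  | node g' a b => rw [homotopy]

theorem homotopy_node_leaf (g : G) {l : BoxTree G} (hl : l.IsNode) :
    R.homotopy k (.node g l .leaf) = Finsupp.single (.node g (.box l) .leaf) 1 := by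
  cases l with
  | leaf => exact hl.elim
  | box r => exact hl.elim
  | node g' a b => rw [homotopy]

variable (F : BoxTree G → k)

theorem homotopyDual_node_box (g : G) (l r : BoxTree G) :
    R.homotopyDual k F (.node g l (.box r)) = 0 := by
  rw [homotopyDual, homotopy] <;> simp

theorem homotopyDual_node_box_leaf {g : G} {l : BoxTree G} (hg : ¬ R.RootRed l g) :
    R.homotopyDual k F (.node g (.box l) .leaf) = 0 := by
  rw [homotopyDual, homotopy, if_neg hg]
  simp

theorem homotopyDual_node_box_leaf_of_red {g : G} {l : BoxTree G} (hl : l.IsNode)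
    (hg : R.RootRed l g) : R.homotopyDual k F (.node g (.box l) .leaf) =
      -R.homotopyDual k (fun s => F (.node g (.box s) .leaf)) l := by
  have h : R.Normal (.node g (.box l) .leaf) ↔ R.Normal l :=
    ⟨fun h => h.1.1, fun h => ⟨⟨h, hl⟩, trivial, fun h => h⟩⟩
  rw [homotopyDual, homotopyDual, homotopy, if_pos hg, map_neg,
    Finsupp.lmapDomain_apply, Finsupp.linearCombination_mapDomain]
  by_cases hN : R.Normal l
  · rw [if_pos (h.2 hN), if_pos hN]
    rfl
  · rw [if_neg fun h' => hN (h.1 h'), if_neg hN, neg_zero]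

theorem homotopyDual_nonNormal {t : BoxTree G} (ht : ¬ R.Normal t) :
    R.homotopyDual k F t = 0 := if_neg ht

variable {F}

theorem homotopyDual_node (hF : ∀ t, ¬ R.Normal t → F t = 0) {g : G} {l r : BoxTree G}
    (hr : r.IsNode) :
    R.homotopyDual k F (.node g l r) = (-1 : k) ^ l.boxes * F (.node g l (.box r)) := by
  have h : R.Normal (.node g l (.box r)) ↔ R.Normal (.node g l r) := by
    simp only [Normal, hr, and_true]
  rw [homotopyDual, R.homotopy_node_of_isNode g l hr]
  split_ifs with h'
  · simp
  · rw [hF _ fun h'' => h' (h.1 h''), mul_zero]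

theorem homotopyDual_node_leaf (hF : ∀ t, ¬ R.Normal t → F t = 0) {g : G} {l : BoxTree G}
    (hl : l.IsNode) (hg : ¬ R.RootRed l g) :
    R.homotopyDual k F (.node g l .leaf) = F (.node g (.box l) .leaf) := by
  rw [homotopyDual, R.homotopy_node_leaf g hl]
  split_ifs with h'
  · simp
  · refine (hF _ fun h'' => h' ?_).symm
    exact ⟨h''.1.1, trivial, hg⟩

/-- The homotopy formula in transposed form, for functions that treat non-normal trees as zero.
Boxing a subtree and removing that box reproduces `t`; the remaining terms cancel in pairs. Where
boxing and unboxing at the last place are both useless, the argument is repeated inside the box,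
until a critical tree is met. -/
theorem homotopy_spec (hF : ∀ t, ¬ R.Normal t → F t = 0) {t : BoxTree G}
    (ht : R.Normal t) (hn : t.IsNode) (hc : ¬ R.Critical t) :
    Finsupp.linearCombination k (R.homotopyDual k F) (t.boundary k) +
      Finsupp.linearCombination k (fun s => Finsupp.linearCombination k F (s.boundary k))
        (R.homotopy k t) = F t := by
  induction hN : t.leaves using Nat.strong_induction_on generalizing t F with | _ N ih
  cases t with
  | leaf => exact hn.elim
  | box t => exact hn.elim
  | node g l r =>
    have sq : (-1 : k) ^ l.boxes * (-1 : k) ^ l.boxes = 1 := by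
      rw [← mul_pow]; simp
    -- If the right subtree is an unboxed node, the homotopy boxes it. Removing the new box returns
    -- `t`, and removing another box cancels against the homotopy of a term of the boundary of `t`.
    by_cases hr : r.IsNode
    · rw [R.homotopy_node_of_isNode g l hr, map_smul, Finsupp.linearCombination_single, one_smul,
        linearCombination_node_left, linearCombination_node_left, linearCombination_box,
        BoxTree.linearCombination_congr (boundary_mem l) (ψ := fun s =>
          (-(-1 : k) ^ l.boxes) * F (.node g s (.box r))) fun s hs => ?_,
        BoxTree.linearCombination_congr (boundary_mem r) (ψ := fun s =>
          (-1 : k) ^ l.boxes * F (.node g l (.box s))) fun s hs => ?_,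
        linearCombination_const_mul, linearCombination_const_mul, smul_eq_mul]
      · linear_combination F (node g l r) * sq
      · exact R.homotopyDual_node hF (isNode_of_similar hs.1 hr)
      · have h := hs.2
        simp only [Set.mem_ofPred_eq] at h
        rw [R.homotopyDual_node hF hr, ← h, pow_succ]
        ring
    cases r with
    | node => exact (hr trivial).elim
    -- Here the homotopy vanishes, and only the removal of the box around the right subtree
    -- contributes.
    | box r =>
      have hr' := ht.2.1.2
      have e : R.homotopy k (.node g l (.box r)) = 0 := by rw [homotopy] <;> simp
      rw [e, map_zero, linearCombination_node_left, linearCombination_box]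
      simp only [homotopyDual_node_box, R.homotopyDual_node hF hr']
      rw [BoxTree.linearCombination_zero, BoxTree.linearCombination_zero]
      linear_combination F (node g l (box r)) * sq
    | leaf =>
      cases l with
      | leaf => exact (hc trivial).elim
      -- Normality says that the pair at the root is not reducible, so this tree and its boxed
      -- version are matched with each other.
      | node g' a b =>
        have hg : ¬ R.RootRed (.node g' a b) g := ht.2.2
        rw [R.homotopy_node_leaf g (l := .node g' a b) trivial,
          Finsupp.linearCombination_single, one_smul,
          linearCombination_node_left _ g (.node g' a b) .leaf,
          linearCombination_node_left _ g (.box (.node g' a b)) .leaf, linearCombination_box,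
          BoxTree.linearCombination_congr (boundary_mem (.node g' a b)) (ψ := fun s =>
            F (.node g (.box s) .leaf)) fun s hs => ?_]
        · simp [BoxTree.boundary]
        · exact R.homotopyDual_node_leaf hF (isNode_of_similar hs.1 trivial)
            fun h => hg ((R.rootRed_of_similar hs.1 trivial g).1 h)
      | box l =>
        have hl := ht.1.2
        rw [linearCombination_node_left, linearCombination_box]
        -- If the box hides a reducible pair, removing it gives a non-normal tree, on which `F` and
        -- its transposed homotopy vanish; what remains is the formula for `l`, with the sign of
        -- passing the box. Otherwise `t` is the boxed partner of a normal tree.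
        by_cases hg : R.RootRed l g
        · have e : R.homotopy k (.node g (.box l) .leaf) =
              -Finsupp.lmapDomain k k (fun s => .node g (.box s) .leaf) (R.homotopy k l) := by
            rw [homotopy, if_pos hg]
          rw [e, map_neg, Finsupp.lmapDomain_apply, Finsupp.linearCombination_mapDomain,
            R.homotopyDual_nonNormal F (t := .node g l .leaf) (fun h => h.2.2 hg),
            BoxTree.linearCombination_congr (boundary_mem l) (ψ := fun s => (-1) *
              R.homotopyDual k (fun s => F (.node g (.box s) .leaf)) s) fun s hs => ?_,
            BoxTree.linearCombination_congr (R.homotopy_mem l) (ψ := fun s => (-1) *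
              Finsupp.linearCombination k (fun s => F (.node g (.box s) .leaf)) (s.boundary k))
              fun s hs => ?_, linearCombination_const_mul, linearCombination_const_mul]
          · have := ih l.leaves (by simp only [BoxTree.leaves] at hN; omega)
              (F := fun s => F (.node g (.box s) .leaf)) (fun s hs => hF _ fun h => hs h.1.1)
              ht.1.1 hl (fun h => hc ⟨hg, h⟩) rfl
            rw [← this]
            simp only [BoxTree.boundary, map_zero]
            ring
          · dsimp only [Function.comp]
            rw [linearCombination_node_left, linearCombination_box,
              hF (.node g s .leaf) fun h => h.2.2 ((R.rootRed_of_similar hs.1 hl g).2 hg)]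
            simp only [BoxTree.boundary, map_zero]
            ring
          · rw [R.homotopyDual_node_box_leaf_of_red F (isNode_of_similar hs.1 hl)
              ((R.rootRed_of_similar hs.1 hl g).2 hg)]
            ring
        · have e : R.homotopy k (.node g (.box l) .leaf) = 0 := by rw [homotopy, if_neg hg]
          rw [e, map_zero, R.homotopyDual_node_leaf hF hl hg,
            BoxTree.linearCombination_congr (boundary_mem l) (ψ := fun s => 0) fun s hs => ?_]
          · simp [BoxTree.boundary, Finsupp.linearCombination_apply]
          · exact R.homotopyDual_node_box_leaf F
              fun h => hg ((R.rootRed_of_similar hs.1 hl g).1 h)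

end LeftRewriting
end

/-! ### Exactness in positive degrees, by induction on the weight. -/

noncomputable section

namespace QuadraticData

variable {k : Type u} [Field k]

namespace LeftPBW

variable {P : QuadraticData k} (B : P.LeftPBW)

/-- A function on trees in boxes, extended by zero. -/
def unbox (H : BoxTree P.Gen → k) : BoxTree P.Gen → k
  | .box t => H t
  | _ => 0

/-- The multilinear function with the values `H` on normal trees. -/
def ofNormal (H : BoxTree P.Gen → k) (T : DecTree P.Op) : k :=
  Finsupp.linearCombination k (unbox H) (B.expand T)

theorem isMultilinear_ofNormal (H : BoxTree P.Gen → k) :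
    DecTree.IsMultilinear k (B.ofNormal H) :=
  B.treeAlg.isMultilinear_evalDec _ _ (Finsupp.linearCombination k (unbox H))

theorem ofNormal_boxMap (H : BoxTree P.Gen → k) (x : BoxTree P.Gen →₀ k) :
    Finsupp.linearCombination k (unbox H) (LeftRewriting.boxMap k x) =
      Finsupp.linearCombination k H x := by
  rw [LeftRewriting.boxMap, Finsupp.lmapDomain_apply, Finsupp.linearCombination_mapDomain]
  rfl

/-- For normal `t` the value is `H t`, so values on normal trees can be prescribed freely. -/
theorem ofNormal_toDec (H : BoxTree P.Gen → k) {t : BoxTree P.Gen} (h : t.Proper)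
    (h' : t.IsNode) :
    B.ofNormal H (B.toDec t) = Finsupp.linearCombination k H (B.R.normalForm k t) := by
  rw [ofNormal, B.expand_toDec h h', ofNormal_boxMap]

theorem ofNormal_mem {H : BoxTree P.Gen → k} {n i : ℕ}
    (hH : ∀ t, ¬ (t.leaves = n ∧ t.boxes + i + 2 = n) → H t = 0) : B.ofNormal H ∈ P.bar n i := by
  refine ⟨B.isMultilinear_ofNormal H, fun T hT => ?_⟩
  cases T with
  | leaf => simp [ofNormal, expand_leaf, unbox]
  | node hn p c =>
    obtain ⟨x, hx, e⟩ := B.exists_expand_node hn p c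
    rw [ofNormal, e, ofNormal_boxMap, BoxTree.linearCombination_congr hx
      (ψ := fun _ => 0) fun t ht => ?_, BoxTree.linearCombination_zero]
    refine hH t fun h => hT ?_
    have h₁ := ht.2.2.1
    have h₂ := ht.2.2.2
    omega

theorem toDec_eq_normalForm {f : DecTree P.Op → k} (hf : DecTree.IsMultilinear k f)
    {t : BoxTree P.Gen} (h : t.Proper) (h' : t.IsNode) :
    f (B.toDec t) = Finsupp.linearCombination k (fun t => f (B.toDec t)) (B.R.normalForm k t) := by
  conv_lhs => rw [B.eq_expand hf, B.expand_toDec h h', linearCombination_toDec_boxMap]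

/-- `f` vanishes on the normal trees of weight less than `w`. -/
def VanishesBelow (f : DecTree P.Op → k) (w : ℕ) : Prop :=
  ∀ t, B.R.Normal t → t.IsNode → t.weight < w → f (B.toDec t) = 0

open Classical in
/-- The values of `f` on the normal trees of weight `w`. -/
def leading (f : DecTree P.Op → k) (w : ℕ) (t : BoxTree P.Gen) : k :=
  if B.R.Normal t ∧ t.IsNode ∧ t.weight = w then f (B.toDec t) else 0

variable {B}

/-- On a non-normal tree of weight at most `w` the value of `f` is a combination of its values on
normal trees of smaller weight, which are zero. Up to weight `w`, `f` thus behaves as if non-normal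
trees were zero, as `homotopy_spec` requires. -/
theorem VanishesBelow.leading_eq {f : DecTree P.Op → k} {w : ℕ} (h : B.VanishesBelow f w)
    (hf : DecTree.IsMultilinear k f) {t : BoxTree P.Gen} (ht : t.Proper) (ht' : t.IsNode)
    (hw : t.weight ≤ w) : B.leading f w t = f (B.toDec t) := by
  rw [leading]
  split_ifs with h'
  · rfl
  by_cases hn : B.R.Normal t
  · exact (h t hn ht' (lt_of_le_of_ne hw fun h'' => h' ⟨hn, ht', h''⟩)).symm
  · have h₁ := (B.R.normalForm_mem (k := k) ht).2.2 hn
    have h₂ := (B.R.normalForm_mem (k := k) ht).2.1 ht'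
    have h₃ := B.R.weight_pos_of_not_normal ht hn
    rw [Finsupp.mem_supported] at h₁ h₂
    rw [B.toDec_eq_normalForm hf ht ht', Finsupp.linearCombination_apply, Finsupp.sum]
    refine (Finset.sum_eq_zero fun s hs => ?_).symm
    rw [h s (h₁ hs).1 (h₂ hs).1 (by have := (h₁ hs).2.2.2; omega), smul_zero]

theorem leading_of_weight_ne {f : DecTree P.Op → k} {w : ℕ} {t : BoxTree P.Gen}
    (h : t.weight ≠ w) : B.leading f w t = 0 := if_neg fun h' => h h'.2.2

theorem leading_homotopy_of_weight_ne {f : DecTree P.Op → k} {w : ℕ} {t : BoxTree P.Gen}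
    (h : t.weight ≠ w) :
    Finsupp.linearCombination k (B.leading f w) (B.R.homotopy k t) = 0 := by
  rw [BoxTree.linearCombination_congr (B.R.homotopy_mem t) (ψ := fun _ => 0) fun s hs => ?_,
    BoxTree.linearCombination_zero]
  exact leading_of_weight_ne (hs.1.2.1 ▸ h)

/-- The correction is the transposed homotopy of the leading part of `f`. By the homotopy formula
its coboundary has the same leading part, up to a term containing the coboundary of `f`, which is
zero. -/
theorem VanishesBelow.exists_step {n i w : ℕ} {f : DecTree P.Op → k} (h : B.VanishesBelow f w)
    (hf : f ∈ P.bar n (i + 1)) (hd : P.barD f = 0) :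
    ∃ g ∈ P.bar n (i + 2), B.VanishesBelow (f - P.barD g) (w + 1) := by
  have hg : B.ofNormal (fun t => Finsupp.linearCombination k (B.leading f w) (B.R.homotopy k t)) ∈
      P.bar n (i + 2) := by
    refine B.ofNormal_mem fun t ht => ?_
    rw [BoxTree.linearCombination_congr (B.R.homotopy_mem t) (ψ := fun _ => 0) fun s hs => ?_,
      BoxTree.linearCombination_zero]
    rw [leading]
    split_ifs with h'
    · refine hf.2 _ fun h'' => ht ?_
      rw [B.leaves_toDec h'.1.proper h'.2.1, B.verts_toDec h'.1.proper h'.2.1, hs.1.1] at h''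
      have := hs.2
      simp only [Set.mem_ofPred_eq] at this
      omega
    · rfl
  refine ⟨_, hg, fun t ht ht' hw => ?_⟩
  have htp := ht.proper
  have hmem := B.barD_mem hg
  -- In any other arity or degree both functions vanish.
  by_cases hcount : t.leaves = n ∧ t.boxes + 1 + (i + 1) + 1 = n
  swap
  · rw [Pi.sub_apply, hf.2 _ (by rwa [B.leaves_toDec htp ht', B.verts_toDec htp ht']),
      hmem.2 _ (by rwa [B.leaves_toDec htp ht', B.verts_toDec htp ht']), sub_zero]
  -- Critical trees have degree zero, whereas `t` now has degree `i + 1`.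
  have hc : ¬ B.R.Critical t := fun hc => by
    have := hc.boxes
    omega
  rw [Pi.sub_apply, B.barD_toDec hg.1 htp ht']
  -- On a non-normal `s` the correction is evaluated through the normal form, whose trees have
  -- weight below `w`; there the leading part and its homotopy vanish, in agreement with
  -- `homotopyDual`.
  have e₁ : ∀ s ∈ t.similar ∩ {s | s.boxes + 1 = t.boxes},
      B.ofNormal (fun t => Finsupp.linearCombination k (B.leading f w) (B.R.homotopy k t))
        (B.toDec s) = B.R.homotopyDual k (B.leading f w) s := by
    rintro s ⟨hs, -⟩
    have hsp := hs.2.2.1 htp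
    have hsn := BoxTree.isNode_of_similar hs ht'
    rw [B.ofNormal_toDec _ hsp hsn, LeftRewriting.homotopyDual]
    split_ifs with hN
    · rw [B.R.normalForm_of_normal hN, Finsupp.linearCombination_single, one_smul]
    · have h₃ := B.R.weight_pos_of_not_normal hsp hN
      have h₄ := hs.2.1
      rw [BoxTree.linearCombination_congr ((B.R.normalForm_mem (k := k) hsp).2.2 hN)
        (ψ := fun _ => 0) fun s' hs' => ?_, BoxTree.linearCombination_zero]
      refine leading_homotopy_of_weight_ne ?_
      have := hs'.2.2.2
      omega
  rw [BoxTree.linearCombination_congr (BoxTree.boundary_mem t) e₁]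
  have key := B.R.homotopy_spec (F := B.leading f w)
    (fun s hs => if_neg fun h' => hs h'.1) ht ht' hc
  rw [h.leading_eq hf.1 htp ht' (by omega), BoxTree.linearCombination_congr (B.R.homotopy_mem t)
    (ψ := fun _ => 0) fun s hs => ?_, BoxTree.linearCombination_zero, add_zero] at key
  · rw [key, sub_self]
  -- The second term of the homotopy formula: on these trees the leading part coincides with `f`, so
  -- the sum is a value of `barD f`.
  · have hsp := hs.1.2.2.1 htp
    have hsn := BoxTree.isNode_of_similar hs.1 ht'
    have e := B.barD_toDec hf.1 hsp hsn
    rw [hd] at e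
    rw [BoxTree.linearCombination_congr (BoxTree.boundary_mem s) (ψ := fun s => f (B.toDec s))
      fun s' hs' => ?_]
    · exact e.symm
    · refine h.leading_eq hf.1 (hs'.1.2.2.1 hsp) (BoxTree.isNode_of_similar hs'.1 hsn) ?_
      rw [hs'.1.2.1, hs.1.2.1]
      omega

theorem exact_bar (B : P.LeftPBW) (n i : ℕ) :
    (P.bar n (i + 2)).map P.barD = P.bar n (i + 1) ⊓ LinearMap.ker P.barD := by
  refine le_antisymm ?_ ?_
  · rintro _ ⟨f, hf, rfl⟩
    exact ⟨B.barD_mem hf, B.barD_barD hf.1⟩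
  · rintro f ⟨hf, hd⟩
    rw [SetLike.mem_coe, LinearMap.mem_ker] at hd
    have key : ∀ w, ∃ g ∈ P.bar n (i + 2), B.VanishesBelow (f - P.barD g) w := by
      intro w
      induction w with
      | zero => exact ⟨0, Submodule.zero_mem _, fun t _ _ h => (Nat.not_lt_zero _ h).elim⟩
      | succ w ih =>
        obtain ⟨g, hg, h⟩ := ih
        obtain ⟨g', hg', h'⟩ := h.exists_step (Submodule.sub_mem _ hf (B.barD_mem hg))
          (by rw [map_sub, hd, B.barD_barD hg.1, sub_zero])
        refine ⟨g + g', Submodule.add_mem _ hg hg', ?_⟩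
        rwa [map_add, ← sub_sub]
    -- No tree with `n` leaves has weight above `n * n`, so nothing is left after this many steps.
    obtain ⟨g, hg, h⟩ := key (n * n + 1)
    refine ⟨g, hg, ?_⟩
    have hmem := Submodule.sub_mem _ hf (B.barD_mem hg)
    refine (sub_eq_zero.1 (funext fun T => ?_)).symm
    by_cases hT : T.leaves = n
    · refine B.multilinear_ext hmem.1 DecTree.IsMultilinear.zero
        ?_ T fun t ht ht' hl _ => h t ht ht' ?_
      · exact hmem.2 _ fun h => by simp [DecTree.leaves, DecTree.verts] at h; omega
      · have := t.weight_le
        rw [hl, hT] at this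
        omega
    · exact hmem.2 _ fun h => hT h.1

end LeftPBW
end QuadraticData
end

/-! ### Functions on binary decorated trees and surjectivity of the augmentation. -/

noncomputable section

namespace DecTree

variable {E : ℕ → Type u}

theorem verts_lt_leaves (T : DecTree E) : T.verts + 1 ≤ T.leaves := by
  induction T with
  | leaf => exact le_rfl
  | @node n hn p c ih =>
    rw [verts, leaves]
    have : ∑ i, ((c i).verts + 1) ≤ ∑ i, (c i).leaves := Finset.sum_le_sum fun i _ => ih i
    rw [Finset.sum_add_distrib] at this
    simp only [Finset.sum_const, Finset.card_univ, Fintype.card_fin, smul_eq_mul, mul_one] at this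
    omega

variable {k : Type u} [Field k] [∀ n, AddCommGroup (E n)] [∀ n, Module k (E n)]

/-- The product of a linear function of the decoration of the root, of arity `n`, and of
functions of the `n` subtrees. -/
def rootProd {n : ℕ} (L : E n →ₗ[k] k) (φ : Fin n → DecTree E → k) : DecTree E → k
  | leaf => 0
  | node (n := m) _ p c => if h : m = n then L (h ▸ p) * ∏ i, φ i (c (Fin.cast h.symm i)) else 0

theorem rootProd_leaf {n : ℕ} (L : E n →ₗ[k] k) (φ : Fin n → DecTree E → k) :
    rootProd L φ leaf = 0 := rfl

theorem rootProd_node {n : ℕ} (L : E n →ₗ[k] k) (φ : Fin n → DecTree E → k) (hn : 2 ≤ n)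
    (p : E n) (c : Fin n → DecTree E) : rootProd L φ (node hn p c) = L p * ∏ i, φ i (c i) :=
  dif_pos rfl

theorem rootProd_node_of_ne {n m : ℕ} (L : E n →ₗ[k] k) (φ : Fin n → DecTree E → k) (hm : 2 ≤ m)
    (p : E m) (c : Fin m → DecTree E) (h : m ≠ n) : rootProd L φ (node hm p c) = 0 :=
  dif_neg h

theorem IsMultilinear.rootProd {n : ℕ} (L : E n →ₗ[k] k) {φ : Fin n → DecTree E → k}
    (hφ : ∀ i, IsMultilinear k (φ i)) : IsMultilinear k (rootProd L φ) := by
  refine IsMultilinear.of_root (fun {m} hm c => ?_) fun {m} hm p c i => ?_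
  · by_cases h : m = n
    · subst h
      simp only [rootProd_node]
      exact ((LinearMap.toSpanSingleton k k (∏ i, φ i (c i))).comp L).isLinear
    · simp only [rootProd_node_of_ne _ _ _ _ _ h]
      exact (0 : E m →ₗ[k] k).isLinear
  · by_cases h : m = n
    · subst h
      have e : ∀ X, DecTree.rootProd L φ (node hm p (Function.update c i X)) =
          (L p * ∏ j ∈ Finset.univ.erase i, φ j (c j)) * φ i X := by
        intro X
        rw [rootProd_node, ← Finset.mul_prod_erase _ _ (Finset.mem_univ i), Function.update_self,
          Finset.prod_congr rfl fun j hj => by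
            rw [Function.update_of_ne (Finset.ne_of_mem_erase hj)]]
        ring
      simp only [e]
      exact (hφ i).const_mul _
    · simp only [rootProd_node_of_ne _ _ _ _ _ h]
      exact IsMultilinear.zero

theorem leaves_of_rootProd_ne_zero {n : ℕ} {L : E n →ₗ[k] k} {φ : Fin n → DecTree E → k}
    {a b : Fin n → ℕ} (hφ : ∀ i T, φ i T ≠ 0 → T.leaves = a i ∧ T.verts = b i) {T : DecTree E}
    (hT : rootProd L φ T ≠ 0) : T.leaves = ∑ i, a i ∧ T.verts = 1 + ∑ i, b i := by
  cases T with
  | leaf => exact (hT rfl).elim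
  | @node m hm p c =>
    by_cases h : m = n
    · subst h
      rw [rootProd_node] at hT
      have h' := fun i => hφ i (c i) (Finset.prod_ne_zero_iff.1 (right_ne_zero_of_mul hT) i
        (Finset.mem_univ i))
      rw [leaves, verts]
      exact ⟨Finset.sum_congr rfl fun i _ => (h' i).1,
        congrArg _ (Finset.sum_congr rfl fun i _ => (h' i).2)⟩
    · exact (hT (rootProd_node_of_ne _ _ _ _ _ h)).elim

/-- The function that is one at the leaf and zero elsewhere. -/
def leafFun : DecTree E → k
  | leaf => 1
  | node _ _ _ => 0

theorem isMultilinear_leafFun : IsMultilinear k (leafFun (k := k) (E := E)) :=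
  IsMultilinear.of_root (fun _ _ => (0 : _ →ₗ[k] k).isLinear) fun _ _ _ _ => IsMultilinear.zero

end DecTree

namespace QuadraticData

variable {k : Type u} [Field k] (P : QuadraticData k)

/-- The nilpotent algebra of class three given by a relation of the quadratic dual. -/
def cubicAlg {s : (P.Gen × P.Gen → k) × (P.Gen × P.Gen → k)} (hs : s ∈ P.dual.rel) :
    P.Alg (k × (P.Gen → k) × k) where
  op g := LinearMap.mk₂ k (fun x y => (0, Pi.single g (x.1 * y.1),
      (∑ h, s.1 (h, g) * x.2.1 h) * y.1 + x.1 * ∑ h, s.2 (g, h) * y.2.1 h))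
    (by
      intro x x' y
      refine Prod.ext (by simp) (Prod.ext ?_ ?_)
      · simp [add_mul, Pi.single_add]
      · simp only [Prod.fst_add, Prod.snd_add, Pi.add_apply, mul_add, Finset.sum_add_distrib]
        ring)
    (by
      intro a x y
      refine Prod.ext (by simp) (Prod.ext ?_ ?_)
      · simp [mul_assoc, ← Pi.single_smul]
      · simp only [Prod.smul_fst, Prod.smul_snd, Pi.smul_apply, smul_eq_mul, mul_left_comm _ a,
          ← Finset.mul_sum]
        ring)
    (by
      intro x y y'
      refine Prod.ext (by simp) (Prod.ext ?_ ?_)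
      · simp [mul_add, Pi.single_add]
      · simp only [Prod.fst_add, Prod.snd_add, Pi.add_apply, mul_add, Finset.sum_add_distrib]
        ring)
    (by
      intro a x y
      refine Prod.ext (by simp) (Prod.ext ?_ ?_)
      · simp [mul_left_comm, ← Pi.single_smul]
      · simp only [Prod.smul_fst, Prod.smul_snd, Pi.smul_apply, smul_eq_mul, mul_left_comm _ a,
          ← Finset.mul_sum]
        ring)
  relation r hr x y z := by
    have h := sub_eq_zero.1 (hs r hr)
    have e₁ : ∀ g : P.Gen × P.Gen, ∑ h, s.1 (h, g.2) * (Pi.single g.1 (x.1 * y.1) : P.Gen → k) h =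
        s.1 g * (x.1 * y.1) := fun g => by
      rw [Finset.sum_eq_single g.1 (fun h _ hh => by rw [Pi.single_eq_of_ne hh, mul_zero])
        (by simp), Pi.single_eq_same]
    have e₂ : ∀ g : P.Gen × P.Gen, ∑ h, s.2 (g.1, h) * (Pi.single g.2 (y.1 * z.1) : P.Gen → k) h =
        s.2 g * (y.1 * z.1) := fun g => by
      rw [Finset.sum_eq_single g.2 (fun h _ hh => by rw [Pi.single_eq_of_ne hh, mul_zero])
        (by simp), Pi.single_eq_same]
    simp only [LinearMap.mk₂_apply, e₁, e₂, zero_mul, mul_zero, Pi.single_zero, add_zero, zero_add]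
    have e₃ : ∀ (φ : P.Gen × P.Gen → k) (ψ : P.Gen × P.Gen → k),
        ∑ g, φ g • ((0 : k), (0 : P.Gen → k), ψ g) = (0, 0, ∑ g, φ g * ψ g) := by
      intro φ ψ
      simp [Prod.ext_iff, Prod.fst_sum, Prod.snd_sum]
    rw [e₃, e₃]
    refine congrArg (fun a => ((0 : k), (0 : P.Gen → k), a)) ?_
    have e₄ : ∑ g, r.1 g * (s.1 g * (x.1 * y.1) * z.1) =
        (∑ g, s.1 g * r.1 g) * (x.1 * y.1 * z.1) := by
      rw [Finset.sum_mul]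
      exact Finset.sum_congr rfl fun g _ => by ring
    have e₅ : ∑ g, r.2 g * (x.1 * (s.2 g * (y.1 * z.1))) =
        (∑ g, s.2 g * r.2 g) * (x.1 * y.1 * z.1) := by
      rw [Finset.sum_mul]
      exact Finset.sum_congr rfl fun g _ => by ring
    exact e₄.trans ((congrArg (· * (x.1 * y.1 * z.1)) h).trans e₅.symm)

theorem cubicAlg_op {s : (P.Gen × P.Gen → k) × (P.Gen × P.Gen → k)} (hs : s ∈ P.dual.rel)
    (g : P.Gen) (x y : k × (P.Gen → k) × k) : (P.cubicAlg hs).op g x y = (0,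
      Pi.single g (x.1 * y.1), (∑ h, s.1 (h, g) * x.2.1 h) * y.1 +
        x.1 * ∑ h, s.2 (g, h) * y.2.1 h) := rfl

/-- The coefficient of a generator. -/
def coord (g : P.Gen) : P.Op 2 →ₗ[k] k where
  toFun p := ((P.cubicAlg (Submodule.zero_mem P.dual.rel)).eval 2 p fun _ => (1, 0, 0)).2.1 g
  map_add' p q := by simp
  map_smul' a p := by simp

/-- A product of `(1, 0, 0)` with itself in the cubic algebra records the generator in the middle
component. For this the zero relation suffices. -/
theorem coord_gen (g h : P.Gen) : P.coord g (P.gen h) = if g = h then 1 else 0 := by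
  have : P.gen h = P.treeClass (n := 2) (.node h .leaf .leaf) (BinTree.leaves_corolla h) := rfl
  change ((P.cubicAlg (Submodule.zero_mem P.dual.rel)).eval 2 _ fun _ => (1, 0, 0)).2.1 g = _
  rw [this, Alg.eval_treeClass]
  change (Pi.single h ((1 : k) * 1) : P.Gen → k) g = _
  rw [mul_one, Pi.single_apply]

/-- The linear function on the ternary operations given by a relation of the quadratic dual. -/
def ternary {s : (P.Gen × P.Gen → k) × (P.Gen × P.Gen → k)} (hs : s ∈ P.dual.rel) :
    P.Op 3 →ₗ[k] k where
  toFun p := ((P.cubicAlg hs).eval 3 p fun _ => (1, 0, 0)).2.2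
  map_add' p q := by simp
  map_smul' a p := by simp

/-- The first product of `(1, 0, 0)` with itself records the inner generator, and the second one
pairs it with the outer generator through `s`. -/
theorem ternary_leftComb {s : (P.Gen × P.Gen → k) × (P.Gen × P.Gen → k)} (hs : s ∈ P.dual.rel)
    (a b : P.Gen) : P.ternary hs (P.treeClass (n := 3) (BinTree.leftComb a b).1
      (BinTree.leftComb a b).2) = s.1 (a, b) := by
  change ((P.cubicAlg hs).eval 3 _ fun _ => (1, 0, 0)).2.2 = _
  rw [Alg.eval_treeClass]
  simp [BinTree.leftComb, Alg.evalTree, cubicAlg_op, Pi.single_apply]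

theorem ternary_rightComb {s : (P.Gen × P.Gen → k) × (P.Gen × P.Gen → k)} (hs : s ∈ P.dual.rel)
    (a b : P.Gen) : P.ternary hs (P.treeClass (n := 3) (BinTree.rightComb a b).1
      (BinTree.rightComb a b).2) = s.2 (a, b) := by
  change ((P.cubicAlg hs).eval 3 _ fun _ => (1, 0, 0)).2.2 = _
  rw [Alg.eval_treeClass]
  simp [BinTree.rightComb, Alg.evalTree, cubicAlg_op, Pi.single_apply]

/-- The dual basis of the binary trees. -/
def binFun : BinTree P.Gen → DecTree P.Op → k
  | .leaf => DecTree.leafFun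
  | .node g l r => DecTree.rootProd (P.coord g) ![binFun l, binFun r]

theorem isMultilinear_binFun (t : BinTree P.Gen) : DecTree.IsMultilinear k (P.binFun t) := by
  induction t with
  | leaf => exact DecTree.isMultilinear_leafFun
  | node g l r ihl ihr =>
    exact DecTree.IsMultilinear.rootProd _ (Fin.forall_fin_two.2 ⟨ihl, ihr⟩)

theorem leaves_of_binFun_ne_zero {t : BinTree P.Gen} {T : DecTree P.Op} (h : P.binFun t T ≠ 0) :
    T.leaves = t.leaves ∧ T.verts = t.verts := by
  induction t generalizing T with
  | leaf =>
    cases T with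
    | leaf => exact ⟨rfl, rfl⟩
    | node => exact (h rfl).elim
  | node g l r ihl ihr =>
    have := DecTree.leaves_of_rootProd_ne_zero (a := ![l.leaves, r.leaves])
      (b := ![l.verts, r.verts]) (Fin.forall_fin_two.2 ⟨fun T => ihl, fun T => ihr⟩) h
    simpa [BinTree.leaves, BinTree.verts, add_comm] using this

open Classical in
theorem binFun_ofBinTree (t s : BinTree P.Gen) :
    P.binFun t (P.ofBinTree s) = if t = s then 1 else 0 := by
  induction t generalizing s with
  | leaf => cases s <;> simp [binFun, ofBinTree, DecTree.leafFun]
  | node g l r ihl ihr =>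
    cases s with
    | leaf => simp [binFun, ofBinTree, DecTree.rootProd_leaf]
    | node g' l' r' =>
      rw [binFun, ofBinTree, DecTree.rootProd_node, coord_gen, Fin.prod_univ_two]
      simp only [Matrix.cons_val_zero, Matrix.cons_val_one, ihl, ihr, BinTree.node.injEq]
      split_ifs <;> simp_all

end QuadraticData

namespace BinTree

variable {G : Type}

theorem verts_add_one (t : BinTree G) : t.verts + 1 = t.leaves := by
  induction t with
  | leaf => rfl
  | node g l r ihl ihr => rw [verts, leaves]; omega

theorem sign_mul_self (t : BinTree G) : t.sign * t.sign = 1 := by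
  induction t with
  | leaf => rfl
  | node g l r ihl ihr =>
    have : ((-1 : ℤ) ^ l.verts) * (-1) ^ l.verts = 1 := by rw [← mul_pow]; simp
    rw [sign]
    linear_combination (l.sign * l.sign * (r.sign * r.sign)) * this + r.sign * r.sign * ihl + ihr

end BinTree

namespace QuadraticData

variable {k : Type u} [Field k] (P : QuadraticData k)

theorem binFun_mem {n : ℕ} {t : BinTree P.Gen} (ht : t.leaves = n) : P.binFun t ∈ P.bar n 0 := by
  refine ⟨P.isMultilinear_binFun t, fun T hT => ?_⟩
  by_contra h
  obtain ⟨h₁, h₂⟩ := P.leaves_of_binFun_ne_zero h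
  have := t.verts_add_one
  exact hT (by omega)

theorem barAug_apply (n : ℕ) (f : DecTree P.Op → k) : P.barAug n f = (P.dual.ideal n).mkQ
    ((Finsupp.linearEquivFunOnFinite k k {t : BinTree P.Gen // t.leaves = n}).symm
      fun t => (t.1.sign : k) * f (P.ofBinTree t.1)) := rfl

/-- The dual basis function of a tree, times the sign of the tree, is mapped to the class of the
tree, since the sign squares to one. -/
theorem map_barAug (n : ℕ) : (P.bar n 0).map (P.barAug n) = ⊤ := by
  classical
  rw [eq_top_iff]
  rintro x -
  suffices H : ∀ (t : BinTree P.Gen) ht, P.dual.treeClass t ht ∈ (P.bar n 0).map (P.barAug n) by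
    induction x using P.dual.op_induction with
    | zero => exact Submodule.zero_mem _
    | add x y hx hy => exact Submodule.add_mem _ hx hy
    | smul a x hx => exact Submodule.smul_mem _ a hx
    | tree t ht => exact H t ht
  intro t ht
  refine ⟨(t.sign : k) • P.binFun t, Submodule.smul_mem _ _ (P.binFun_mem ht), ?_⟩
  rw [barAug_apply]
  refine congrArg _ (Finsupp.ext fun s => ?_)
  change {t : BinTree P.Gen // t.leaves = n} at s
  change (s.1.sign : k) * ((t.sign : k) * P.binFun t (P.ofBinTree s.1)) =
    Finsupp.single (⟨t, ht⟩ : {t : BinTree P.Gen // t.leaves = n}) (1 : k) s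
  have hsq : (t.sign : k) * t.sign = 1 := by rw [← Int.cast_mul, t.sign_mul_self, Int.cast_one]
  rw [binFun_ofBinTree, Finsupp.single_apply]
  by_cases h : t = s.1
  · obtain ⟨s, hs⟩ := s
    subst h
    simpa using hsq
  · rw [if_neg h, if_neg fun h' => h (congrArg Subtype.val h')]
    simp

/-- Having one vertex less than leaves forces every vertex to be binary. Binary decorations are
combinations of generators, so multilinearity leaves only the trees labelled by generators. -/
theorem eq_zero_of_ofBinTree {f : DecTree P.Op → k} (hf : DecTree.IsMultilinear k f)
    {T : DecTree P.Op} (hT : T.verts + 1 = T.leaves)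
    (h : ∀ t, t.leaves = T.leaves → f (P.ofBinTree t) = 0) : f T = 0 := by
  induction T generalizing f with
  | leaf => exact h .leaf rfl
  | @node n hn p c ih =>
    have h₁ : ∀ i, (c i).verts + 1 ≤ (c i).leaves := fun i => (c i).verts_lt_leaves
    rw [DecTree.verts, DecTree.leaves] at hT
    rw [DecTree.leaves] at h
    have h₂ : ∑ i, ((c i).verts + 1) ≤ ∑ i, (c i).leaves := Finset.sum_le_sum fun i _ => h₁ i
    rw [Finset.sum_add_distrib] at h₂
    simp only [Finset.sum_const, Finset.card_univ, Fintype.card_fin, smul_eq_mul, mul_one] at h₂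
    -- Each subtree has at least one leaf more than vertices, so a root with three or more inputs
    -- would violate the equality `hT`.
    obtain rfl : n = 2 := by omega
    rw [Fin.sum_univ_two, Fin.sum_univ_two] at hT
    rw [Fin.sum_univ_two] at h
    have h₃ := h₁ 0
    have h₄ := h₁ 1
    induction p using P.op_induction with
    | zero => exact (hf.root hn c).map_zero
    | add p q hp hq => rw [(hf.root hn c).map_add, hp, hq, add_zero]
    | smul a p hp => rw [(hf.root hn c).map_smul, hp, smul_zero]
    | tree s hs =>
      obtain ⟨g, rfl⟩ : ∃ g, s = .node g .leaf .leaf := by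
        cases s with
        | leaf => simp [BinTree.leaves] at hs
        | node g l r =>
          rw [BinTree.leaves] at hs
          have := l.leaves_pos
          have := r.leaves_pos
          cases l with
          | node _ l l' =>
            have := l.leaves_pos
            have := l'.leaves_pos
            simp only [BinTree.leaves] at hs
            omega
          | leaf =>
            cases r with
            | node _ r r' =>
              have := r.leaves_pos
              have := r'.leaves_pos
              simp only [BinTree.leaves] at hs
              omega
            | leaf => exact ⟨g, rfl⟩
      change f (.node hn (P.gen g) c) = 0
      rw [← Function.update_eq_self 0 c]
      refine ih 0 (hf.update hn (P.gen g) c 0) (by omega) fun t ht => ?_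
      rw [← Function.update_eq_self 1 (Function.update c 0 (P.ofBinTree t))]
      rw [Function.update_of_ne (by decide)]
      refine ih 1 (hf.update hn (P.gen g) (Function.update c 0 (P.ofBinTree t)) 1) (by omega)
        fun t' ht' => ?_
      have e : Function.update (Function.update c 0 (P.ofBinTree t)) 1 (P.ofBinTree t') =
          ![P.ofBinTree t, P.ofBinTree t'] := by
        funext j
        fin_cases j <;> simp
      rw [e]
      exact h (.node g t t') (by rw [BinTree.leaves, ht, ht'])

end QuadraticData
end

/-! ### Contraction of one edge of a binary tree, with signs. -/

noncomputable section

/-- Planar trees with one ternary vertex and with binary vertices labelled by `G`. -/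
inductive TernTree (G : Type) : Type
  | tri (x y z : BinTree G) : TernTree G
  | inL (g : G) (m : TernTree G) (r : BinTree G) : TernTree G
  | inR (g : G) (l : BinTree G) (m : TernTree G) : TernTree G

namespace TernTree

variable {G : Type}

def leaves : TernTree G → ℕ
  | tri x y z => x.leaves + y.leaves + z.leaves
  | inL _ m r => m.leaves + r.leaves
  | inR _ l m => l.leaves + m.leaves

/-- The binary tree obtained by replacing the ternary vertex by a left comb (`e.1 = true`) or a
right comb. -/
def resolve : TernTree G → Bool × G × G → BinTree G
  | tri x y z, (true, a, b) => .node b (.node a x y) z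
  | tri x y z, (false, a, b) => .node a x (.node b y z)
  | inL g m r, e => .node g (m.resolve e) r
  | inR g l m, e => .node g l (m.resolve e)

theorem leaves_resolve (τ : TernTree G) (e : Bool × G × G) : (τ.resolve e).leaves = τ.leaves := by
  induction τ with
  | tri x y z =>
    obtain ⟨_ | _, a, b⟩ := e <;> simp [resolve, leaves, BinTree.leaves, add_assoc]
  | inL g m r ih => simp [resolve, leaves, BinTree.leaves, ih]
  | inR g l m ih => simp [resolve, leaves, BinTree.leaves, ih]

/-- The sign relating the orientations of a tree and of its resolutions. -/
def sign : TernTree G → ℤ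
  | tri x y z => -((-1) ^ y.verts * x.sign * y.sign * z.sign)
  | inL _ m r => (-1) ^ m.leaves * m.sign * r.sign
  | inR _ l m => -(l.sign * m.sign)

theorem sign_mul_self (τ : TernTree G) : τ.sign * τ.sign = 1 := by
  induction τ with
  | tri x y z =>
    have h : ((-1 : ℤ) ^ y.verts) * (-1) ^ y.verts = 1 := by rw [← mul_pow]; simp
    rw [sign]
    linear_combination (x.sign * x.sign * (y.sign * y.sign) * (z.sign * z.sign)) * h +
      (y.sign * y.sign) * (z.sign * z.sign) * x.sign_mul_self + z.sign * z.sign * y.sign_mul_self +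
      z.sign_mul_self
  | inL g m r ih =>
    have h : ((-1 : ℤ) ^ m.leaves) * (-1) ^ m.leaves = 1 := by rw [← mul_pow]; simp
    rw [sign]
    linear_combination (m.sign * m.sign * (r.sign * r.sign)) * h + r.sign * r.sign * ih +
      r.sign_mul_self
  | inR g l m ih =>
    rw [sign]
    linear_combination (l.sign * l.sign) * ih + l.sign_mul_self

/-- The sign of a comb. -/
def combSign (e : Bool × G × G) : ℤ := if e.1 then 1 else -1

/-- The comb with three leaves. -/
def comb : Bool × G × G → {t : BinTree G // t.leaves = 3}
  | (true, a, b) => BinTree.leftComb a b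
  | (false, a, b) => BinTree.rightComb a b

end TernTree

namespace BinTree

variable (k : Type u) [Field k] {G : Type}

open TernTree

/-- The contraction of the edge to the left of the root. -/
def leftEdge (g : G) : BinTree G → BinTree G → (TernTree G × Bool × G × G →₀ k)
  | leaf, _ => 0
  | node a x y, z => Finsupp.single (tri x y z, true, a, g) 1

/-- The contraction of the edge to the right of the root. -/
def rightEdge (g : G) (x : BinTree G) : BinTree G → (TernTree G × Bool × G × G →₀ k)
  | leaf => 0
  | node b y z => Finsupp.single (tri x y z, false, g, b) 1

/-- The alternating sum of the contractions of the edges of a binary tree. -/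
def edges : BinTree G → (TernTree G × Bool × G × G →₀ k)
  | leaf => 0
  | node g l r => (leftEdge k g l r -
        Finsupp.mapDomain (fun x => (inL g x.1 r, x.2)) (edges l)) +
      (-1 : k) ^ l.verts • (rightEdge k g l r -
        Finsupp.mapDomain (fun x => (inR g l x.1, x.2)) (edges r))

variable {k}

theorem leftEdge_inL (g g' : G) (l r r' : BinTree G) (m : TernTree G) (e : Bool × G × G) :
    leftEdge k g l r (inL g' m r', e) = 0 := by
  cases l <;> simp [leftEdge]

theorem leftEdge_inR (g g' : G) (l r l' : BinTree G) (m : TernTree G) (e : Bool × G × G) :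
    leftEdge k g l r (inR g' l' m, e) = 0 := by
  cases l <;> simp [leftEdge]

theorem rightEdge_inL (g g' : G) (l r r' : BinTree G) (m : TernTree G) (e : Bool × G × G) :
    rightEdge k g l r (inL g' m r', e) = 0 := by
  cases r <;> simp [rightEdge]

theorem rightEdge_inR (g g' : G) (l r l' : BinTree G) (m : TernTree G) (e : Bool × G × G) :
    rightEdge k g l r (inR g' l' m, e) = 0 := by
  cases r <;> simp [rightEdge]

open Classical in
theorem leftEdge_tri (g : G) (l r x y z : BinTree G) (e : Bool × G × G) :
    leftEdge k g l r (tri x y z, e) =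
      if e.1 = true ∧ node g l r = (tri x y z).resolve e then 1 else 0 := by
  obtain ⟨_ | _, a, b⟩ := e
  · cases l <;> simp [leftEdge]
  · cases l with
    | leaf => simp [leftEdge, resolve]
    | node g' l₁ l₂ =>
      simp only [leftEdge, resolve, Finsupp.single_apply, Prod.mk.injEq, tri.injEq, node.injEq,
        true_and]
      refine if_congr ?_ rfl rfl
      tauto

open Classical in
theorem rightEdge_tri (g : G) (l r x y z : BinTree G) (e : Bool × G × G) :
    rightEdge k g l r (tri x y z, e) =
      if e.1 = false ∧ node g l r = (tri x y z).resolve e then 1 else 0 := by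
  obtain ⟨_ | _, a, b⟩ := e
  · cases r with
    | leaf => simp [rightEdge, resolve]
    | node g' r₁ r₂ =>
      simp only [rightEdge, resolve, Finsupp.single_apply, Prod.mk.injEq, tri.injEq, node.injEq,
        true_and]
      refine if_congr ?_ rfl rfl
      tauto
  · cases r <;> simp [rightEdge]

theorem mapDomain_inL_tri (g : G) (r x y z : BinTree G) (e : Bool × G × G)
    (v : TernTree G × Bool × G × G →₀ k) :
    Finsupp.mapDomain (fun x => (inL g x.1 r, x.2)) v (tri x y z, e) = 0 :=
  Finsupp.mapDomain_of_notMem_range _ _ fun h => by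
    obtain ⟨_, h⟩ := h
    simp at h

theorem mapDomain_inR_tri (g : G) (l x y z : BinTree G) (e : Bool × G × G)
    (v : TernTree G × Bool × G × G →₀ k) :
    Finsupp.mapDomain (fun x => (inR g l x.1, x.2)) v (tri x y z, e) = 0 :=
  Finsupp.mapDomain_of_notMem_range _ _ fun h => by
    obtain ⟨_, h⟩ := h
    simp at h

theorem mapDomain_inL_inR (g g' : G) (r l : BinTree G) (m : TernTree G) (e : Bool × G × G)
    (v : TernTree G × Bool × G × G →₀ k) :
    Finsupp.mapDomain (fun x => (inL g x.1 r, x.2)) v (inR g' l m, e) = 0 :=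
  Finsupp.mapDomain_of_notMem_range _ _ fun h => by
    obtain ⟨_, h⟩ := h
    simp at h

theorem mapDomain_inR_inL (g g' : G) (r l : BinTree G) (m : TernTree G) (e : Bool × G × G)
    (v : TernTree G × Bool × G × G →₀ k) :
    Finsupp.mapDomain (fun x => (inR g l x.1, x.2)) v (inL g' m r, e) = 0 :=
  Finsupp.mapDomain_of_notMem_range _ _ fun h => by
    obtain ⟨_, h⟩ := h
    simp at h

open Classical in
theorem mapDomain_inL_inL (g g' : G) (r r' : BinTree G) (m : TernTree G) (e : Bool × G × G)
    (v : TernTree G × Bool × G × G →₀ k) :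
    Finsupp.mapDomain (fun x => (inL g x.1 r, x.2)) v (inL g' m r', e) =
      if g = g' ∧ r = r' then v (m, e) else 0 := by
  split_ifs with h
  · obtain ⟨rfl, rfl⟩ := h
    exact Finsupp.mapDomain_apply (fun x y h => by
      simp only [Prod.mk.injEq, inL.injEq] at h
      exact Prod.ext h.1.2.1 h.2) v (m, e)
  · refine Finsupp.mapDomain_of_notMem_range _ _ fun h' => h ?_
    obtain ⟨_, h'⟩ := h'
    simp only [Prod.mk.injEq, inL.injEq] at h'
    exact ⟨h'.1.1, h'.1.2.2⟩

open Classical in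
theorem mapDomain_inR_inR (g g' : G) (l l' : BinTree G) (m : TernTree G) (e : Bool × G × G)
    (v : TernTree G × Bool × G × G →₀ k) :
    Finsupp.mapDomain (fun x => (inR g l x.1, x.2)) v (inR g' l' m, e) =
      if g = g' ∧ l = l' then v (m, e) else 0 := by
  split_ifs with h
  · obtain ⟨rfl, rfl⟩ := h
    exact Finsupp.mapDomain_apply (fun x y h => by
      simp only [Prod.mk.injEq, inR.injEq, true_and] at h
      exact Prod.ext h.1 h.2) v (m, e)
  · refine Finsupp.mapDomain_of_notMem_range _ _ fun h' => h ?_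
    obtain ⟨_, h'⟩ := h'
    simp only [Prod.mk.injEq, inR.injEq] at h'
    exact ⟨h'.1.1, h'.1.2.1⟩

-- Once trees are weighted by `BinTree.sign`, the coefficient of a contraction depends only on the
-- contracted tree and on the side of the comb. So the two resolutions of a ternary vertex enter
-- with opposite signs wherever the vertex is, matching the minus sign in a relation.
open Classical in
theorem sign_mul_edges (t : BinTree G) (τ : TernTree G) (e : Bool × G × G) :
    (t.sign : k) * t.edges k (τ, e) =
      if t = τ.resolve e then (τ.sign : k) * (combSign e : k) else 0 := by
  induction t generalizing τ with
  | leaf =>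
    rw [if_neg, edges, Finsupp.zero_apply, mul_zero]
    cases τ <;> obtain ⟨_ | _, a, b⟩ := e <;> simp [resolve]
  | node g l r ihl ihr =>
    have sq : (-1 : k) ^ l.verts * (-1 : k) ^ l.verts = 1 := by rw [← mul_pow]; simp
    rw [edges, Finsupp.add_apply, Finsupp.smul_apply, Finsupp.sub_apply, Finsupp.sub_apply]
    cases τ with
    | tri x y z =>
      rw [mapDomain_inL_tri, mapDomain_inR_tri, leftEdge_tri, rightEdge_tri]
      by_cases h : node g l r = (tri x y z).resolve e
      swap
      · simp [h]
      obtain ⟨_ | _, a, b⟩ := e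
      · rw [resolve, node.injEq] at h
        obtain ⟨rfl, rfl, rfl⟩ := h
        simp only [resolve, combSign, sign, TernTree.sign]
        push_cast
        simp
        linear_combination ((-1) ^ y.verts * (l.sign : k) * y.sign * z.sign) * sq
      · rw [resolve, node.injEq] at h
        obtain ⟨rfl, rfl, rfl⟩ := h
        have sq' : (-1 : k) ^ x.verts * (-1 : k) ^ x.verts = 1 := by rw [← mul_pow]; simp
        simp only [resolve, combSign, sign, TernTree.sign, verts]
        push_cast
        simp
        linear_combination (-(-1) ^ y.verts * (x.sign : k) * y.sign * r.sign) * sq'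
    | inL g' m r' =>
      rw [leftEdge_inL, rightEdge_inL, mapDomain_inL_inL, mapDomain_inR_inL]
      by_cases h : g = g' ∧ r = r'
      · obtain ⟨rfl, rfl⟩ := h
        have ih := ihl m
        simp only [resolve, node.injEq, true_and, and_true, sign, TernTree.sign, if_true]
        by_cases h' : l = m.resolve e
        · rw [if_pos h'] at ih ⊢
          have hv := l.verts_add_one
          rw [h', leaves_resolve, ← h'] at hv
          rw [← hv, pow_succ]
          push_cast
          linear_combination (-(-1 : k) ^ l.verts * r.sign) * ih
        · rw [if_neg h'] at ih ⊢
          push_cast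
          linear_combination (-(-1 : k) ^ l.verts * r.sign) * ih
      · rw [if_neg h, if_neg]
        · simp
        · simp only [resolve, node.injEq]
          tauto
    | inR g' l' m =>
      rw [leftEdge_inR, rightEdge_inR, mapDomain_inL_inR, mapDomain_inR_inR]
      by_cases h : g = g' ∧ l = l'
      · obtain ⟨rfl, rfl⟩ := h
        have ih := ihr m
        simp only [resolve, node.injEq, true_and, sign, TernTree.sign, and_self, if_true]
        split_ifs at ih ⊢ with h'
        · push_cast
          simp only [smul_eq_mul]
          linear_combination (-(l.sign : k)) * ih - (l.sign * r.sign * r.edges k (m, e) : k) * sq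
        · push_cast
          simp only [smul_eq_mul]
          linear_combination (-(l.sign : k)) * ih - (l.sign * r.sign * r.edges k (m, e) : k) * sq
      · rw [if_neg h, if_neg]
        · simp
        · simp only [resolve, node.injEq]
          tauto

end BinTree
end

/-! ### Decorated trees with one ternary vertex, and relations at a place of a tree. -/

noncomputable section

theorem update_pair_zero {α : Type*} (a b c : α) : Function.update ![a, b] 0 c = ![c, b] := by
  funext j
  fin_cases j <;> rfl

theorem update_pair_one {α : Type*} (a b c : α) : Function.update ![a, b] 1 c = ![a, c] := by
  funext j
  fin_cases j <;> rfl

namespace QuadraticData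

variable {k : Type u} [Field k] (P : QuadraticData k)

open TernTree

/-- A tree with one ternary vertex, decorated by `p`, as a decorated tree. -/
def ofTernTree (p : P.Op 3) : TernTree P.Gen → DecTree P.Op
  | tri x y z => .node (n := 3) (by omega) p ![P.ofBinTree x, P.ofBinTree y, P.ofBinTree z]
  | inL g m r => .node (n := 2) le_rfl (P.gen g) ![ofTernTree p m, P.ofBinTree r]
  | inR g l m => .node (n := 2) le_rfl (P.gen g) ![P.ofBinTree l, ofTernTree p m]

/-- The class of a comb in the operad. -/
def combClass (e : Bool × P.Gen × P.Gen) : P.Op 3 := P.treeClass (comb e).1 (comb e).2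

theorem isLinearMap_ofTernTree {f : DecTree P.Op → k} (hf : DecTree.IsMultilinear k f)
    (τ : TernTree P.Gen) : IsLinearMap k fun p => f (P.ofTernTree p τ) := by
  induction τ generalizing f with
  | tri x y z => exact hf.root _ _
  | inL g m r ih =>
    have := ih (hf.update le_rfl (P.gen g) ![.leaf, P.ofBinTree r] 0)
    simpa only [update_pair_zero, ofTernTree] using this
  | inR g l m ih =>
    have := ih (hf.update le_rfl (P.gen g) ![P.ofBinTree l, .leaf] 1)
    simpa only [update_pair_one, ofTernTree] using this

theorem verts_ofBinTree (t : BinTree P.Gen) : (P.ofBinTree t).verts = t.verts := by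
  induction t with
  | leaf => rfl
  | node g l r ihl ihr => simp [ofBinTree, DecTree.verts, BinTree.verts, ihl, ihr, add_comm]

theorem contract_left (f : DecTree P.Op → k) (g : P.Gen) (l r : BinTree P.Gen) :
    Finsupp.linearCombination k f (P.contract (n := 2) le_rfl (P.gen g)
      ![P.ofBinTree l, P.ofBinTree r] 0 (P.ofBinTree l)) =
    Finsupp.linearCombination k (fun x => f (P.ofTernTree (P.combClass x.2) x.1))
      (BinTree.leftEdge k g l r) := by
  cases l with
  | leaf => simp [ofBinTree, contract, BinTree.leftEdge]
  | node a x y =>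
    rw [ofBinTree, contract, BinTree.leftEdge, Finsupp.linearCombination_single,
      Finsupp.linearCombination_single, one_smul, one_smul, ofTernTree]
    refine congrArg f (congrArg₂ (DecTree.node (n := 3) _) ?_ ?_)
    · exact P.comp_treeClass (l := 3) 0 (by omega) (.node g .leaf .leaf) (.node a .leaf .leaf)
        (BinTree.leaves_corolla g) (BinTree.leaves_corolla a)
    · funext j
      fin_cases j <;> rfl

theorem contract_right (f : DecTree P.Op → k) (g : P.Gen) (l r : BinTree P.Gen) :
    Finsupp.linearCombination k f (P.contract (n := 2) le_rfl (P.gen g)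
      ![P.ofBinTree l, P.ofBinTree r] 1 (P.ofBinTree r)) =
    Finsupp.linearCombination k (fun x => f (P.ofTernTree (P.combClass x.2) x.1))
      (BinTree.rightEdge k g l r) := by
  cases r with
  | leaf => simp [ofBinTree, contract, BinTree.rightEdge]
  | node a x y =>
    rw [ofBinTree, contract, BinTree.rightEdge, Finsupp.linearCombination_single,
      Finsupp.linearCombination_single, one_smul, one_smul, ofTernTree]
    refine congrArg f (congrArg₂ (DecTree.node (n := 3) _) ?_ ?_)
    · exact P.comp_treeClass (l := 3) 1 (by omega) (.node g .leaf .leaf) (.node a .leaf .leaf)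
        (BinTree.leaves_corolla g) (BinTree.leaves_corolla a)
    · funext j
      fin_cases j <;> rfl

/-- Contracting an edge merges two generators into the class of a left or right comb at a ternary
vertex. -/
theorem barD_ofBinTree (f : DecTree P.Op → k) (t : BinTree P.Gen) :
    P.barD f (P.ofBinTree t) = Finsupp.linearCombination k
      (fun x => f (P.ofTernTree (P.combClass x.2) x.1)) (t.edges k) := by
  induction t generalizing f with
  | leaf =>
    rw [BinTree.edges, map_zero]
    exact LeftPBW.barD_leaf f
  | node g l r ihl ihr =>
    rw [ofBinTree, barD_node, Fin.sum_univ_two]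
    simp only [Matrix.cons_val_zero, Matrix.cons_val_one, update_pair_zero, update_pair_one]
    rw [contract_left, contract_right, ihl, ihr, BinTree.edges, map_add, map_smul, map_sub, map_sub,
      Finsupp.linearCombination_mapDomain, Finsupp.linearCombination_mapDomain,
      show Finset.univ.filter (· < (0 : Fin 2)) = ∅ by decide,
      show Finset.univ.filter (· < (1 : Fin 2)) = {0} by decide, Finset.sum_empty,
      Finset.sum_singleton, pow_zero, one_mul, Matrix.cons_val_zero, verts_ofBinTree]
    rfl

/-- The sum of trees obtained by putting a relation at the place of the ternary vertex. -/
def relVector {G : Type} [Fintype G] (s : (G × G → k) × (G × G → k)) (τ : TernTree G) :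
    BinTree G →₀ k :=
  ∑ x, Finsupp.single (τ.resolve (true, x)) (s.1 x) -
    ∑ x, Finsupp.single (τ.resolve (false, x)) (s.2 x)

/-- The relations that hold in the operad, in all arities. -/
def treeIdeal : Submodule k (BinTree P.Gen →₀ k) :=
  Submodule.span k {v | ∃ s ∈ P.rel, ∃ τ, v = relVector s τ}

/-- The bilinear extension of `BinTree.node`. -/
def nodeMap (k : Type u) [Field k] {G : Type} (g : G) :
    (BinTree G →₀ k) →ₗ[k] (BinTree G →₀ k) →ₗ[k] (BinTree G →₀ k) :=
  Finsupp.linearCombination k fun l => Finsupp.lmapDomain k k (.node g l)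

theorem nodeMap_single {G : Type} (g : G) (l r : BinTree G) (a b : k) :
    nodeMap k g (Finsupp.single l a) (Finsupp.single r b) =
      Finsupp.single (.node g l r) (a * b) := by
  simp [nodeMap, Finsupp.mapDomain_single]

/-- Grafting the place of a relation into a larger tree gives another place, here `inL`. -/
theorem nodeMap_mem_left (g : P.Gen) {x : BinTree P.Gen →₀ k} (hx : x ∈ P.treeIdeal)
    (y : BinTree P.Gen →₀ k) : nodeMap k g x y ∈ P.treeIdeal := by
  induction y using Finsupp.induction_linear with
  | zero => simp
  | add y y' h h' => rw [map_add]; exact Submodule.add_mem _ h h'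
  | single r b =>
    induction hx using Submodule.span_induction with
    | zero => simp
    | add x x' _ _ h h' => rw [map_add, LinearMap.add_apply]; exact Submodule.add_mem _ h h'
    | smul a x _ h => rw [map_smul, LinearMap.smul_apply]; exact Submodule.smul_mem _ _ h
    | mem x hx =>
      obtain ⟨s, hs, τ, rfl⟩ := hx
      have : nodeMap k g (relVector s τ) (Finsupp.single r b) = b • relVector s (inL g τ r) := by
        simp only [relVector, map_sub, map_sum, LinearMap.sub_apply, LinearMap.sum_apply,
          nodeMap_single, smul_sub, Finset.smul_sum, Finsupp.smul_single, smul_eq_mul, resolve,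
          mul_comm]
      rw [this]
      exact Submodule.smul_mem _ _ (Submodule.subset_span ⟨s, hs, _, rfl⟩)

theorem nodeMap_mem_right (g : P.Gen) (x : BinTree P.Gen →₀ k) {y : BinTree P.Gen →₀ k}
    (hy : y ∈ P.treeIdeal) : nodeMap k g x y ∈ P.treeIdeal := by
  induction x using Finsupp.induction_linear with
  | zero => simp
  | add x x' h h' => rw [map_add, LinearMap.add_apply]; exact Submodule.add_mem _ h h'
  | single l b =>
    induction hy using Submodule.span_induction with
    | zero => simp
    | add x x' _ _ h h' => rw [map_add]; exact Submodule.add_mem _ h h'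
    | smul a x _ h => rw [map_smul]; exact Submodule.smul_mem _ _ h
    | mem y hy =>
      obtain ⟨s, hs, τ, rfl⟩ := hy
      have : nodeMap k g (Finsupp.single l b) (relVector s τ) = b • relVector s (inR g l τ) := by
        simp only [relVector, map_sub, map_sum,
          nodeMap_single, smul_sub, Finset.smul_sum, Finsupp.smul_single, smul_eq_mul, resolve]
      rw [this]
      exact Submodule.smul_mem _ _ (Submodule.subset_span ⟨s, hs, _, rfl⟩)

/-- The operation on the quotient by the relations. -/
def freeOp (g : P.Gen) : ((BinTree P.Gen →₀ k) ⧸ P.treeIdeal) →ₗ[k]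
    ((BinTree P.Gen →₀ k) ⧸ P.treeIdeal) →ₗ[k] ((BinTree P.Gen →₀ k) ⧸ P.treeIdeal) :=
  P.treeIdeal.liftQ ((Submodule.mapQLinear P.treeIdeal P.treeIdeal).comp
      ((nodeMap k g).codRestrict (Submodule.compatibleMaps P.treeIdeal P.treeIdeal)
        fun x _ hy => P.nodeMap_mem_right g x hy)) (by
      intro x hx
      rw [LinearMap.mem_ker]
      refine LinearMap.ext fun y => ?_
      obtain ⟨y, rfl⟩ := P.treeIdeal.mkQ_surjective y
      exact (Submodule.Quotient.mk_eq_zero _).2 (P.nodeMap_mem_left g hx y))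

theorem freeOp_mkQ (g : P.Gen) (x y : BinTree P.Gen →₀ k) :
    P.freeOp g (P.treeIdeal.mkQ x) (P.treeIdeal.mkQ y) = P.treeIdeal.mkQ (nodeMap k g x y) := rfl

/-- The free algebra on one generator. -/
def freeAlg : P.Alg ((BinTree P.Gen →₀ k) ⧸ P.treeIdeal) where
  op := P.freeOp
  relation s hs x y z := by
    obtain ⟨x, rfl⟩ := P.treeIdeal.mkQ_surjective x
    obtain ⟨y, rfl⟩ := P.treeIdeal.mkQ_surjective y
    obtain ⟨z, rfl⟩ := P.treeIdeal.mkQ_surjective z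
    simp only [freeOp_mkQ]
    induction x using Finsupp.induction_linear with
    | zero => simp
    | add x x' h h' => simp only [map_add, LinearMap.add_apply, smul_add, Finset.sum_add_distrib,
        h, h']
    | single x a =>
    induction y using Finsupp.induction_linear with
    | zero => simp
    | add x x' h h' => simp only [map_add, LinearMap.add_apply, smul_add, Finset.sum_add_distrib,
        h, h']
    | single y b =>
    induction z using Finsupp.induction_linear with
    | zero => simp
    | add x x' h h' => simp only [map_add, smul_add, Finset.sum_add_distrib, h, h']
    | single z c =>
    have h : (a * b * c) • relVector s (tri x y z) ∈ P.treeIdeal :=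
      Submodule.smul_mem _ _ (Submodule.subset_span ⟨s, hs, _, rfl⟩)
    have h' := (Submodule.Quotient.mk_eq_zero _).2 h
    rw [← Submodule.mkQ_apply, relVector, smul_sub, map_sub, sub_eq_zero] at h'
    simp only [← map_smul, ← map_sum, nodeMap_single]
    simp only [Finset.smul_sum, Finsupp.smul_single, smul_eq_mul, resolve] at h' ⊢
    simp only [mul_comm (s.1 _), mul_comm (s.2 _), ← mul_assoc]
    exact h'

theorem evalTree_freeAlg (t : BinTree P.Gen) :
    P.freeAlg.evalTree t (fun _ => P.treeIdeal.mkQ (Finsupp.single .leaf 1)) =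
      P.treeIdeal.mkQ (Finsupp.single t 1) := by
  induction t with
  | leaf => rfl
  | node g l r ihl ihr =>
    rw [Alg.evalTree, ihl, ihr]
    change P.freeOp g _ _ = _
    rw [freeOp_mkQ, nodeMap_single, one_mul]

/-- In the free algebra on one generator a tree evaluates, at the generator, to its own class, while
elements of the operadic ideal vanish in every algebra. This replaces the inductively defined ideal
by an explicit span. -/
theorem mem_treeIdeal {n : ℕ} {x : FreeOp k P.Gen n} (hx : x ∈ P.ideal n) :
    Finsupp.lmapDomain k k Subtype.val x ∈ P.treeIdeal := by
  have h := congrFun (P.freeAlg.evalFree_eq_zero hx)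
    fun _ => P.treeIdeal.mkQ (Finsupp.single .leaf 1)
  have e : P.freeAlg.evalFree n x (fun _ => P.treeIdeal.mkQ (Finsupp.single .leaf 1)) =
      P.treeIdeal.mkQ (Finsupp.lmapDomain k k Subtype.val x) := by
    clear h hx
    induction x using Finsupp.induction_linear with
    | zero => simp
    | add x y h h' => rw [map_add, Pi.add_apply, h, h', map_add, map_add]
    | single t a =>
      rw [Alg.evalFree_single, Pi.smul_apply, evalTree_freeAlg, ← map_smul,
        Finsupp.smul_single_one, Finsupp.lmapDomain_apply, Finsupp.mapDomain_single]
  rw [e] at h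
  exact (Submodule.Quotient.mk_eq_zero _).1 h

/-- The relations hold at each place of a tree. -/
theorem sum_treeClass_resolve {s : (P.Gen × P.Gen → k) × (P.Gen × P.Gen → k)} (hs : s ∈ P.rel)
    {n : ℕ} (τ : TernTree P.Gen) (hτ : τ.leaves = n) :
    ∑ x, s.1 x • P.treeClass (τ.resolve (true, x)) ((τ.leaves_resolve _).trans hτ) =
      ∑ x, s.2 x • P.treeClass (τ.resolve (false, x)) ((τ.leaves_resolve _).trans hτ) := by
  induction τ generalizing n with
  | tri x y z =>
    have h := P.opNode_relation hs (l := n) rfl (by rw [← hτ, leaves]) rfl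
      (by rw [← hτ, leaves, add_assoc]) (P.treeClass x rfl) (P.treeClass y rfl) (P.treeClass z rfl)
    simp only [opNode_treeClass] at h
    exact h
  | inL g m r ih =>
    have h := congrArg (fun p => P.opNode g (l := n) (by rw [← hτ, leaves]) p
      (P.treeClass r rfl)) (ih rfl)
    simp only [map_sum, map_smul, LinearMap.sum_apply, LinearMap.smul_apply,
      opNode_treeClass] at h
    exact h
  | inR g l m ih =>
    have h := congrArg (fun p => P.opNode g (l := n) (by rw [← hτ, leaves])
      (P.treeClass l rfl) p) (ih rfl)
    simp only [map_sum, map_smul, opNode_treeClass] at h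
    exact h

end QuadraticData
end

/-! ### Exactness in degree zero and the Koszul criterion. -/

noncomputable section

namespace TernTree

variable {G : Type}

theorem three_le_leaves (τ : TernTree G) : 3 ≤ τ.leaves := by
  induction τ with
  | tri x y z =>
    have := x.leaves_pos
    have := y.leaves_pos
    have := z.leaves_pos
    rw [leaves]
    omega
  | inL g m r ih => rw [leaves]; omega
  | inR g l m ih => rw [leaves]; omega

end TernTree

namespace QuadraticData

variable {k : Type u} [Field k] (P : QuadraticData k)

open TernTree

section

variable {P} {s : (P.Gen × P.Gen → k) × (P.Gen × P.Gen → k)} (hs : s ∈ P.dual.rel)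

/-- The function on trees with one ternary vertex that is given by a tree and a relation of the
quadratic dual. -/
def ternFun : TernTree P.Gen → DecTree P.Op → k
  | tri x y z => DecTree.rootProd (P.ternary hs) ![P.binFun x, P.binFun y, P.binFun z]
  | inL g m r => DecTree.rootProd (P.coord g) ![ternFun m, P.binFun r]
  | inR g l m => DecTree.rootProd (P.coord g) ![P.binFun l, ternFun m]

theorem isMultilinear_ternFun (τ : TernTree P.Gen) : DecTree.IsMultilinear k (ternFun hs τ) := by
  have hb := P.isMultilinear_binFun
  induction τ with
  | tri x y z =>
    refine DecTree.IsMultilinear.rootProd _ fun i => ?_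
    fin_cases i
    exacts [hb x, hb y, hb z]
  | inL g m r ih => exact DecTree.IsMultilinear.rootProd _ (Fin.forall_fin_two.2 ⟨ih, hb r⟩)
  | inR g l m ih => exact DecTree.IsMultilinear.rootProd _ (Fin.forall_fin_two.2 ⟨hb l, ih⟩)

theorem leaves_of_ternFun_ne_zero {τ : TernTree P.Gen} {T : DecTree P.Op}
    (h : ternFun hs τ T ≠ 0) : T.leaves = τ.leaves ∧ T.verts = τ.leaves - 2 := by
  have hb := fun t T => P.leaves_of_binFun_ne_zero (t := t) (T := T)
  induction τ generalizing T with
  | tri x y z =>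
    have h' := DecTree.leaves_of_rootProd_ne_zero (a := ![x.leaves, y.leaves, z.leaves])
      (b := ![x.verts, y.verts, z.verts]) (fun i => by
        fin_cases i
        exacts [hb x, hb y, hb z]) h
    rw [Fin.sum_univ_three, Fin.sum_univ_three] at h'
    change T.leaves = x.leaves + y.leaves + z.leaves ∧ T.verts = 1 + (x.verts + y.verts + z.verts)
      at h'
    have := x.verts_add_one
    have := y.verts_add_one
    have := z.verts_add_one
    rw [leaves]
    omega
  | inL g m r ih =>
    have := DecTree.leaves_of_rootProd_ne_zero (a := ![m.leaves, r.leaves])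
      (b := ![m.leaves - 2, r.verts]) (Fin.forall_fin_two.2 ⟨fun T => ih, hb r⟩) h
    rw [Fin.sum_univ_two, Fin.sum_univ_two] at this
    simp only [Matrix.cons_val_zero, Matrix.cons_val_one] at this
    have := r.verts_add_one
    have := m.three_le_leaves
    rw [leaves]
    omega
  | inR g l m ih =>
    have := DecTree.leaves_of_rootProd_ne_zero (a := ![l.leaves, m.leaves])
      (b := ![l.verts, m.leaves - 2]) (Fin.forall_fin_two.2 ⟨hb l, fun T => ih⟩) h
    rw [Fin.sum_univ_two, Fin.sum_univ_two] at this
    simp only [Matrix.cons_val_zero, Matrix.cons_val_one] at this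
    have := l.verts_add_one
    have := m.three_le_leaves
    rw [leaves]
    omega

theorem ternFun_mem {n : ℕ} {τ : TernTree P.Gen} (hτ : τ.leaves = n) :
    ternFun hs τ ∈ P.bar n 1 := by
  refine ⟨isMultilinear_ternFun hs τ, fun T hT => ?_⟩
  by_contra h
  obtain ⟨h₁, h₂⟩ := leaves_of_ternFun_ne_zero hs h
  have := τ.three_le_leaves
  exact hT (by omega)

theorem ternFun_ofBinTree (τ : TernTree P.Gen) (t : BinTree P.Gen) :
    ternFun hs τ (P.ofBinTree t) = 0 := by
  induction τ generalizing t with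
  | tri x y z =>
    cases t with
    | leaf => rfl
    | node g l r => exact DecTree.rootProd_node_of_ne _ _ _ _ _ (by decide)
  | inL g m r ih =>
    cases t with
    | leaf => rfl
    | node g' l' r' =>
      rw [ternFun, ofBinTree, DecTree.rootProd_node, Fin.prod_univ_two]
      simp [ih]
  | inR g l m ih =>
    cases t with
    | leaf => rfl
    | node g' l' r' =>
      rw [ternFun, ofBinTree, DecTree.rootProd_node, Fin.prod_univ_two]
      simp [ih]

theorem binFun_ofTernTree (t : BinTree P.Gen) (τ : TernTree P.Gen) (p : P.Op 3) :
    P.binFun t (P.ofTernTree p τ) = 0 := by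
  induction t generalizing τ with
  | leaf => cases τ <;> rfl
  | node g l r ihl ihr =>
    cases τ with
    | tri x y z => exact DecTree.rootProd_node_of_ne _ _ _ _ _ (by decide)
    | inL g' m r' =>
      rw [binFun, ofTernTree, DecTree.rootProd_node, Fin.prod_univ_two]
      simp [ihl]
    | inR g' l' m =>
      rw [binFun, ofTernTree, DecTree.rootProd_node, Fin.prod_univ_two]
      simp [ihr]

-- Together with `binFun_ofBinTree`, the functions `ternFun` detect the shape and labels of a tree
-- with one ternary vertex and read its decoration through `ternary`.
open Classical in
theorem ternFun_ofTernTree (τ τ' : TernTree P.Gen) (p : P.Op 3) :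
    ternFun hs τ (P.ofTernTree p τ') = if τ = τ' then P.ternary hs p else 0 := by
  induction τ generalizing τ' with
  | tri x y z =>
    cases τ' with
    | tri x' y' z' =>
      rw [ternFun, ofTernTree, DecTree.rootProd_node, Fin.prod_univ_three]
      change P.ternary hs p * (P.binFun x (P.ofBinTree x') * P.binFun y (P.ofBinTree y') *
        P.binFun z (P.ofBinTree z')) = _
      simp only [binFun_ofBinTree, tri.injEq]
      split_ifs <;> simp_all
    | inL g m r =>
      rw [if_neg (by simp)]
      exact DecTree.rootProd_node_of_ne _ _ _ _ _ (by decide)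
    | inR g m r =>
      rw [if_neg (by simp)]
      exact DecTree.rootProd_node_of_ne _ _ _ _ _ (by decide)
  | inL g m r ih =>
    cases τ' with
    | tri x' y' z' =>
      rw [if_neg (by simp)]
      exact DecTree.rootProd_node_of_ne _ _ _ _ _ (by decide)
    | inL g' m' r' =>
      rw [ternFun, ofTernTree, DecTree.rootProd_node, Fin.prod_univ_two]
      simp only [Matrix.cons_val_zero, Matrix.cons_val_one, coord_gen, ih, binFun_ofBinTree,
        inL.injEq]
      split_ifs <;> simp_all
    | inR g' l' m' =>
      rw [ternFun, ofTernTree, DecTree.rootProd_node, Fin.prod_univ_two]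
      simp [ternFun_ofBinTree]
  | inR g l m ih =>
    cases τ' with
    | tri x' y' z' =>
      rw [if_neg (by simp)]
      exact DecTree.rootProd_node_of_ne _ _ _ _ _ (by decide)
    | inL g' m' r' =>
      rw [ternFun, ofTernTree, DecTree.rootProd_node, Fin.prod_univ_two]
      simp [binFun_ofTernTree]
    | inR g' l' m' =>
      rw [ternFun, ofTernTree, DecTree.rootProd_node, Fin.prod_univ_two]
      simp only [Matrix.cons_val_zero, Matrix.cons_val_one, coord_gen, ih, binFun_ofBinTree,
        inR.injEq]
      split_ifs <;> simp_all

open Classical in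
theorem linearCombination_ite_fst {α β : Type*} [Fintype β] (a : α) (φ : β → k) (v : α × β →₀ k) :
    Finsupp.linearCombination k (fun x => if a = x.1 then φ x.2 else 0) v =
      ∑ b, v (a, b) * φ b := by
  induction v using Finsupp.induction_linear with
  | zero => simp
  | add v w hv hw => simp only [map_add, hv, hw, Finsupp.add_apply, add_mul, Finset.sum_add_distrib]
  | single x c =>
    obtain ⟨a', b'⟩ := x
    by_cases h : a = a'
    · subst h
      simp [Finsupp.single_apply]
    · simp [h]

theorem sum_comb {M : Type*} [AddCommGroup M] [Module k M] (φ : Bool × P.Gen × P.Gen → k)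
    (ψ : Bool × P.Gen × P.Gen → M) : ∑ e, ((combSign e : k) * φ e) • ψ e =
      ∑ x, φ (true, x) • ψ (true, x) - ∑ x, φ (false, x) • ψ (false, x) := by
  rw [Fintype.sum_prod_type, Fintype.sum_bool, sub_eq_add_neg, ← Finset.sum_neg_distrib]
  simp [combSign]

theorem ternary_combClass (x : P.Gen × P.Gen) :
    P.ternary hs (P.combClass (true, x)) = s.1 x ∧ P.ternary hs (P.combClass (false, x)) = s.2 x :=
  ⟨P.ternary_leftComb hs x.1 x.2, P.ternary_rightComb hs x.1 x.2⟩

/-- Only the resolutions of `τ` contribute. Their decorations give the coefficients of `s`, and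
`combSign` supplies the minus sign between its two halves. -/
theorem sign_mul_barD_ternFun (τ : TernTree P.Gen) (t : BinTree P.Gen) :
    (t.sign : k) * P.barD (ternFun hs τ) (P.ofBinTree t) = τ.sign * relVector s τ t := by
  classical
  rw [barD_ofBinTree]
  simp only [ternFun_ofTernTree]
  rw [linearCombination_ite_fst τ (fun e => P.ternary hs (P.combClass e)), Finset.mul_sum]
  have e : ∀ e, (t.sign : k) * (t.edges k (τ, e) * P.ternary hs (P.combClass e)) =
      τ.sign * ((combSign e * P.ternary hs (P.combClass e)) •
        (if t = τ.resolve e then (1 : k) else 0)) := by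
    intro e
    rw [← mul_assoc, BinTree.sign_mul_edges]
    split_ifs
    · simp only [smul_eq_mul]
      ring
    · simp
  simp only [e]
  rw [← Finset.mul_sum, sum_comb]
  simp only [ternary_combClass, relVector, Finsupp.sub_apply, Finsupp.finsetSum_apply,
    Finsupp.single_apply, smul_eq_mul, mul_ite, mul_one, mul_zero, eq_comm (a := t)]

end

/-- The decoration of the ternary vertex lives in the operad, where the relations are zero, so a
linear function of it annihilates them. -/
theorem mem_dual_rel {f : DecTree P.Op → k} (hf : DecTree.IsMultilinear k f)
    (τ : TernTree P.Gen) : ((fun x => f (P.ofTernTree (P.combClass (true, x)) τ),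
      fun x => f (P.ofTernTree (P.combClass (false, x)) τ)) :
      (P.Gen × P.Gen → k) × (P.Gen × P.Gen → k)) ∈ P.dual.rel := by
  intro r hr
  have h0 : (P.ideal 3).mkQ (relator r.1 r.2) = 0 :=
    (Submodule.Quotient.mk_eq_zero _).2 (InIdeal.rel hr)
  have h1 := congrArg ((P.isLinearMap_ofTernTree hf τ).mk' _) h0
  rw [mkQ_relator, map_zero, map_sub, map_sum, map_sum] at h1
  simp only [map_smul, smul_eq_mul, IsLinearMap.mk'_apply] at h1
  simp only [mul_comm _ (r.1 _), mul_comm _ (r.2 _)]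
  exact h1

open Classical in
/-- The class of a tree in the quadratic dual, zero for trees of the wrong arity. -/
def dualClass (n : ℕ) (t : BinTree P.Gen) : P.dual.Op n :=
  if h : t.leaves = n then P.dual.treeClass t h else 0

theorem barAug_eq_sum (n : ℕ) [Fintype {t : BinTree P.Gen // t.leaves = n}]
    (f : DecTree P.Op → k) : P.barAug n f = ∑ t : {t : BinTree P.Gen // t.leaves = n},
      ((t.1.sign : k) * f (P.ofBinTree t.1)) • P.dualClass n t.1 := by
  classical
  have e : ∀ φ : {t : BinTree P.Gen // t.leaves = n} → k,
      (Finsupp.linearEquivFunOnFinite k k {t : BinTree P.Gen // t.leaves = n}).symm φ =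
        ∑ t, φ t • Finsupp.single t (1 : k) := by
    intro φ
    refine Finsupp.ext fun t => ?_
    rw [Finsupp.finsetSum_apply]
    simp [Finsupp.single_apply]
  let L : ({t : BinTree P.Gen // t.leaves = n} →₀ k) →ₗ[k] P.dual.Op n := (P.dual.ideal n).mkQ
  have h : P.barAug n f = L ((Finsupp.linearEquivFunOnFinite k k _).symm
      fun t => (t.1.sign : k) * f (P.ofBinTree t.1)) := rfl
  rw [h, e, map_sum]
  refine Finset.sum_congr rfl fun t _ => ?_
  rw [map_smul, dualClass, dif_pos t.2]
  rfl

theorem sum_resolve_dualClass {f : DecTree P.Op → k} (hf : DecTree.IsMultilinear k f) {n : ℕ}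
    (τ : TernTree P.Gen) (hτ : τ.leaves = n) :
    ∑ e, ((combSign e : k) * f (P.ofTernTree (P.combClass e) τ)) •
      P.dualClass n (τ.resolve e) = 0 := by
  rw [sum_comb, sub_eq_zero]
  have h := P.dual.sum_treeClass_resolve (P.mem_dual_rel hf τ) τ hτ
  have e : ∀ e, P.dualClass n (τ.resolve e) =
      P.dual.treeClass (τ.resolve e) ((τ.leaves_resolve e).trans hτ) := fun e => dif_pos _
  simp only [e]
  exact h

/-- Grouped by the contracted tree `τ`, the sum consists of the values of `f` at the resolutions of
`τ`. These form a relation of the dual, inserted at the place given by `τ`, hence zero in the dual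
operad. -/
theorem barAug_barD {f : DecTree P.Op → k} (hf : DecTree.IsMultilinear k f) (n : ℕ) :
    P.barAug n (P.barD f) = 0 := by
  classical
  let _ : Fintype {t : BinTree P.Gen // t.leaves = n} := Fintype.ofFinite _
  -- A finite set containing every tree that arises by contracting an edge of a binary tree with `n`
  -- leaves.
  set S : Finset (TernTree P.Gen) := (Finset.univ.biUnion
    fun t : {t : BinTree P.Gen // t.leaves = n} => (t.1.edges k).support).image Prod.fst with hS
  have hleaves : ∀ τ ∈ S, τ.leaves = n := by
    intro τ hτ
    rw [hS, Finset.mem_image] at hτ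
    obtain ⟨⟨τ, e⟩, hx, rfl⟩ := hτ
    obtain ⟨t, -, ht⟩ := Finset.mem_biUnion.1 hx
    have h := t.1.sign_mul_edges (k := k) τ e
    by_cases h' : t.1 = τ.resolve e
    · rw [← τ.leaves_resolve e, ← h', t.2]
    · rw [if_neg h'] at h
      have hsq : (t.1.sign : k) * t.1.sign = 1 := by
        rw [← Int.cast_mul, t.1.sign_mul_self, Int.cast_one]
      have h0 : t.1.edges k (τ, e) = 0 := by
        linear_combination (t.1.sign : k) * h - t.1.edges k (τ, e) * hsq
      exact (Finsupp.mem_support_iff.1 ht h0).elim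
  have key : ∀ t : {t : BinTree P.Gen // t.leaves = n},
      (t.1.sign : k) * P.barD f (P.ofBinTree t.1) = ∑ τ ∈ S, ∑ e, if t.1 = τ.resolve e then
        (τ.sign : k) * (combSign e * f (P.ofTernTree (P.combClass e) τ)) else 0 := by
    intro t
    rw [barD_ofBinTree, Finsupp.linearCombination_apply, Finsupp.sum_of_support_subset
      (s := S ×ˢ Finset.univ) _ _ _ (by simp), Finset.mul_sum, Finset.sum_product]
    · refine Finset.sum_congr rfl fun τ _ => Finset.sum_congr rfl fun e _ => ?_
      rw [smul_eq_mul, ← mul_assoc, BinTree.sign_mul_edges]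
      split_ifs
      · ring
      · simp
    · intro x hx
      refine Finset.mem_product.2 ⟨Finset.mem_image_of_mem _ ?_, Finset.mem_univ _⟩
      exact Finset.mem_biUnion.2 ⟨t, Finset.mem_univ _, hx⟩
  rw [barAug_eq_sum]
  simp only [key, Finset.sum_smul]
  rw [Finset.sum_comm]
  refine Finset.sum_eq_zero fun τ hτ => ?_
  rw [Finset.sum_comm]
  have h : ∀ e, ∑ t : {t : BinTree P.Gen // t.leaves = n}, (if t.1 = τ.resolve e then
      (τ.sign : k) * (combSign e * f (P.ofTernTree (P.combClass e) τ)) else 0) •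
        P.dualClass n t.1 = (τ.sign : k) • ((combSign e * f (P.ofTernTree (P.combClass e) τ)) •
        P.dualClass n (τ.resolve e)) := by
    intro e
    rw [Finset.sum_eq_single ⟨τ.resolve e, (τ.leaves_resolve e).trans (hleaves τ hτ)⟩]
    · rw [if_pos rfl, smul_smul]
    · intro t _ ht
      rw [if_neg fun h => ht (Subtype.ext h), zero_smul]
    · simp
  simp only [h]
  rw [← Finset.smul_sum, P.sum_resolve_dualClass hf τ (hleaves τ hτ), smul_zero]

theorem exists_barD_of_mem_treeIdeal (n : ℕ) {y : BinTree P.dual.Gen →₀ k}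
    (hy : y ∈ P.dual.treeIdeal) : ∃ g ∈ P.bar n 1, ∀ t : BinTree P.Gen, t.leaves = n →
      (t.sign : k) * P.barD g (P.ofBinTree t) = y t := by
  induction hy using Submodule.span_induction with
  | mem y hy =>
    obtain ⟨s, hs, τ, rfl⟩ := hy
    change TernTree P.Gen at τ
    by_cases hτ : τ.leaves = n
    · refine ⟨(τ.sign : k) • ternFun hs τ, Submodule.smul_mem _ _ (ternFun_mem hs hτ),
        fun t _ => ?_⟩
      have hsq : (τ.sign : k) * τ.sign = 1 := by
        rw [← Int.cast_mul, τ.sign_mul_self, Int.cast_one]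
      have h := sign_mul_barD_ternFun hs τ t
      rw [map_smul, Pi.smul_apply, smul_eq_mul, mul_left_comm, h, ← mul_assoc, hsq, one_mul]
      rfl
    · refine ⟨0, Submodule.zero_mem _, fun t ht => ?_⟩
      have h : ∀ e, τ.resolve e ≠ t := fun e h => hτ (by rw [← τ.leaves_resolve e, h, ht])
      rw [map_zero, Pi.zero_apply, mul_zero]
      change 0 = relVector (G := P.Gen) s τ t
      simp [relVector, h]
  | zero => exact ⟨0, Submodule.zero_mem _, fun t _ => by
      rw [map_zero, Pi.zero_apply, mul_zero]
      rfl⟩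
  | add x y _ _ hx hy =>
    obtain ⟨g, hg, h⟩ := hx
    obtain ⟨g', hg', h'⟩ := hy
    refine ⟨g + g', Submodule.add_mem _ hg hg', fun t ht => ?_⟩
    rw [map_add, Pi.add_apply, mul_add, h t ht, h' t ht]
    rfl
  | smul a x _ hx =>
    obtain ⟨g, hg, h⟩ := hx
    refine ⟨a • g, Submodule.smul_mem _ _ hg, fun t ht => ?_⟩
    rw [map_smul, Pi.smul_apply, smul_eq_mul, mul_left_comm, h t ht]
    rfl

/-- If the augmentation kills `f`, its signed values on binary trees form an element of the ideal of
the dual, a combination of relations at places of trees, and each of these is a coboundary of some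
`ternFun`. Functions in degree zero are determined by their values on binary trees. -/
theorem LeftPBW.exact_bar_zero {P : QuadraticData k} (B : P.LeftPBW) (n : ℕ) :
    (P.bar n 1).map P.barD = P.bar n 0 ⊓ LinearMap.ker (P.barAug n) := by
  refine le_antisymm ?_ ?_
  · rintro _ ⟨f, hf, rfl⟩
    exact ⟨B.barD_mem hf, P.barAug_barD hf.1 n⟩
  · rintro f ⟨hf, hd⟩
    have h₁ := (Submodule.Quotient.mk_eq_zero _).1 ((P.barAug_apply n f).symm.trans hd)
    obtain ⟨g, hg, h⟩ := P.exists_barD_of_mem_treeIdeal n (P.dual.mem_treeIdeal h₁)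
    refine ⟨g, hg, ?_⟩
    have hmem := Submodule.sub_mem _ hf (B.barD_mem hg)
    refine (sub_eq_zero.1 (funext fun T => ?_)).symm
    by_cases hT : T.leaves = n ∧ T.verts + 0 + 1 = n
    swap
    · exact hmem.2 T hT
    refine P.eq_zero_of_ofBinTree hmem.1 (by omega) fun t ht => ?_
    have ht' : t.leaves = n := ht.trans hT.1
    have h₂ := h t ht'
    have e : (t.sign : k) * P.barD g (P.ofBinTree t) = t.sign * f (P.ofBinTree t) :=
      h₂.trans (Finsupp.mapDomain_apply Subtype.val_injective _
        (⟨t, ht'⟩ : {t : BinTree P.Gen // t.leaves = n}))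
    have hsq : (t.sign : k) * t.sign = 1 := by
      rw [← Int.cast_mul, t.sign_mul_self, Int.cast_one]
    rw [Pi.sub_apply]
    linear_combination (-(t.sign : k)) * e - (f (P.ofBinTree t) - P.barD g (P.ofBinTree t)) * hsq

theorem LeftPBW.isKoszul {P : QuadraticData k} (B : P.LeftPBW) : P.IsKoszul :=
  fun n => ⟨P.map_barAug n, B.exact_bar_zero n, fun i => B.exact_bar n i⟩

end QuadraticData
end

/-! ### Products of presentations and the dendriform operad. -/

noncomputable section

namespace LeftRewriting

/-- The product of two rewriting systems. -/
def prod {G H : Type} [Fintype G] [Fintype H] (R : LeftRewriting G) (S : LeftRewriting H) :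
    LeftRewriting (G × H) where
  red a b := R.red a.1 b.1 ∧ S.red a.2 b.2
  coeff a b p q := R.coeff a.1 b.1 p.1 q.1 * S.coeff a.2 b.2 p.2 q.2
  red_left h h' :=
    ⟨R.red_left (left_ne_zero_of_mul h) h'.1, S.red_left (right_ne_zero_of_mul h) h'.2⟩
  red_right h h' :=
    ⟨R.red_right (left_ne_zero_of_mul h) h'.1, S.red_right (right_ne_zero_of_mul h) h'.2⟩
  -- The sum over pairs factors, and a pair irreducible in the product is irreducible in one factor,
  -- whose sum vanishes.
  overlap_zero {a' a b q s} r h h' hn := by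
    have e : ∑ p : G × H, (R.coeff a'.1 a.1 p.1 q.1 * S.coeff a'.2 a.2 p.2 q.2) *
        (R.coeff p.1 b.1 r.1 s.1 * S.coeff p.2 b.2 r.2 s.2) =
        (∑ p, R.coeff a'.1 a.1 p q.1 * R.coeff p b.1 r.1 s.1) *
          ∑ p, S.coeff a'.2 a.2 p q.2 * S.coeff p b.2 r.2 s.2 := by
      rw [Fintype.sum_mul_sum, Fintype.sum_prod_type]
      exact Finset.sum_congr rfl fun _ _ => Finset.sum_congr rfl fun _ _ => by ring
    rw [e]
    by_cases h₁ : R.red q.1 s.1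
    · rw [S.overlap_zero r.2 h.2 h'.2 fun h₂ => hn ⟨h₁, h₂⟩, mul_zero]
    · rw [R.overlap_zero r.1 h.1 h'.1 h₁, zero_mul]
  overlap {a' a b} r w v h h' := by
    have e₁ := R.overlap r.1 w.1 v.1 h.1 h'.1
    have e₂ := S.overlap r.2 w.2 v.2 h.2 h'.2
    have e : ∀ q s : G × H, ∑ p : G × H, (R.coeff a'.1 a.1 p.1 q.1 * S.coeff a'.2 a.2 p.2 q.2) *
        (R.coeff p.1 b.1 r.1 s.1 * S.coeff p.2 b.2 r.2 s.2) =
        (∑ p, R.coeff a'.1 a.1 p q.1 * R.coeff p b.1 r.1 s.1) *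
          ∑ p, S.coeff a'.2 a.2 p q.2 * S.coeff p b.2 r.2 s.2 := by
      intro q s
      rw [Fintype.sum_mul_sum, Fintype.sum_prod_type]
      exact Finset.sum_congr rfl fun _ _ => Finset.sum_congr rfl fun _ _ => by ring
    have e' : ∑ p : G × H, (R.coeff a.1 b.1 p.1 v.1 * S.coeff a.2 b.2 p.2 v.2) *
        (R.coeff a'.1 p.1 r.1 w.1 * S.coeff a'.2 p.2 r.2 w.2) =
        (∑ p, R.coeff a.1 b.1 p v.1 * R.coeff a'.1 p r.1 w.1) *
          ∑ p, S.coeff a.2 b.2 p v.2 * S.coeff a'.2 p r.2 w.2 := by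
      rw [Fintype.sum_mul_sum, Fintype.sum_prod_type]
      exact Finset.sum_congr rfl fun _ _ => Finset.sum_congr rfl fun _ _ => by ring
    rw [e', ← e₁, ← e₂]
    simp only [e]
    rw [Fintype.sum_mul_sum, Fintype.sum_prod_type]
    refine Finset.sum_congr rfl fun q _ => Finset.sum_congr rfl fun q' _ => ?_
    rw [Fintype.sum_mul_sum, Fintype.sum_prod_type]
    exact Finset.sum_congr rfl fun _ _ => Finset.sum_congr rfl fun _ _ => by ring

/-- The coefficients of the rewriting system of the dendriform operad for the operations `≺`
and `≺ + ≻`; the label `succ` stands for the latter. -/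
def dendCoeff : DendOp → DendOp → DendOp → DendOp → ℤ
  | .prec, .prec, .prec, .succ => 1
  | .succ, .prec, .prec, .succ => 1
  | .succ, .prec, .succ, .prec => 1
  | .succ, .prec, .prec, .prec => -1
  | .succ, .succ, .succ, .succ => 1
  | _, _, _, _ => 0

/-- The rewriting system of the dendriform operad. -/
def dend : LeftRewriting DendOp where
  red a b := ¬ (a = .prec ∧ b = .succ)
  coeff := dendCoeff
  -- The coefficients are integers and there are two labels, so all conditions are finite decidable
  -- checks, valid over any field after casting.
  red_left {a' a b p q} := by revert a' a b p q; decide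
  red_right {a' a b p q} := by revert a' a b p q; decide
  overlap_zero {a' a b q s} := by revert a' a b q s; decide
  overlap {a' a b} := by revert a' a b; decide

end LeftRewriting

namespace QuadraticData

variable {k : Type u} [Field k]

/-- The product of relations. -/
def relMul (k : Type u) [Field k] (G H : Type) :
    ((G × G → k) × (G × G → k)) →ₗ[k] ((H × H → k) × (H × H → k)) →ₗ[k]
      (((G × H) × (G × H) → k) × ((G × H) × (G × H) → k)) :=
  LinearMap.mk₂ k (fun s t => (fun x => s.1 (x.1.1, x.2.1) * t.1 (x.1.2, x.2.2),
      fun x => s.2 (x.1.1, x.2.1) * t.2 (x.1.2, x.2.2)))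
    (fun _ _ _ => Prod.ext (funext fun _ => add_mul _ _ _) (funext fun _ => add_mul _ _ _))
    (fun _ _ _ => Prod.ext (funext fun _ => mul_assoc _ _ _) (funext fun _ => mul_assoc _ _ _))
    (fun _ _ _ => Prod.ext (funext fun _ => mul_add _ _ _) (funext fun _ => mul_add _ _ _))
    (fun _ _ _ => Prod.ext (funext fun _ => mul_left_comm _ _ _)
      (funext fun _ => mul_left_comm _ _ _))

/-- As the image of a bilinear map, this space is spanned by the products of any two spanning sets,
in particular of the rules of two presentations. -/
theorem blackSquare_rel (P Q : QuadraticData k) : (P.blackSquare Q).rel =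
    Submodule.map₂ (relMul k P.Gen Q.Gen) P.rel Q.rel := by
  rw [Submodule.map₂_eq_span_image2]
  refine congrArg (Submodule.span k) (Set.ext fun r => ?_)
  constructor
  · rintro ⟨s, hs, t, ht, rfl⟩
    exact ⟨s, hs, t, ht, rfl⟩
  · rintro ⟨s, hs, t, ht, rfl⟩
    exact ⟨s, hs, t, ht, rfl⟩

namespace LeftPBW

theorem ite_mul_ite_eq {G H : Type} [DecidableEq G] [DecidableEq H] [DecidableEq (G × H)]
    (a b : G × H) : (if a.1 = b.1 then (1 : k) else 0) * (if a.2 = b.2 then 1 else 0) =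
      if a = b then 1 else 0 := by
  simp only [Prod.ext_iff, ite_and, mul_ite, mul_one, mul_zero]
  split_ifs <;> rfl

/-- The product of two presentations presents the black square product. -/
def prod {P Q : QuadraticData k} (B : P.LeftPBW) (C : Q.LeftPBW) : (P.blackSquare Q).LeftPBW where
  R := B.R.prod C.R
  β a b := B.β a.1 b.1 * C.β a.2 b.2
  α a b := B.α a.1 b.1 * C.α a.2 b.2
  β_α a b := by
    have e : ∑ h : P.Gen × Q.Gen, (B.β a.1 h.1 * C.β a.2 h.2) * (B.α h.1 b.1 * C.α h.2 b.2) =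
        (∑ h, B.β a.1 h * B.α h b.1) * ∑ h, C.β a.2 h * C.α h b.2 := by
      rw [Fintype.sum_mul_sum, Fintype.sum_prod_type]
      exact Finset.sum_congr rfl fun _ _ => Finset.sum_congr rfl fun _ _ => by ring
    refine e.trans ?_
    rw [B.β_α, C.β_α]
    exact ite_mul_ite_eq a b
  α_β a b := by
    have e : ∑ h : P.Gen × Q.Gen, (B.α a.1 h.1 * C.α a.2 h.2) * (B.β h.1 b.1 * C.β h.2 b.2) =
        (∑ h, B.α a.1 h * B.β h b.1) * ∑ h, C.α a.2 h * C.β h b.2 := by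
      rw [Fintype.sum_mul_sum, Fintype.sum_prod_type]
      exact Finset.sum_congr rfl fun _ _ => Finset.sum_congr rfl fun _ _ => by ring
    refine e.trans ?_
    rw [B.α_β, C.α_β]
    exact ite_mul_ite_eq a b
  rel_eq := by
    rw [blackSquare_rel, B.rel_eq, C.rel_eq, Submodule.map₂_span_span]
    -- The product of two rules is the rule for the pairs of labels, with the product coefficients.
    have key : ∀ a b a' b', relMul k P.Gen Q.Gen
        (fun x => B.β a x.1 * B.β b x.2,
          fun x => ∑ p, ∑ q, (B.R.coeff a b p q : k) * (B.β p x.1 * B.β q x.2))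
        (fun x => C.β a' x.1 * C.β b' x.2,
          fun x => ∑ p, ∑ q, (C.R.coeff a' b' p q : k) * (C.β p x.1 * C.β q x.2)) =
        (fun x => (B.β a x.1.1 * C.β a' x.1.2) * (B.β b x.2.1 * C.β b' x.2.2),
          fun x => ∑ p : P.Gen × Q.Gen, ∑ q : P.Gen × Q.Gen,
            (((B.R.coeff a b p.1 q.1 * C.R.coeff a' b' p.2 q.2 : ℤ)) : k) *
              ((B.β p.1 x.1.1 * C.β p.2 x.1.2) * (B.β q.1 x.2.1 * C.β q.2 x.2.2))) := by
      intro a b a' b'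
      refine Prod.ext (funext fun _ => mul_mul_mul_comm _ _ _ _) (funext fun x => ?_)
      refine (Fintype.sum_mul_sum _ _).trans ?_
      dsimp only
      rw [Fintype.sum_prod_type]
      refine Finset.sum_congr rfl fun p _ => Finset.sum_congr rfl fun p' _ => ?_
      rw [Fintype.sum_mul_sum, Fintype.sum_prod_type]
      refine Finset.sum_congr rfl fun q _ => Finset.sum_congr rfl fun q' _ => ?_
      push_cast
      ring
    refine congrArg (Submodule.span k) (Set.ext fun r => ?_)
    constructor
    · rintro ⟨_, ⟨a, b, h, rfl⟩, _, ⟨a', b', h', rfl⟩, rfl⟩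
      exact ⟨(a, a'), (b, b'), ⟨h, h'⟩, key a b a' b'⟩
    · rintro ⟨⟨a, a'⟩, ⟨b, b'⟩, ⟨h, h'⟩, rfl⟩
      exact ⟨_, ⟨a, b, h, rfl⟩, _, ⟨a', b', h', rfl⟩, key a b a' b'⟩

/-- The coordinates of the operations `≺` and `≺ + ≻`. -/
def dendβ (k : Type u) [Field k] : DendOp → DendOp → k
  | .prec, .prec => 1
  | .prec, .succ => 0
  | .succ, _ => 1

/-- The inverse of `dendβ`. -/
def dendα (k : Type u) [Field k] : DendOp → DendOp → k
  | .prec, .prec => 1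
  | .prec, .succ => 0
  | .succ, .prec => -1
  | .succ, .succ => 1

theorem sum_dendOp {M : Type*} [AddCommMonoid M] (f : DendOp → M) :
    ∑ a, f a = f .prec + f .succ :=
  Finset.sum_pair (by decide)

theorem sum_dendβ_dendα (a b : DendOp) :
    ∑ h, dendβ k a h * dendα k h b = if a = b then 1 else 0 := by
  rw [sum_dendOp]
  cases a <;> cases b <;> simp [dendα, dendβ]

theorem sum_dendα_dendβ (a b : DendOp) :
    ∑ h, dendα k a h * dendβ k h b = if a = b then 1 else 0 := by
  rw [sum_dendOp]
  cases a <;> cases b <;> simp [dendα, dendβ]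

/-- The relation `(x a y) b z = ∑ x p (y q z)` of the dendriform operad. -/
def dendRel (k : Type u) [Field k] (a b : DendOp) :
    (DendOp × DendOp → k) × (DendOp × DendOp → k) :=
  (fun x => dendβ k a x.1 * dendβ k b x.2,
    fun x => ∑ p, ∑ q, (LeftRewriting.dendCoeff a b p q : k) * (dendβ k p x.1 * dendβ k q x.2))

theorem dendRel_prec_prec : dendRel k .prec .prec =
    (Pi.single (.prec, .prec) 1, Pi.single (.prec, .prec) 1 + Pi.single (.prec, .succ) 1) := by
  refine Prod.ext (funext fun x => ?_) (funext fun x => ?_) <;> obtain ⟨_ | _, _ | _⟩ := x <;>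
    simp [dendRel, dendβ, LeftRewriting.dendCoeff, sum_dendOp]

/-- Adding the first two dendriform relations gives `(x * y) ≺ z`; the coefficient `-1` comes from
`≻ = * - ≺`. -/
theorem dendRel_succ_prec : dendRel k .succ .prec = dendRel k .prec .prec +
    (Pi.single (.succ, .prec) 1, Pi.single (.succ, .prec) 1) := by
  refine Prod.ext (funext fun x => ?_) (funext fun x => ?_) <;> obtain ⟨_ | _, _ | _⟩ := x <;>
    simp [dendRel, dendβ, LeftRewriting.dendCoeff, sum_dendOp]

/-- The sum of all three relations is the associativity of `*`. -/
theorem dendRel_succ_succ : dendRel k .succ .succ = dendRel k .succ .prec +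
    (Pi.single (.prec, .succ) 1 + Pi.single (.succ, .succ) 1, Pi.single (.succ, .succ) 1) := by
  refine Prod.ext (funext fun x => ?_) (funext fun x => ?_) <;> obtain ⟨_ | _, _ | _⟩ := x <;>
    simp [dendRel, dendβ, LeftRewriting.dendCoeff, sum_dendOp]

/-- The defining relations of the dendriform operad. -/
def dendRelators (k : Type u) [Field k] : Set ((DendOp × DendOp → k) × (DendOp × DendOp → k)) :=
  {(Pi.single (.prec, .prec) 1, Pi.single (.prec, .prec) 1 + Pi.single (.prec, .succ) 1),
    (Pi.single (.succ, .prec) 1, Pi.single (.succ, .prec) 1),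
    (Pi.single (.prec, .succ) 1 + Pi.single (.succ, .succ) 1, Pi.single (.succ, .succ) 1)}

/-- The three rules are the partial sums of the three defining relations, a unitriangular change of
spanning set. -/
theorem span_dendRelators : Submodule.span k (dendRelators k) =
    Submodule.span k {r | ∃ a b, LeftRewriting.dend.red a b ∧ r = dendRel k a b} := by
  set S := Submodule.span k {r | ∃ a b, LeftRewriting.dend.red a b ∧ r = dendRel k a b}
  have h : ∀ a b, LeftRewriting.dend.red a b → dendRel k a b ∈ S := fun a b hab =>
    Submodule.subset_span ⟨a, b, hab, rfl⟩
  have h₁ := h .prec .prec (fun h => by simp at h)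
  have h₂ := h .succ .prec (fun h => by simp at h)
  have h₃ := h .succ .succ (fun h => by simp at h)
  refine le_antisymm (Submodule.span_le.2 ?_) (Submodule.span_le.2 ?_)
  · rintro r (rfl | rfl | rfl)
    · rw [← dendRel_prec_prec]
      exact h₁
    · rw [dendRel_succ_prec] at h₂
      exact (Submodule.add_mem_iff_right _ h₁).1 h₂
    · rw [dendRel_succ_succ] at h₃
      exact (Submodule.add_mem_iff_right _ h₂).1 h₃
  · have e₁ : dendRel k .prec .prec ∈ Submodule.span k (dendRelators k) := by
      rw [dendRel_prec_prec]
      exact Submodule.subset_span (Or.inl rfl)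
    have e₂ : dendRel k .succ .prec ∈ Submodule.span k (dendRelators k) := by
      rw [dendRel_succ_prec]
      exact Submodule.add_mem _ e₁ (Submodule.subset_span (Or.inr (Or.inl rfl)))
    rintro r ⟨_ | _, _ | _, hab, rfl⟩
    · exact e₁
    · exact (hab ⟨rfl, rfl⟩).elim
    · exact e₂
    · rw [dendRel_succ_succ]
      exact Submodule.add_mem _ e₂ (Submodule.subset_span (Or.inr (Or.inr rfl)))

/-- The presentation of the dendriform operad by the operations `≺` and `≺ + ≻`. -/
def dend (k : Type u) [Field k] : (Dend k).LeftPBW where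
  R := LeftRewriting.dend
  β := dendβ k
  α := dendα k
  β_α := sum_dendβ_dendα
  α_β := sum_dendα_dendβ
  rel_eq := span_dendRelators

/-- The presentations of the black square powers of the dendriform operad. -/
def dendPow (k : Type u) [Field k] : ∀ m : ℕ, ((Dend k).blackPow (m + 1)).LeftPBW
  | 0 => dend k
  | m + 1 => (dendPow k m).prod (dend k)

end LeftPBW

end QuadraticData
end

theorem theorem5p1 (k : Type*) [Field k] [IsAlgClosed k] [CharZero k] (m : ℕ) (hm : 1 ≤ m) :
    ((Dend k).blackPow m).IsKoszul := by
  obtain ⟨m, rfl⟩ := Nat.exists_eq_add_of_le' hm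
  exact (QuadraticData.LeftPBW.dendPow k m).isKoszul
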